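/- Let $g_2,g_3\in\mathbb C[u]$ with $\deg g_2\le 2$, $\deg g_3\le 3$, and suppose that the discriminant $\Delta=g_2^3-27g_3^2$ has degree $N_f+2$ (with $N_f\ge 0$ an integer) and only simple zeros $u_1^*,\dots,u_{N_f+2}^*$. Let $U=\{u\in\mathbb C:\Delta(u)\ne 0\}$. For $u\in U$ let $E_u$ be the elliptic curve $y^2=4x^3-g_2(u)x-g_3(u)$; there are period lattices $\Lambda_u\subset\mathbb C$ with invariants $g_2(u),g_3(u)$, so that $E_u\cong\mathbb C/\Lambda_u$ by $z\mapsto(\wp(z),\wp'(z))$ and $dz=dx/y$. Let $\mathrm D=\bar\partial+\bar\partial_1:\Omega^{0,0}(E_u)\oplus\Omega^{1,0}(E_u)\to\Omega^{0,1}(E_u)\oplus\Omega^{1,1}(E_u)$ be the signature operator along the fibre, and let $\mathrm{DET}\,\mathrm D\to U$ be its determinant line bundle, with fibres $$[H^{0,0}(E_u)\otimes H^{1,0}(E_u)]^{-1}\otimes[H^{0,1}(E_u)\otimes H^{1,1}(E_u)].$$ It carries the holomorphic structure coming from holomorphic functions and holomorphic relative one-forms on the elliptic surface, the Quillen metric $\|\cdot\|_Q=\big((2\pi)^2\sqrt{\det{}'\Delta_{E_u}}\big)^2\|\cdot\|_{L^2}$,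 where $\det'\Delta_{E_u}$ is the zeta-regularized determinant of $-4\partial_z\partial_{\bar z}$ on $E_u$ and the $L^2$-norms are those of the flat metric $|dz|^2$, and the Bismut–Freed connection, which is the unitary connection of $\|\cdot\|_Q$ whose $(0,1)$-part is $\bar\partial$. By Serre duality $(\mathrm{DET}\,\mathrm D)^*\cong H^{1,0}(E_u)^{\otimes 2}$, and $(dz)^2$ denotes the resulting section of $(\mathrm{DET}\,\mathrm D)^*$. **(1)** The line bundle $(\mathrm{DET}\,\mathrm D)^{*\otimes 6}\to U$ is canonically trivial: $\underline\sigma^{6}=\big(\Delta^{1/6}(dz)^2\big)^{\otimes 6}$ does not depend on the choice of the sixth root of $\Delta(u)$, and it is a holomorphic section over $U$ which vanishes nowhere, spans every fibre, and is parallel for the connection induced by the Bismut–Freed connection. **(2)** Let $\gamma_n$ be a circle around $u_n^*$, traversed once clockwise, such that the closed disc it bounds contains no other zero of $\Delta$, and let $\gamma_\infty$ be a circle $|u|=R$ with $R>\max_n|u_n^*|$, traversed once counterclockwise in the $u$-plane. Identify $(dz)^2$ with the vector field $du^{-1}=\partial_u$, and trivialize $(\mathrm{DET}\,\mathrm D)^*$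 by $s=du^{-1}=(dz)^2$ along $\gamma_n$ and by $s=dv^{-1}=u^2(dz)^2$, $v=-1/u$, along $\gamma_\infty$. Along each of these loops $\gamma:[0,1]\to U$ there is a continuous function $\theta:[0,1]\to\mathbb C$ with $s^{\otimes 6}=(e^{\theta})^{6}\,\underline\sigma^{6}$, and the logarithmic monodromy $\eta^0_{\mathrm D}[\gamma]\in\mathbb R$, given by $\theta(1)-\theta(0)=-\frac{\pi i}{2}\,\eta^0_{\mathrm D}[\gamma]$, exists and is unique. Its values are $$\eta^0_{\mathrm D}[\gamma_n]=-\tfrac23,\qquad \eta^0_{\mathrm D}[\gamma_\infty]=-\tfrac{2(10-N_f)}{3}.$$ Moreover, $\exp\big(-\tfrac{\pi i}{2}\eta^0_{\mathrm D}[\gamma]\big)$ is the holonomy of the Bismut–Freed connection of $\mathrm{DET}\,\mathrm D$ along $\gamma$. -/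

import Mathlib

open scoped ContDiff TensorProduct Topology ComplexConjugate

noncomputable section

namespace SeibergWitten

/-! ### Seiberg-Witten curves -/

/-- The discriminant `g₂³ - 27 g₃²` of the Weierstrass cubics `y² = 4x³ - g₂(u) x - g₃(u)`. -/
def discr (g₂ g₃ : Polynomial ℂ) : Polynomial ℂ := g₂ ^ 3 - 27 * g₃ ^ 2

/-- A Seiberg-Witten curve with `Nf` hypermultiplets and generic masses, in the affine chart
`[u : 1]` of the base: a family of Weierstrass cubics `y² = 4x³ - g₂(u) x - g₃(u)` with
`deg g₂ ≤ 2`, `deg g₃ ≤ 3`, whose discriminant has degree `Nf + 2` and only simple zeros. -/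
structure Curve where
  g₂ : Polynomial ℂ
  g₃ : Polynomial ℂ
  Nf : ℕ
  natDegree_g₂_le : g₂.natDegree ≤ 2
  natDegree_g₃_le : g₃.natDegree ≤ 3
  natDegree_discr : (discr g₂ g₃).natDegree = Nf + 2
  nodup_roots : (discr g₂ g₃).roots.Nodup

/-- The discriminant, a polynomial in `u`. -/
def Curve.Δ (S : Curve) : Polynomial ℂ := discr S.g₂ S.g₃

/-- The part of the `u`-plane over which the fibres are smooth. -/
def Curve.smoothLocus (S : Curve) : Set ℂ := {u | S.Δ.eval u ≠ 0}

/-- `L u` is a pair of periods of `dx/y` on the fibre `E_u`: its Weierstrass invariants are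
`g₂(u)` and `g₃(u)`. Then `z ↦ (℘(z), ℘'(z))` identifies `ℂ / Λ_u` with
`E_u : y² = 4x³ - g₂(u) x - g₃(u)`, and `dz` with `dx/y`. -/
def Curve.IsPeriods (S : Curve) (L : ℂ → PeriodPair) : Prop :=
  ∀ u ∈ S.smoothLocus, (L u).g₂ = S.g₂.eval u ∧ (L u).g₃ = S.g₃.eval u

/-! ### Wirtinger derivatives -/

/-- `∂f/∂z`. -/
def del (f : ℂ → ℂ) (z : ℂ) : ℂ := (fderiv ℝ f z 1 - Complex.I * fderiv ℝ f z Complex.I) / 2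

/-- `∂f/∂z̄`. -/
def delbar (f : ℂ → ℂ) (z : ℂ) : ℂ := (fderiv ℝ f z 1 + Complex.I * fderiv ℝ f z Complex.I) / 2

/-! ### Forms on one elliptic curve `E = ℂ / Λ` -/

/-- Smooth complex functions on `ℂ / Λ`, as `Λ`-periodic smooth functions on `ℂ`. -/
def smoothFun (L : PeriodPair) : Submodule ℂ (ℂ → ℂ) where
  carrier := {f | ContDiff ℝ ∞ f ∧ ∀ w ∈ L.lattice, ∀ z, f (z + w) = f z}
  add_mem' := by
    rintro f g ⟨hf, hf'⟩ ⟨hg, hg'⟩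
    refine ⟨hf.add hg, fun w hw z => ?_⟩
    simp [hf' w hw z, hg' w hw z]
  zero_mem' := ⟨contDiff_const, fun _ _ _ => rfl⟩
  smul_mem' := by
    rintro c f ⟨hf, hf'⟩
    refine ⟨hf.const_smul c, fun w hw z => ?_⟩
    simp [hf' w hw z]

/-! A `(p,q)`-form on `E` is given by its coefficient with respect to the global frame
`1`, `dz`, `dz̄`, `dz ∧ dz̄`; each of these has pointwise norm `1` for the metric `|dz|²`. -/

/-- `Ω^{0,0}(E)`: the function `f` stands for `f`. -/
abbrev Form00 (L : PeriodPair) := smoothFun L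
/-- `Ω^{1,0}(E)`: the function `f` stands for `f dz`. -/
abbrev Form10 (L : PeriodPair) := smoothFun L
/-- `Ω^{0,1}(E)`: the function `f` stands for `f dz̄`. -/
abbrev Form01 (L : PeriodPair) := smoothFun L
/-- `Ω^{1,1}(E)`: the function `f` stands for `f dz ∧ dz̄`. -/
abbrev Form11 (L : PeriodPair) := smoothFun L

lemma periodic_fderiv {f : ℂ → ℂ} {w : ℂ} (h : ∀ z, f (z + w) = f z) (z : ℂ) :
    fderiv ℝ f (z + w) = fderiv ℝ f z := by
  have h' : (fun x => f (x + w)) = f := funext h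
  rw [← fderiv_comp_add_right w, h']

lemma contDiff_fderiv_apply {f : ℂ → ℂ} (hf : ContDiff ℝ ∞ f) (v : ℂ) :
    ContDiff ℝ ∞ (fun z => fderiv ℝ f z v) :=
  (hf.fderiv_right (m := ∞) (by simp)).clm_apply contDiff_const

lemma del_mem (L : PeriodPair) (f : smoothFun L) : del f ∈ smoothFun L := by
  obtain ⟨f, hf, hp⟩ := f
  refine ⟨?_, fun w hw z => ?_⟩
  · exact ((contDiff_fderiv_apply hf 1).sub
      (contDiff_const.mul (contDiff_fderiv_apply hf Complex.I))).div_const 2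
  · simp [del, periodic_fderiv (hp w hw)]

lemma delbar_mem (L : PeriodPair) (f : smoothFun L) : delbar f ∈ smoothFun L := by
  obtain ⟨f, hf, hp⟩ := f
  refine ⟨?_, fun w hw z => ?_⟩
  · exact ((contDiff_fderiv_apply hf 1).add
      (contDiff_const.mul (contDiff_fderiv_apply hf Complex.I))).div_const 2
  · simp [delbar, periodic_fderiv (hp w hw)]

lemma smoothFun_differentiableAt {L : PeriodPair} (f : smoothFun L) (z : ℂ) :
    DifferentiableAt ℝ (f : ℂ → ℂ) z :=
  (f.2.1.differentiable (by simp)) z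

/-- `∂/∂z` on `C^∞(E)`. -/
def delₗ (L : PeriodPair) : smoothFun L →ₗ[ℂ] smoothFun L where
  toFun f := ⟨del f, del_mem L f⟩
  map_add' f g := by
    ext z
    simp [del, fderiv_add (smoothFun_differentiableAt f z) (smoothFun_differentiableAt g z)]
    ring
  map_smul' c f := by
    ext z
    simp [del, fderiv_const_smul (smoothFun_differentiableAt f z) c]
    ring

/-- `∂/∂z̄` on `C^∞(E)`. -/
def delbarₗ (L : PeriodPair) : smoothFun L →ₗ[ℂ] smoothFun L where
  toFun f := ⟨delbar f, delbar_mem L f⟩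
  map_add' f g := by
    ext z
    simp [delbar, fderiv_add (smoothFun_differentiableAt f z) (smoothFun_differentiableAt g z)]
    ring
  map_smul' c f := by
    ext z
    simp [delbar, fderiv_const_smul (smoothFun_differentiableAt f z) c]
    ring

/-- The signature operator `D = ∂̄ + ∂̄₁ : Ω^{0,0} ⊕ Ω^{1,0} → Ω^{0,1} ⊕ Ω^{1,1}` of `E`:
`∂̄ f = (∂f/∂z̄) dz̄` and `∂̄₁ (g dz) = (∂g/∂z̄) dz̄ ∧ dz = -(∂g/∂z̄) dz ∧ dz̄`. -/
def signatureOp (L : PeriodPair) : Form00 L × Form10 L →ₗ[ℂ] Form01 L × Form11 L :=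
  (delbarₗ L).prodMap (-delbarₗ L)

/-- The formal `L²`-adjoint `D* : Ω^{0,1} ⊕ Ω^{1,1} → Ω^{0,0} ⊕ Ω^{1,0}` of `D`. -/
def signatureOpAdj (L : PeriodPair) : Form01 L × Form11 L →ₗ[ℂ] Form00 L × Form10 L :=
  (-delₗ L).prodMap (delₗ L)

/-- `H^{0,0}(E)`, the part of `ker D` in `Ω^{0,0}`. -/
def H00 (L : PeriodPair) : Submodule ℂ (Form00 L) :=
  LinearMap.ker (signatureOp L ∘ₗ LinearMap.inl ℂ (Form00 L) (Form10 L))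
/-- `H^{1,0}(E)`, the part of `ker D` in `Ω^{1,0}`: the holomorphic one-forms. -/
def H10 (L : PeriodPair) : Submodule ℂ (Form10 L) :=
  LinearMap.ker (signatureOp L ∘ₗ LinearMap.inr ℂ (Form00 L) (Form10 L))
/-- `H^{0,1}(E)`, realised by harmonic forms: the part of `ker D*` in `Ω^{0,1}`. -/
def H01 (L : PeriodPair) : Submodule ℂ (Form01 L) :=
  LinearMap.ker (signatureOpAdj L ∘ₗ LinearMap.inl ℂ (Form01 L) (Form11 L))
/-- `H^{1,1}(E)`, realised by harmonic forms: the part of `ker D*` in `Ω^{1,1}`. -/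
def H11 (L : PeriodPair) : Submodule ℂ (Form11 L) :=
  LinearMap.ker (signatureOpAdj L ∘ₗ LinearMap.inr ℂ (Form01 L) (Form11 L))

/-- The fibre of the determinant line bundle of `D`:
`DET D = [H^{0,0} ⊗ H^{1,0}]⁻¹ ⊗ [H^{0,1} ⊗ H^{1,1}]`. -/
abbrev DetD (L : PeriodPair) : Type :=
  Module.Dual ℂ (H00 L ⊗[ℂ] H10 L) ⊗[ℂ] (H01 L ⊗[ℂ] H11 L)

/-! ### Integration, Serre duality -/

lemma integrableOn_smoothFun {L : PeriodPair} (f g : smoothFun L) :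
    MeasureTheory.IntegrableOn (fun z => (g : ℂ → ℂ) z * (f : ℂ → ℂ) z)
      (ZSpan.fundamentalDomain L.basis) := by
  have hc : Continuous (fun z => (g : ℂ → ℂ) z * (f : ℂ → ℂ) z) :=
    g.2.1.continuous.mul f.2.1.continuous
  have hb := ZSpan.fundamentalDomain_isBounded L.basis
  exact (hc.continuousOn.integrableOn_compact hb.isCompact_closure).mono_set subset_closure

/-- `f ↦ ∫_E g f dA`, where `dA = (i/2) dz ∧ dz̄` is the area form. -/
def pairing (L : PeriodPair) (g : smoothFun L) : smoothFun L →ₗ[ℂ] ℂ where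
  toFun f := ∫ z in ZSpan.fundamentalDomain L.basis, (g : ℂ → ℂ) z * (f : ℂ → ℂ) z
  map_add' f₁ f₂ := by
    rw [← MeasureTheory.integral_add (integrableOn_smoothFun f₁ g) (integrableOn_smoothFun f₂ g)]
    simp [mul_add]
  map_smul' c f := by
    simp only [Submodule.coe_smul, Pi.smul_apply, smul_eq_mul, RingHom.id_apply]
    rw [← MeasureTheory.integral_const_mul]
    congr 1
    ext z
    ring

/-- The linear form on `DET D` given by `f ∈ H^{0,0}`, `α ∈ H^{1,0}` and linear forms on
`H^{0,1}` and `H^{1,1}`: it sends `φ ⊗ (a ⊗ b)` to `φ (f ⊗ α) * (ℓ a * m b)`. -/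
def detForm {L : PeriodPair} (f : H00 L) (α : H10 L) (ℓ : Module.Dual ℂ (H01 L))
    (m : Module.Dual ℂ (H11 L)) : Module.Dual ℂ (DetD L) :=
  LinearMap.mul' ℂ ℂ ∘ₗ TensorProduct.map
    (Module.Dual.eval ℂ (H00 L ⊗[ℂ] H10 L) (f ⊗ₜ[ℂ] α))
    (LinearMap.mul' ℂ ℂ ∘ₗ TensorProduct.map ℓ m)

/-- The element of `(DET D)*` defined by `f ∈ H^{0,0}` and `α ∈ H^{1,0}` through the duality of
`H^{1,0}` with `H^{0,1}` and of `H^{0,0}` with `H^{1,1}`, `(ω, ω') ↦ (i/2) ∫_E ω ∧ ω'`. It is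
quadratic in `α`, which gives the identification `(DET D)* ≅ H^{1,0} ⊗ H^{1,0}`. -/
def serreForm {L : PeriodPair} (f : H00 L) (α : H10 L) : Module.Dual ℂ (DetD L) :=
  detForm f α (pairing L α.1 ∘ₗ (H01 L).subtype) (pairing L f.1 ∘ₗ (H11 L).subtype)

/-- The constant function `1` on `E`. -/
def oneFun (L : PeriodPair) : smoothFun L := ⟨fun _ => 1, contDiff_const, fun _ _ _ => rfl⟩

/-- The constant function `1` as an element of `H^{0,0}(E)`. -/
def unit00 (L : PeriodPair) : H00 L :=
  ⟨oneFun L, by ext z <;> simp [signatureOp, delbarₗ, oneFun, delbar]⟩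

/-- The holomorphic differential `dz = dx/y` as an element of `H^{1,0}(E)`. -/
def dz10 (L : PeriodPair) : H10 L :=
  ⟨oneFun L, by ext z <;> simp [signatureOp, delbarₗ, oneFun, delbar]⟩

/-- `(dz)²` as an element of `(DET D)*`. -/
def dzSq (L : PeriodPair) : Module.Dual ℂ (DetD L) := serreForm (unit00 L) (dz10 L)

/-! ### The Quillen metric -/

/-- The area of `E` for the metric `|dz|²`. -/
def vol (L : PeriodPair) : ℝ := |(conj L.ω₁ * L.ω₂).im|

/-- The zeta function (for `Re s > 1`) of the Laplacian `Δ = -4 ∂∂̄` of `E`; its non-zero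
eigenvalues are the numbers `(2π |w| / vol E)²`, where `w = n₁ ω₁ + n₂ ω₂` and `(n₁, n₂) ∈ ℤ²`
is non-zero. -/
def laplaceZeta (L : PeriodPair) (s : ℂ) : ℂ :=
  ∑' n : {n : ℤ × ℤ // n ≠ 0},
    (((2 * Real.pi * ‖(n.1.1 : ℂ) * L.ω₁ + (n.1.2 : ℂ) * L.ω₂‖ / vol L) ^ 2 : ℝ) : ℂ) ^ (-s)

/-- `Z` is the analytic continuation of the zeta function of `Δ`. -/
def IsZetaContinuation (L : PeriodPair) (Z : ℂ → ℂ) : Prop :=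
  AnalyticOnNhd ℂ Z {1}ᶜ ∧ ∀ s : ℂ, 1 < s.re → Z s = laplaceZeta L s

open Classical in
/-- The zeta-regularized determinant `det' Δ = exp (-ζ'(0))` of `Δ = -4 ∂∂̄` on `E`. -/
def regDet (L : PeriodPair) : ℝ :=
  if h : ∃ Z, IsZetaContinuation L Z then Real.exp (-(deriv h.choose 0).re) else 0

/-- The `L²`-norm of a form, given by its coefficient. -/
def l2Norm {L : PeriodPair} (f : smoothFun L) : ℝ :=
  √ (∫ z in ZSpan.fundamentalDomain L.basis, ‖(f : ℂ → ℂ) z‖ ^ 2)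

/-- The complex conjugate of a smooth function on `E`. -/
def conjFun {L : PeriodPair} (f : smoothFun L) : smoothFun L :=
  ⟨fun z => conj ((f : ℂ → ℂ) z),
    Complex.conjCLE.contDiff.comp f.2.1, fun w hw z => by simp only [f.2.2 w hw z]⟩

/-- The `L²`-norm on `DET D`, induced by the `L²`-norms of `H^{0,0}, H^{1,0}, H^{0,1}, H^{1,1}`: the
norm of `φ ⊗ (a ⊗ b)` is `|φ (f ⊗ α) * (⟨β, a⟩ * ⟨h, b⟩)|` for vectors `f, α, β, h` of norm `1`
in the four lines. -/
def detL2Norm {L : PeriodPair} (ξ : DetD L) : ℝ :=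
  sSup {r : ℝ | ∃ (f : H00 L) (α : H10 L) (β : H01 L) (h : H11 L),
    l2Norm f.1 = 1 ∧ l2Norm α.1 = 1 ∧ l2Norm β.1 = 1 ∧ l2Norm h.1 = 1 ∧
    r = ‖detForm f α (pairing L (conjFun β.1) ∘ₗ (H01 L).subtype)
      (pairing L (conjFun h.1) ∘ₗ (H11 L).subtype) ξ‖}

/-- The Quillen norm on `DET D`. The Laplacian of `D` is `Δ` on `Ω^{0,0}` and on `Ω^{1,0}`, and each
of the two summands contributes the factor `(2π)² √(det' Δ)`. -/
def quillenNorm {L : PeriodPair} (ξ : DetD L) : ℝ :=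
  ((2 * Real.pi) ^ 2 * √ (regDet L)) ^ 2 * detL2Norm ξ

/-! ### The holomorphic structure of the determinant line bundle -/

/-- The function `(u, z) ↦ a u z` is holomorphic on the affine elliptic surface
`{(u, x, y) | u ∈ V, y² = 4x³ - g₂(u) x - g₃(u)}`: locally it is the restriction of a holomorphic
function of `(u, x, y) = (u, ℘(z), ℘'(z))`. -/
def IsHolFun (L : ℂ → PeriodPair) (V : Set ℂ) (a : ∀ u, smoothFun (L u)) : Prop :=
  ∀ u₀ ∈ V, ∀ z₀ : ℂ, z₀ ∉ (L u₀).lattice → ∃ F : ℂ × ℂ × ℂ → ℂ,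
    AnalyticAt ℂ F (u₀, (L u₀).weierstrassP z₀, (L u₀).derivWeierstrassP z₀) ∧
    ∀ᶠ p in 𝓝 (u₀, (L u₀).weierstrassP z₀, (L u₀).derivWeierstrassP z₀),
      ∀ z : ℂ, z ∉ (L p.1).lattice → (L p.1).weierstrassP z = p.2.1 →
        (L p.1).derivWeierstrassP z = p.2.2 → (a p.1 : ℂ → ℂ) z = F p

/-- Over the open set `W`, `f` and `α` are nowhere vanishing holomorphic sections of the direct
images with fibres `H^{0,0}(E_u)` and `H^{1,0}(E_u)`: the function `f`, and the coefficient of `α`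
in the relative one-form `dx/y`, are holomorphic on the elliptic surface. -/
def IsHodgeFrame (L : ℂ → PeriodPair) (W : Set ℂ) (f : ∀ u, H00 (L u)) (α : ∀ u, H10 (L u)) :
    Prop :=
  IsOpen W ∧ (∀ u ∈ W, f u ≠ 0 ∧ α u ≠ 0) ∧
    IsHolFun L W (fun u => (f u).1) ∧ IsHolFun L W (fun u => (α u).1)

/-- `ξ` is a holomorphic section of `DET D` over `V`: its pairing with the section of `(DET D)*`
defined by a local holomorphic frame of the `H^{0,0}` and `H^{1,0}` is holomorphic. -/
def IsHolDet (L : ℂ → PeriodPair) (V : Set ℂ) (ξ : ∀ u, DetD (L u)) : Prop :=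
  ∀ u₀ ∈ V, ∃ (W : Set ℂ) (f : ∀ u, H00 (L u)) (α : ∀ u, H10 (L u)),
    u₀ ∈ W ∧ IsHodgeFrame L W f α ∧ AnalyticAt ℂ (fun u => serreForm (f u) (α u) (ξ u)) u₀

/-- The fibre of `(DET D)^{* ⊗ 6}`. -/
abbrev DetDualPow (L : PeriodPair) : Type := ⨂[ℂ]^6 (Module.Dual ℂ (DetD L))

/-- The sixth tensor power of an element of `(DET D)*`. -/
def sixth {L : PeriodPair} (ℓ : Module.Dual ℂ (DetD L)) : DetDualPow L :=
  PiTensorProduct.tprod ℂ (fun _ : Fin 6 => ℓ)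

/-- `t` is a holomorphic section of `(DET D)^{* ⊗ 6}` over `V`. -/
def IsHolDetDualPow (L : ℂ → PeriodPair) (V : Set ℂ) (t : ∀ u, DetDualPow (L u)) : Prop :=
  ∀ u₀ ∈ V, ∃ (W : Set ℂ) (f : ∀ u, H00 (L u)) (α : ∀ u, H10 (L u)) (c : ℂ → ℂ),
    u₀ ∈ W ∧ IsHodgeFrame L W f α ∧ AnalyticAt ℂ c u₀ ∧
    ∀ u ∈ W, t u = c u • sixth (serreForm (f u) (α u))

/-! ### The Bismut-Freed connection -/

/-- The connection form `∂ log ‖e‖²` (coefficient of `du`) of the unitary connection of the Quillen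
metric with `(0,1)`-part `∂̄`, in the holomorphic frame `e`: `∇ e = ∂ log ‖e‖² ⊗ e`. -/
def connForm (L : ℂ → PeriodPair) (e : ∀ u, DetD (L u)) (u : ℂ) : ℂ :=
  del (fun w => (Real.log (quillenNorm (e w) ^ 2) : ℂ)) u

/-- The section `ξ` of `DET D` along the path `γ` is parallel for the Bismut-Freed connection. -/
def IsParallel (L : ℂ → PeriodPair) (γ : ℝ → ℂ) (ξ : ∀ t, DetD (L (γ t))) : Prop :=
  ∀ t : ℝ, ∃ (W : Set ℂ) (e : ∀ u, DetD (L u)) (c : ℝ → ℂ),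
    IsOpen W ∧ γ t ∈ W ∧ IsHolDet L W e ∧ (∀ u ∈ W, e u ≠ 0) ∧
    (∀ᶠ s in 𝓝 t, ξ s = c s • e (γ s)) ∧
    HasDerivAt c (-(connForm L e (γ t) * deriv γ t) * c t) t

/-- `κ` is the holonomy of the Bismut-Freed connection of `DET D` along the closed path
`γ` (parametrised by `[0, 1]`); the equality is one of points of the total space of `DET D`. -/
def HasHolonomy (L : ℂ → PeriodPair) (γ : ℝ → ℂ) (κ : ℂ) : Prop :=
  (∃ ξ, IsParallel L γ ξ ∧ ξ 0 ≠ 0) ∧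
    ∀ ξ, IsParallel L γ ξ → (⟨γ 1, ξ 1⟩ : Σ u, DetD (L u)) = ⟨γ 0, κ • ξ 0⟩

/-- The natural pairing of `(DET D)^{* ⊗ 6}` with `ξ^{⊗ 6}`, `ξ ∈ DET D`. -/
def evalSixth {L : PeriodPair} (ξ : DetD L) : DetDualPow L →ₗ[ℂ] ℂ :=
  PiTensorProduct.lift ((MultilinearMap.mkPiAlgebra ℂ (Fin 6) ℂ).compLinearMap
    (fun _ => Module.Dual.eval ℂ (DetD L) ξ))

/-- `t` is a parallel section of `(DET D)^{* ⊗ 6}` over `U`, for the connection induced by the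
Bismut-Freed connection: along every path in `U` its pairing with the sixth power of a parallel
section of `DET D` is constant. -/
def IsParallelDualPow (L : ℂ → PeriodPair) (U : Set ℂ) (t : ∀ u, DetDualPow (L u)) : Prop :=
  ∀ γ : ℝ → ℂ, ContDiff ℝ 1 γ → (∀ s, γ s ∈ U) → ∀ ξ, IsParallel L γ ξ →
    ∀ s, evalSixth (ξ s) (t (γ s)) = evalSixth (ξ 0) (t (γ 0))

/-! ### The canonical section and the logarithmic monodromy -/

/-- The section `(Δ^{1/6} (dz)²)^{⊗ 6}` of `(DET D)^{* ⊗ 6}`, with the principal sixth root. -/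
def canonicalSection (S : Curve) (L : ℂ → PeriodPair) (u : ℂ) : DetDualPow (L u) :=
  sixth ((S.Δ.eval u ^ (1 / 6 : ℂ)) • dzSq (L u))

/-- The section of `(DET D)*` that corresponds to the coordinate vector field `dw⁻¹` of a local
coordinate `w = w(u)` of the base, under the identification of `(dz)²` with `du⁻¹`. -/
def coordFrame (L : ℂ → PeriodPair) (w : ℂ → ℂ) (u : ℂ) : Module.Dual ℂ (DetD (L u)) :=
  (deriv w u)⁻¹ • dzSq (L u)

/-- `η` is the logarithmic monodromy along the closed path `γ : [0, 1] → ℂ`, relative to the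
standard trivialization `s` of `(DET D)*` given by the coordinate `w`: along `γ`, continuously,
`s = e^θ (Δ^{1/6} (dz)²)`, that is `s^{⊗ 6} = (e^θ)^6 (Δ^{1/6} (dz)²)^{⊗ 6}`, and the continuous
logarithm `θ` changes by `-(π i / 2) η`. -/
def IsLogMonodromy (S : Curve) (L : ℂ → PeriodPair) (w : ℂ → ℂ) (γ : ℝ → ℂ) (η : ℝ) : Prop :=
  ∃ θ : ℝ → ℂ, ContinuousOn θ (Set.Icc 0 1) ∧
    (∀ t ∈ Set.Icc (0 : ℝ) 1,
      sixth (coordFrame L w (γ t)) = Complex.exp (θ t) ^ 6 • canonicalSection S L (γ t)) ∧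
    θ 1 - θ 0 = -(Real.pi * Complex.I / 2) * η

/-- The circle of radius `ε` around `r`, traversed once clockwise. -/
def clockwiseLoop (r : ℂ) (ε : ℝ) (t : ℝ) : ℂ :=
  r + ε * Complex.exp (-(2 * Real.pi * t * Complex.I))

/-- The circle of radius `R` around `0` in the `u`-plane, traversed once counterclockwise: it
bounds a disc around `u = ∞`. -/
def loopAtInfinity (R : ℝ) (t : ℝ) : ℂ := R * Complex.exp (2 * Real.pi * t * Complex.I)

end SeibergWitten

end

noncomputable section

namespace SeibergWitten

open UpperHalfPlane ModularForm EisensteinSeries MatrixGroups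

/-! ### Lattices in normal form -/

/-! The theorem rests on one formula (`quillenNorm_eq`): over the smooth locus the Quillen norm of
`ξ` is a universal constant times `|(dz)²(ξ)| |Δ(u)|^{1/6}`. By Liouville's theorem each of the four
cohomology spaces consists of the constants, so `(dz)²` is a coordinate on the line `DET D`, and the
L²-norm is `|(dz)²(ξ)| / vol²`. The Kronecker limit formula (`regDet_eq_discr`) gives `det'Δ = C
vol² |Δ|^{1/6}`, and the areas cancel.

Since `∂ log |g| = g' / (2g)` for holomorphic `g`, the coordinate `X = (dz)²(ξ)` of a parallel
section along `γ` solves `X' = -(Δ'/(6Δ)) γ' X`: it is a multiple of a branch of `Δ^{-1/6}`. Hence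
`Δ X⁶` is constant, which is flatness of the canonical section, and the holonomy along a loop is
`exp(-d/6)`, where `d` is the increment of `log Δ`. Factoring `Δ` into linear terms gives `d = -2πi`
around a simple zero and `d = 2πi (Nf + 2)` at infinity. The logarithmic monodromy also sees the
framing, through the increment of `log (w')⁻¹`: zero at a node, `4πi` at infinity.

The limit formula is proved by the Chowla-Selberg method. The Epstein zeta function of `ℤτ + ℤ` is
split into the row `m = 0` and the rows `m ≠ 0`; Poisson summation in each of the latter yields a
second completed Riemann zeta function and an entire Mellin transform. At `s = 0` that transform is
an elementary Bessel integral, and its double series sums to `-4 log |∏ (1 - qⁿ)|`.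

Two classical facts link this to the cubics. The modular invariant takes every value, so lattices
with given invariants exist. The map `(℘, ℘')` hits every affine point, so holomorphy on the
elliptic surface can be tested along a local section. -/

/-- The lattice of `L` is `w (ℤ τ + ℤ)` with `τ` in the upper half-plane. -/
structure IsNormalForm (L : PeriodPair) (w : ℂ) (τ : ℍ) : Prop where
  ne_zero : w ≠ 0
  exists_equiv : ∃ e : ℤ × ℤ ≃ ℤ × ℤ, e 0 = 0 ∧
    ∀ n : ℤ × ℤ, (n.1 : ℂ) * L.ω₁ + n.2 * L.ω₂ = w * ((e n).1 * τ + (e n).2)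
  vol_eq : vol L = ‖w‖ ^ 2 * τ.im

lemma im_conj_mul_ne_zero (L : PeriodPair) : (conj L.ω₁ * L.ω₂).im ≠ 0 := by
  intro h
  have h0 : L.ω₁ ≠ 0 := L.indep.ne_zero 0
  have h1 : (conj L.ω₁ * L.ω₂) = ((conj L.ω₁ * L.ω₂).re : ℂ) := by
    apply Complex.ext <;> simp [h]
  -- If `conj ω₁ * ω₂` is real, then `-(conj ω₁ ω₂) ω₁ + |ω₁|² ω₂ = 0` is a real linear relation.
  have h2 := LinearIndependent.pair_iff.mp L.indep (-(conj L.ω₁ * L.ω₂).re) (Complex.normSq L.ω₁)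
    (by
      simp only [Complex.real_smul, Complex.ofReal_neg, ← h1, ← Complex.mul_conj]
      ring)
  exact h0 (Complex.normSq_eq_zero.mp h2.2)

lemma vol_pos (L : PeriodPair) : 0 < vol L := abs_pos.mpr (im_conj_mul_ne_zero L)

lemma isNormalForm_of_eq {L : PeriodPair} {w : ℂ} {τ : ℍ} (hw0 : w ≠ 0) (h₁ : L.ω₁ = w)
    (h₂ : L.ω₂ = w * τ) : IsNormalForm L w τ := by
  refine ⟨hw0, ⟨Equiv.prodComm ℤ ℤ, rfl, fun n => ?_⟩, ?_⟩
  · simp [h₁, h₂]; ring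
  · rw [vol, h₁, h₂, ← mul_assoc, mul_comm (conj w), Complex.mul_conj, Complex.im_ofReal_mul, Complex.normSq_eq_norm_sq, abs_of_pos]
    · rfl
    · have := τ.im_pos
      have h := norm_pos_iff.mpr hw0
      exact mul_pos (by positivity) this

/-- The sign of `Im (conj ω₁ ω₂)` decides which of `ω₁/ω₂` and `ω₂/ω₁` lies in the upper half-plane.
-/
lemma exists_isNormalForm (L : PeriodPair) : ∃ w τ, IsNormalForm L w τ := by
  have h0 : L.ω₁ ≠ 0 := L.indep.ne_zero 0
  have h0' : L.ω₂ ≠ 0 := L.indep.ne_zero 1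
  have hi := im_conj_mul_ne_zero L
  rcases lt_or_gt_of_ne hi with h | h
  · have key : (L.ω₁ / L.ω₂).im = -(conj L.ω₁ * L.ω₂).im / Complex.normSq L.ω₂ := by
      rw [Complex.div_im]; simp; ring
    have hp : 0 < (L.ω₁ / L.ω₂).im := by
      rw [key]; exact div_pos (by linarith) (Complex.normSq_pos.mpr h0')
    refine ⟨L.ω₂, ⟨L.ω₁ / L.ω₂, hp⟩, h0', ⟨Equiv.refl _, rfl, fun n => ?_⟩, ?_⟩
    · simp; field_simp
    · change vol L = ‖L.ω₂‖ ^ 2 * (L.ω₁ / L.ω₂).im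
      rw [key, vol, abs_of_neg h, Complex.normSq_eq_norm_sq]
      have := norm_ne_zero_iff.mpr h0'
      field_simp
  · have key : (L.ω₂ / L.ω₁).im = (conj L.ω₁ * L.ω₂).im / Complex.normSq L.ω₁ := by
      rw [Complex.div_im]; simp; ring
    have hp : 0 < (L.ω₂ / L.ω₁).im := by
      rw [key]; exact div_pos h (Complex.normSq_pos.mpr h0)
    refine ⟨L.ω₁, ⟨L.ω₂ / L.ω₁, hp⟩, isNormalForm_of_eq h0 rfl ?_⟩
    change L.ω₂ = L.ω₁ * (L.ω₂ / L.ω₁)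
    field_simp

/-- Eisenstein sums of a lattice in terms of the normalised Eisenstein series. -/
lemma IsNormalForm.G_eq {L : PeriodPair} {w : ℂ} {τ : ℍ} (h : IsNormalForm L w τ) {k : ℕ}
    (hk : 3 ≤ k) : L.G k = (w ^ k)⁻¹ * (2 * riemannZeta k * E hk τ) := by
  obtain ⟨e, -, he⟩ := h.exists_equiv
  -- `eisensteinSeries` runs over coprime pairs and `E` is half of it, so the full lattice sum is
  -- `ζ(k)` times the former, `2 ζ(k)` times the latter.
  have hE : E hk τ = 1 / 2 * eisensteinSeries (N := 1) 0 k τ := rfl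
  have h1 : L.G k = ∑' n : ℤ × ℤ, (((n.1 : ℂ) * L.ω₁ + n.2 * L.ω₂) ^ k)⁻¹ := by
    rw [PeriodPair.G, ← L.latticeEquivProd.symm.toEquiv.tsum_eq]
    exact tsum_congr fun n => by
      rw [← L.latticeEquiv_symm_apply]; rfl
  rw [hE, show 2 * riemannZeta k * (1 / 2 * eisensteinSeries (N := 1) 0 k τ) =
    riemannZeta k * eisensteinSeries (N := 1) 0 k τ by ring,
    ← tsum_eisSummand_eq_riemannZeta_mul_eisensteinSeries hk, ← tsum_mul_left,
    ← (finTwoArrowEquiv ℤ).symm.tsum_eq, ← e.tsum_eq, h1]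
  refine tsum_congr fun n => ?_
  rw [he]
  simp [eisSummand, mul_pow, mul_comm]

lemma riemannZeta_six : riemannZeta 6 = (Real.pi : ℂ) ^ 6 / 945 := by
  have := riemannZeta_two_mul_nat (k := 3) (by norm_num)
  norm_num [show bernoulli 6 = 1 / 42 by decide +kernel, Nat.factorial] at this
  rw [this]; ring

/-- The constant is `60 · 2ζ(4)` with `ζ(4) = π⁴/90`; the one for `g₃` is `140 · 2ζ(6)`. -/
lemma IsNormalForm.g₂_eq {L : PeriodPair} {w : ℂ} {τ : ℍ} (h : IsNormalForm L w τ) :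
    L.g₂ = (w ^ 4)⁻¹ * (4 * (Real.pi : ℂ) ^ 4 / 3 * E₄ τ) := by
  have := riemannZeta_four
  rw [PeriodPair.g₂, h.G_eq (by norm_num : 3 ≤ 4)]
  push_cast
  rw [this]; ring

lemma IsNormalForm.g₃_eq {L : PeriodPair} {w : ℂ} {τ : ℍ} (h : IsNormalForm L w τ) :
    L.g₃ = (w ^ 6)⁻¹ * (8 * (Real.pi : ℂ) ^ 6 / 27 * E₆ τ) := by
  rw [PeriodPair.g₃, h.G_eq (by norm_num : 3 ≤ 6)]
  push_cast
  rw [riemannZeta_six]; ring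

/-- The discriminant of a lattice is `(2π / w)¹² Δ(τ)`. -/
lemma IsNormalForm.discr_eq {L : PeriodPair} {w : ℂ} {τ : ℍ} (h : IsNormalForm L w τ) :
    L.g₂ ^ 3 - 27 * L.g₃ ^ 2 = (2 * Real.pi / w) ^ 12 * discriminant τ := by
  have := h.ne_zero
  rw [h.g₂_eq, h.g₃_eq, discriminant_eq_E₄_cube_sub_E₆_sq]
  field_simp
  ring

/-! ### Existence of lattices with given invariants -/

lemma tendsto_E_atImInfty {k : ℕ} (hk : 3 ≤ k) (hk2 : Even k) :
    Filter.Tendsto (E hk) atImInfty (𝓝 1) := by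
  obtain ⟨c, hc, h⟩ := ModularFormClass.exp_decay_sub_atImInfty' (E hk)
  have h1 : valueAtInfty (E hk) = 1 := by
    rw [← E_qExpansion_coeff_zero hk hk2, qExpansion_coeff_zero one_pos
      (ModularFormClass.analyticAt_cuspFunction_zero _ one_pos one_mem_strictPeriods_SL)
      (SlashInvariantFormClass.periodic_comp_ofComplex _ one_mem_strictPeriods_SL)]
  rw [h1] at h
  have h2 : Filter.Tendsto (fun τ : ℍ => Real.exp (-c * τ.im)) atImInfty (𝓝 0) := by
    refine Real.tendsto_exp_atBot.comp ?_
    exact (Filter.tendsto_comap (f := UpperHalfPlane.im)).const_mul_atTop_of_neg (by linarith)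
  simpa using (h.trans_tendsto h2).add_const 1

/-- Every complex number is a value of the modular invariant. -/
lemma exists_E₄_cube_eq (c : ℂ) : ∃ τ : ℍ, E₄ τ ^ 3 = c * discriminant τ := by
  by_contra! hne
  -- If `c` is not a value, the weight 12 form `E₄³ - cΔ` has no zero and tends to 1 at the cusp.
  -- Then `Δ / f` is a level one form of weight 0, hence constant, and its limit at the cusp is 0;
  -- but `Δ` has no zero.
  let f : ModularForm 𝒮ℒ 12 := ModularForm.mcast (by decide) (E₄.pow 3) -
    c • (CuspForm.discriminant : ModularForm 𝒮ℒ 12)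
  have hf (τ : ℍ) : f τ = E₄ τ ^ 3 - c * discriminant τ := by
    simp only [f, coe_mcast, coe_pow, sub_apply, Pi.pow_apply]
    rfl
  have hf0 (τ : ℍ) : f τ ≠ 0 := by rw [hf, sub_ne_zero]; exact hne τ
  have hf1 : Filter.Tendsto f atImInfty (𝓝 1) := by
    have := ((tendsto_E_atImInfty (by norm_num : 3 ≤ 4) ⟨2, rfl⟩).pow 3).sub
      ((discriminant_isZeroAtImInfty : Filter.Tendsto _ _ _).const_mul c)
    simp only [one_pow, mul_zero, sub_zero] at this
    exact this.congr fun τ => (hf τ).symm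
  have hq : Filter.Tendsto (fun τ => discriminant τ / f τ) atImInfty (𝓝 0) := by
    have := (discriminant_isZeroAtImInfty : Filter.Tendsto _ _ _).div hf1 one_ne_zero
    rwa [zero_div] at this
  have hslash (γ : SL(2, ℤ)) :
      (fun τ => discriminant τ / f τ) ∣[(0 : ℤ)] γ = fun τ => discriminant τ / f τ := by
    have hγ : (γ : GL (Fin 2) ℝ) ∈ 𝒮ℒ := ⟨γ, rfl⟩
    have := div_slash_SL2 12 12 γ CuspForm.discriminant f
    simp only [SL_slash, SlashInvariantFormClass.slash_action_eq _ _ hγ] at this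
    exact this
  let g : ModularForm 𝒮ℒ 0 :=
    { toFun τ := discriminant τ / f τ
      slash_action_eq' := fun _ ⟨γ, hγ⟩ => hγ ▸ hslash γ
      holo' := CuspForm.discriminant.holo'.div f.holo' hf0
      -- By `SL(2, ℤ)`-invariance only the cusp `i∞` has to be examined.
      bdd_at_cusps' {x} hx := by
        rw [Subgroup.IsArithmetic.isCusp_iff_isCusp_SL2Z] at hx
        rw [OnePoint.isBoundedAt_iff_forall_SL2Z hx]
        intro γ _
        rw [hslash γ]
        exact IsZeroAtImInfty.isBoundedAtImInfty hq }
  obtain ⟨d, hd⟩ := ModularFormClass.levelOne_weight_zero_const g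
  have hd' (τ : ℍ) : discriminant τ / f τ = d := congrFun hd τ
  have : d = 0 := tendsto_nhds_unique
    (tendsto_const_nhds.congr fun τ => (hd' τ).symm) hq
  have h2 := hd' I
  rw [this, div_eq_zero_iff] at h2
  exact h2.elim (discriminant_ne_zero _) (hf0 _)

/-- The period pair `(w, w τ)`. -/
def normalPair (w : ℂ) (hw : w ≠ 0) (τ : ℍ) : PeriodPair where
  ω₁ := w
  ω₂ := w * τ
  indep := by
    rw [LinearIndependent.pair_iff]
    intro a b h
    have h1 : (a : ℂ) + b * τ = 0 := by
      have : w * ((a : ℂ) + b * τ) = 0 := by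
        rw [← h]; simp only [Complex.real_smul]; ring
      exact (mul_eq_zero.mp this).resolve_left hw
    have hb : b = 0 := by
      have := congrArg Complex.im h1
      simpa [τ.im_ne_zero] using this
    subst hb
    simpa using h1

/-- Every nonsingular Weierstrass cubic comes from a lattice. -/
theorem exists_periodPair (a b : ℂ) (h : a ^ 3 - 27 * b ^ 2 ≠ 0) :
    ∃ L : PeriodPair, L.g₂ = a ∧ L.g₃ = b := by
  have hpi : (Real.pi : ℂ) ≠ 0 := by exact_mod_cast Real.pi_ne_zero
  -- This makes `j(τ)` equal to the modular invariant of the cubic.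
  obtain ⟨τ, hτ⟩ := exists_E₄_cube_eq (1728 * a ^ 3 / (a ^ 3 - 27 * b ^ 2))
  have hΔ := discriminant_eq_E₄_cube_sub_E₆_sq τ
  have hΔ0 := discriminant_ne_zero τ
  -- a³ / (a³ - 27 b²) = E₄³ / (E₄³ - E₆²)
  have h1 : E₄ τ ^ 3 * (a ^ 3 - 27 * b ^ 2) = a ^ 3 * (E₄ τ ^ 3 - E₆ τ ^ 2) := by
    have h0 : 1728 * a ^ 3 / (a ^ 3 - 27 * b ^ 2) * (a ^ 3 - 27 * b ^ 2) = 1728 * a ^ 3 :=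
      div_mul_cancel₀ _ h
    linear_combination (a ^ 3 - 27 * b ^ 2) * hτ + discriminant τ * h0 + 1728 * a ^ 3 * hΔ
  have h2 : 27 * b ^ 2 * E₄ τ ^ 3 = a ^ 3 * E₆ τ ^ 2 := by linear_combination -h1
  -- `A` and `B` are the invariants of `ℤτ + ℤ`. Multiplying the lattice by `r⁻¹` multiplies them by
  -- `r⁴` and `r⁶`, so equality of the modular invariants leaves only the scale `r` to be found.
  set A : ℂ := 4 * (Real.pi : ℂ) ^ 4 / 3 * E₄ τ with hA
  set B : ℂ := 8 * (Real.pi : ℂ) ^ 6 / 27 * E₆ τ with hB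
  have h3 : b ^ 2 * A ^ 3 = a ^ 3 * B ^ 2 := by
    rw [hA, hB]; linear_combination (64 * (Real.pi : ℂ) ^ 12 / 729) * h2
  have hAB : A ^ 3 - 27 * B ^ 2 ≠ 0 := by
    have : A ^ 3 - 27 * B ^ 2 = 4096 * (Real.pi : ℂ) ^ 12 * discriminant τ := by
      rw [hΔ, hA, hB]; ring
    rw [this]
    exact mul_ne_zero (mul_ne_zero (by norm_num) (pow_ne_zero _ hpi)) hΔ0
  -- it suffices to find a scaling factor
  suffices ∃ r : ℂ, r ≠ 0 ∧ r ^ 4 * A = a ∧ r ^ 6 * B = b by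
    obtain ⟨r, hr, h4, h6⟩ := this
    have hn : IsNormalForm (normalPair r⁻¹ (inv_ne_zero hr) τ) r⁻¹ τ :=
      isNormalForm_of_eq (inv_ne_zero hr) rfl rfl
    refine ⟨_, hn.g₂_eq.trans ?_, hn.g₃_eq.trans ?_⟩
    · rw [← h4, inv_pow, inv_inv]
    · rw [← h6, inv_pow, inv_inv]
  have hroot (n : ℕ) (hn : 0 < n) (x : ℂ) : ∃ r : ℂ, r ^ n = x :=
    IsAlgClosed.exists_pow_nat_eq x hn
  by_cases hA0 : A = 0
  · have hB0 : B ≠ 0 := by rintro h0; apply hAB; rw [hA0, h0]; ring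
    have ha0 : a = 0 := by
      rw [hA0] at h3
      have : a ^ 3 = 0 := by
        have h5 : a ^ 3 * B ^ 2 = 0 := by rw [← h3]; ring
        exact (mul_eq_zero.mp h5).resolve_right (pow_ne_zero _ hB0)
      exact pow_eq_zero_iff (by norm_num) |>.mp this
    have hb0 : b ≠ 0 := by rintro rfl; apply h; rw [ha0]; ring
    obtain ⟨r, hr⟩ := hroot 6 (by norm_num) (b / B)
    refine ⟨r, ?_, by rw [hA0, ha0, mul_zero], by rw [hr]; field_simp⟩
    rintro rfl
    have : b / B ≠ 0 := div_ne_zero hb0 hB0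
    exact this (by rw [← hr]; norm_num)
  · have ha0 : a ≠ 0 := by
      rintro rfl
      have h5 : b ^ 2 * A ^ 3 = 0 := by rw [h3]; ring
      have hb : b = 0 := by
        exact pow_eq_zero_iff (by norm_num) |>.mp
          ((mul_eq_zero.mp h5).resolve_right (pow_ne_zero _ hA0))
      apply h; rw [hb]; ring
    obtain ⟨r, hr⟩ := hroot 4 (by norm_num) (a / A)
    have hr0 : r ≠ 0 := by
      rintro rfl
      have : a / A ≠ 0 := div_ne_zero ha0 hA0
      exact this (by rw [← hr]; norm_num)
    have h4 : r ^ 4 * A = a := by rw [hr]; field_simp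
    have h12 : (r ^ 6 * B) ^ 2 = b ^ 2 := by
      have h5 : A ^ 3 * (r ^ 6 * B) ^ 2 = A ^ 3 * b ^ 2 := by
        rw [mul_comm (A ^ 3) (b ^ 2), h3, ← h4]; ring
      exact mul_left_cancel₀ (pow_ne_zero _ hA0) h5
    -- A fourth root of `a / A` determines `r⁶ B` only up to sign; replacing `r` by `i r` keeps `r⁴`
    -- and negates `r⁶`.
    rcases sq_eq_sq_iff_eq_or_eq_neg.mp h12 with h6 | h6
    · exact ⟨r, hr0, h4, h6⟩
    · refine ⟨Complex.I * r, mul_ne_zero Complex.I_ne_zero hr0, ?_, ?_⟩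
      · rw [mul_pow, Complex.I_pow_four, one_mul, h4]
      · rw [mul_pow, show Complex.I ^ 6 = -1 by rw [show 6 = 4 + 2 by rfl, pow_add]; simp,
          mul_assoc, h6]; ring

theorem Curve.exists_isPeriods (S : Curve) : ∃ L : ℂ → PeriodPair, S.IsPeriods L := by
  have h (u : ℂ) : ∃ L : PeriodPair, u ∈ S.smoothLocus →
      L.g₂ = S.g₂.eval u ∧ L.g₃ = S.g₃.eval u := by
    by_cases hu : u ∈ S.smoothLocus
    · obtain ⟨L, hL⟩ := exists_periodPair (S.g₂.eval u) (S.g₃.eval u) (by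
        simpa [Curve.smoothLocus, Curve.Δ, discr] using hu)
      exact ⟨L, fun _ => hL⟩
    · exact ⟨normalPair 1 one_ne_zero I, fun h => absurd h hu⟩
  choose L hL using h
  exact ⟨L, hL⟩

end SeibergWitten

end

noncomputable section

namespace SeibergWitten

/-! ### Liouville's theorem on a torus -/

lemma exists_norm_le_of_periodic {L : PeriodPair} {f : ℂ → ℂ} (hf : Continuous f)
    (hp : ∀ w ∈ L.lattice, ∀ z, f (z + w) = f z) : ∃ C, ∀ z, ‖f z‖ ≤ C := by
  have hb := (ZSpan.fundamentalDomain_isBounded L.basis).isCompact_closure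
  obtain ⟨C, hC⟩ := hb.exists_bound_of_continuousOn hf.continuousOn
  refine ⟨C, fun z => ?_⟩
  have h1 : f (ZSpan.fract L.basis z) = f z := by
    rw [ZSpan.fract_apply, sub_eq_add_neg]
    apply hp
    rw [L.lattice_eq_span_range_basis]
    exact neg_mem (ZSpan.floor L.basis z).2
  rw [← h1]
  exact hC _ (subset_closure (ZSpan.fract_mem_fundamentalDomain _ z))

lemma apply_eq_apply_of_periodic {L : PeriodPair} {f : ℂ → ℂ} (hf : Differentiable ℂ f)
    (hp : ∀ w ∈ L.lattice, ∀ z, f (z + w) = f z) (z w : ℂ) : f z = f w := by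
  obtain ⟨C, hC⟩ := exists_norm_le_of_periodic hf.continuous hp
  exact hf.apply_eq_apply_of_bounded
    (isBounded_iff_forall_norm_le.mpr ⟨C, by rintro _ ⟨x, rfl⟩; exact hC x⟩) z w

/-- `∂̄f = 0` is the Cauchy-Riemann equation, so `f` is entire and periodic. -/
lemma eq_smul_oneFun_of_delbar_eq_zero {L : PeriodPair} {f : smoothFun L}
    (h : delbarₗ L f = 0) : f = (f : ℂ → ℂ) 0 • oneFun L := by
  have hd : Differentiable ℂ (f : ℂ → ℂ) := fun z => by
    rw [differentiableAt_complex_iff_differentiableAt_real]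
    refine ⟨smoothFun_differentiableAt f z, ?_⟩
    have h0 : delbar f z = 0 := congrFun (congrArg Subtype.val h) z
    simp only [delbar, div_eq_zero_iff, OfNat.ofNat_ne_zero, or_false] at h0
    rw [smul_eq_mul]
    linear_combination -Complex.I * h0 + fderiv ℝ (f : ℂ → ℂ) z Complex.I * Complex.I_sq
  ext z
  simpa [oneFun] using apply_eq_apply_of_periodic hd f.2.2 z 0

/-- Conjugation exchanges `∂` and `∂̄`. -/
lemma eq_smul_oneFun_of_del_eq_zero {L : PeriodPair} {f : smoothFun L}
    (h : delₗ L f = 0) : f = (f : ℂ → ℂ) 0 • oneFun L := by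
  have h1 : delbarₗ L (conjFun f) = 0 := by
    ext z
    have h0 : del f z = 0 := congrFun (congrArg Subtype.val h) z
    have h2 (v : ℂ) : fderiv ℝ (conjFun f : ℂ → ℂ) z v = conj (fderiv ℝ (f : ℂ → ℂ) z v) := by
      have := (Complex.conjCLE.toContinuousLinearMap.hasFDerivAt.comp z
        (smoothFun_differentiableAt f z).hasFDerivAt).fderiv
      exact congrArg (fun A : ℂ →L[ℝ] ℂ => A v) this
    change delbar _ z = 0
    rw [delbar, h2, h2, ← Complex.conj_conj ((_ : ℂ) / 2), map_eq_zero, ← h0, del]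
    simp only [map_div₀, map_add, map_mul, Complex.conj_conj, Complex.conj_I,
      map_ofNat]
    ring
  have h3 := eq_smul_oneFun_of_delbar_eq_zero h1
  ext z
  have h4 := congrArg (fun g : smoothFun L => conj ((g : ℂ → ℂ) z)) h3
  simpa [conjFun, oneFun] using h4

/-! ### Surjectivity of the Weierstrass function -/

lemma tendsto_weierstrassP_cobounded (L : PeriodPair) {l : ℂ} (hl : l ∈ L.lattice) :
    Filter.Tendsto L.weierstrassP (𝓝[≠] l) (Bornology.cobounded ℂ) := by
  apply tendsto_cobounded_of_meromorphicOrderAt_neg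
  rw [L.order_weierstrassP l hl]
  decide

/-- If `℘` omitted `x`, then `1/(℘ - x)`, extended by 0 over the poles, would be entire and
periodic, hence constantly 0. It is not 0 at the half period `ω₁/2`, which is not a pole. -/
theorem exists_weierstrassP_eq (L : PeriodPair) (x : ℂ) :
    ∃ z, z ∉ L.lattice ∧ L.weierstrassP z = x := by
  classical
  by_contra! hne
  let h : ℂ → ℂ := fun z => if z ∈ L.lattice then 0 else (L.weierstrassP z - x)⁻¹
  have hopen : IsOpen ((L.lattice : Set ℂ)ᶜ) := L.isClosed_lattice.isOpen_compl
  have hd1 (z : ℂ) (hz : z ∉ L.lattice) : DifferentiableAt ℂ h z := by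
    have h1 : DifferentiableAt ℂ (fun z => (L.weierstrassP z - x)⁻¹) z :=
      (((L.differentiableOn_weierstrassP).differentiableAt (hopen.mem_nhds hz)).sub_const x).inv
        (sub_ne_zero.mpr (hne z hz))
    refine h1.congr_of_eventuallyEq ?_
    filter_upwards [hopen.mem_nhds hz] with y hy
    exact if_neg hy
  have hd2 (z : ℂ) (hz : z ∈ L.lattice) : DifferentiableAt ℂ h z := by
    have hs : ((L.lattice : Set ℂ) \ {z})ᶜ ∈ 𝓝 z := L.compl_lattice_sdiff_singleton_mem_nhds z
    have hev : ∀ᶠ y in 𝓝[≠] z, y ∉ L.lattice := by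
      filter_upwards [nhdsWithin_le_nhds hs, self_mem_nhdsWithin] with y hy hyz hyL
      exact hy ⟨hyL, hyz⟩
    have hc : ContinuousAt h z := by
      rw [continuousAt_iff_punctured_nhds]
      have h0 : h z = 0 := if_pos hz
      rw [h0]
      have ht : Filter.Tendsto (fun y => (L.weierstrassP y - x)⁻¹) (𝓝[≠] z) (𝓝 0) := by
        refine Filter.tendsto_inv₀_cobounded.comp ?_
        exact (tendsto_sub_const_cobounded x).comp (tendsto_weierstrassP_cobounded L hz)
      refine ht.congr' ?_
      filter_upwards [hev] with y hy
      exact (if_neg hy).symm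
    have := (Complex.differentiableOn_compl_singleton_and_continuousAt_iff hs).mp
      ⟨fun y hy => (hd1 y fun hyL => hy.1 ⟨hyL, hy.2⟩).differentiableWithinAt, hc⟩
    exact this.differentiableAt hs
  have hd : Differentiable ℂ h := fun z =>
    if hz : z ∈ L.lattice then hd2 z hz else hd1 z hz
  have hp : ∀ w ∈ L.lattice, ∀ z, h (z + w) = h z := by
    intro w hw z
    have : z + w ∈ L.lattice ↔ z ∈ L.lattice := L.lattice.add_mem_iff_left hw
    simp only [h, this]
    rw [L.weierstrassP_add_coe z ⟨w, hw⟩]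
  have h0 := apply_eq_apply_of_periodic hd hp (L.ω₁ / 2) 0
  simp only [h, L.ω₁_div_two_notMem_lattice, if_false, zero_mem, if_true, inv_eq_zero] at h0
  exact hne _ L.ω₁_div_two_notMem_lattice (sub_eq_zero.mp h0)

/-- Every point of the affine Weierstrass cubic is `(℘(z), ℘'(z))`. -/
theorem exists_weierstrassP_derivWeierstrassP_eq (L : PeriodPair) (x y : ℂ)
    (h : y ^ 2 = 4 * x ^ 3 - L.g₂ * x - L.g₃) :
    ∃ z, z ∉ L.lattice ∧ L.weierstrassP z = x ∧ L.derivWeierstrassP z = y := by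
  obtain ⟨z, hz, hx⟩ := exists_weierstrassP_eq L x
  have h1 := L.derivWeierstrassP_sq z hz
  rw [hx, ← h] at h1
  -- The sign of `℘'` is adjusted by `z ↦ -z`, since `℘` is even and `℘'` odd.
  rcases sq_eq_sq_iff_eq_or_eq_neg.mp h1 with h2 | h2
  · exact ⟨z, hz, hx, h2⟩
  · refine ⟨-z, fun h => hz (by simpa using h), by rw [L.weierstrassP_neg, hx], ?_⟩
    rw [L.derivWeierstrassP_neg, h2, neg_neg]

end SeibergWitten

end

noncomputable section

namespace SeibergWitten

/-! ### The four cohomology lines -/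

lemma H00_le_ker {L : PeriodPair} (f : H00 L) : delbarₗ L f.1 = 0 := by
  have h := LinearMap.mem_ker.mp f.2
  exact congrArg Prod.fst h

lemma H10_le_ker {L : PeriodPair} (f : H10 L) : delbarₗ L f.1 = 0 := by
  have h := LinearMap.mem_ker.mp f.2
  exact neg_eq_zero.mp (congrArg Prod.snd h)

lemma H01_le_ker {L : PeriodPair} (f : H01 L) : delₗ L f.1 = 0 := by
  have h := LinearMap.mem_ker.mp f.2
  exact neg_eq_zero.mp (congrArg Prod.fst h)

lemma H11_le_ker {L : PeriodPair} (f : H11 L) : delₗ L f.1 = 0 := by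
  have h := LinearMap.mem_ker.mp f.2
  exact congrArg Prod.snd h

/-- `dz̄` as an element of `H^{0,1}(E)`. -/
def dzBar01 (L : PeriodPair) : H01 L :=
  ⟨oneFun L, by ext z <;> simp [signatureOpAdj, delₗ, oneFun, del]⟩

/-- `dz ∧ dz̄` as an element of `H^{1,1}(E)`. -/
def area11 (L : PeriodPair) : H11 L :=
  ⟨oneFun L, by ext z <;> simp [signatureOpAdj, delₗ, oneFun, del]⟩

lemma oneFun_ne_zero (L : PeriodPair) : oneFun L ≠ 0 := fun h => by
  simpa [oneFun] using congrArg (fun g : smoothFun L => (g : ℂ → ℂ) 0) h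

lemma exists_eq_smul_unit00 {L : PeriodPair} (f : H00 L) : ∃ c : ℂ, f = c • unit00 L :=
  ⟨_, Subtype.ext (eq_smul_oneFun_of_delbar_eq_zero (H00_le_ker f))⟩

lemma exists_eq_smul_dz10 {L : PeriodPair} (f : H10 L) : ∃ c : ℂ, f = c • dz10 L :=
  ⟨_, Subtype.ext (eq_smul_oneFun_of_delbar_eq_zero (H10_le_ker f))⟩

lemma exists_eq_smul_dzBar01 {L : PeriodPair} (f : H01 L) : ∃ c : ℂ, f = c • dzBar01 L :=
  ⟨_, Subtype.ext (eq_smul_oneFun_of_del_eq_zero (H01_le_ker f))⟩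

lemma exists_eq_smul_area11 {L : PeriodPair} (f : H11 L) : ∃ c : ℂ, f = c • area11 L :=
  ⟨_, Subtype.ext (eq_smul_oneFun_of_del_eq_zero (H11_le_ker f))⟩

lemma unit00_ne_zero (L : PeriodPair) : unit00 L ≠ 0 :=
  fun h => oneFun_ne_zero L (congrArg Subtype.val h)

lemma dz10_ne_zero (L : PeriodPair) : dz10 L ≠ 0 :=
  fun h => oneFun_ne_zero L (congrArg Subtype.val h)

/-- Lines are handled through a spanning vector; this property passes to tensor products and duals
without bases or dimension counts. -/
lemma exists_eq_smul_tmul {V W : Type*} [AddCommMonoid V] [Module ℂ V] [AddCommMonoid W]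
    [Module ℂ W] {v : V} {w : W} (hv : ∀ x, ∃ c : ℂ, x = c • v) (hw : ∀ y, ∃ c : ℂ, y = c • w)
    (x : V ⊗[ℂ] W) : ∃ c : ℂ, x = c • (v ⊗ₜ[ℂ] w) := by
  induction x with
  | zero => exact ⟨0, (zero_smul ℂ _).symm⟩
  | add x y hx hy =>
    obtain ⟨a, rfl⟩ := hx
    obtain ⟨b, rfl⟩ := hy
    exact ⟨a + b, (add_smul _ _ _).symm⟩
  | tmul x y =>
    obtain ⟨a, rfl⟩ := hv x
    obtain ⟨b, rfl⟩ := hw y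
    exact ⟨a * b, TensorProduct.smul_tmul_smul _ _ _ _⟩

lemma exists_eq_smul_dual {V : Type*} [AddCommMonoid V] [Module ℂ V] {v : V}
    (hv : ∀ x, ∃ c : ℂ, x = c • v) {φ : Module.Dual ℂ V} (hφ : φ v ≠ 0) (ψ : Module.Dual ℂ V) :
    ∃ c : ℂ, ψ = c • φ := by
  refine ⟨ψ v / φ v, LinearMap.ext fun x => ?_⟩
  obtain ⟨c, rfl⟩ := hv x
  simp only [map_smul, LinearMap.smul_apply, smul_eq_mul]
  field_simp

/-! ### The area of the torus -/

lemma volume_fundamentalDomain (L : PeriodPair) :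
    MeasureTheory.volume.real (ZSpan.fundamentalDomain L.basis) = vol L := by
  have h1 : MeasureTheory.volume (ZSpan.fundamentalDomain Complex.basisOneI) = 1 := by
    rw [MeasureTheory.measure_congr (ZSpan.fundamentalDomain_ae_parallelepiped _ _)]
    have := Complex.orthonormalBasisOneI.volume_parallelepiped
    rwa [Complex.coe_orthonormalBasisOneI, ← Complex.coe_basisOneI] at this
  rw [MeasureTheory.measureReal_def, ZSpan.measure_fundamentalDomain L.basis _ Complex.basisOneI,
    h1, mul_one, ENNReal.toReal_ofReal (abs_nonneg _), Module.Basis.det_apply, vol,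
    Matrix.det_fin_two]
  simp [Module.Basis.toMatrix_apply]
  congr 1
  ring

lemma pairing_oneFun_oneFun (L : PeriodPair) : pairing L (oneFun L) (oneFun L) = vol L := by
  simp [pairing, oneFun, volume_fundamentalDomain]

lemma l2Norm_smul_oneFun {L : PeriodPair} (c : ℂ) :
    l2Norm (c • oneFun L) = ‖c‖ * √ (vol L) := by
  simp [l2Norm, oneFun, volume_fundamentalDomain, mul_comm]

lemma pairing_smul {L : PeriodPair} (c : ℂ) (g : smoothFun L) :
    pairing L (c • g) = c • pairing L g := by
  ext f
  simp only [pairing, LinearMap.coe_mk, AddHom.coe_mk, LinearMap.smul_apply, smul_eq_mul,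
    Submodule.coe_smul, Pi.smul_apply]
  rw [← MeasureTheory.integral_const_mul]
  congr 1
  ext z
  ring

lemma conjFun_smul_oneFun {L : PeriodPair} (c : ℂ) :
    conjFun (c • oneFun L) = conj c • oneFun L := by
  ext z
  simp [conjFun, oneFun]

/-! ### The determinant line -/

lemma detForm_smul {L : PeriodPair} (a b c d : ℂ) (f : H00 L) (α : H10 L)
    (ℓ : Module.Dual ℂ (H01 L)) (m : Module.Dual ℂ (H11 L)) :
    detForm (a • f) (b • α) (c • ℓ) (d • m) = (a * b * (c * d)) • detForm f α ℓ m := by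
  refine TensorProduct.ext' fun φ x => ?_
  induction x with
  | zero => simp
  | add x y hx hy => rw [TensorProduct.tmul_add, map_add, map_add, hx, hy]
  | tmul x y =>
    have h : (a • f) ⊗ₜ[ℂ] (b • α) = (a * b) • (f ⊗ₜ[ℂ] α) := TensorProduct.smul_tmul_smul _ _ _ _
    simp only [detForm, LinearMap.comp_apply, TensorProduct.map_tmul, LinearMap.mul'_apply,
      LinearMap.smul_apply, Module.Dual.eval_apply, smul_eq_mul, h, map_smul]
    ring

/-- Each of `f` and `α` enters twice, as a vector to be evaluated on and through the Serre pairing;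
hence the squares. -/
lemma serreForm_smul {L : PeriodPair} (a b : ℂ) :
    serreForm (a • unit00 L) (b • dz10 L) = (a ^ 2 * b ^ 2) • dzSq L := by
  have h1 : pairing L (b • dz10 L).1 ∘ₗ (H01 L).subtype =
      b • (pairing L (dz10 L).1 ∘ₗ (H01 L).subtype) := by
    rw [← LinearMap.smul_comp, ← pairing_smul]; rfl
  have h2 : pairing L (a • unit00 L).1 ∘ₗ (H11 L).subtype =
      a • (pairing L (unit00 L).1 ∘ₗ (H11 L).subtype) := by
    rw [← LinearMap.smul_comp, ← pairing_smul]; rfl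
  rw [serreForm, h1, h2, detForm_smul, dzSq, serreForm]
  congr 1
  ring

/-- Evaluation at `0` of a smooth function. -/
def evalZero (L : PeriodPair) : smoothFun L →ₗ[ℂ] ℂ where
  toFun f := (f : ℂ → ℂ) 0
  map_add' _ _ := rfl
  map_smul' _ _ := rfl

/-- The linear form on `H^{0,0} ⊗ H^{1,0}` dual to `1 ⊗ dz`. -/
def hodgeDual (L : PeriodPair) : Module.Dual ℂ (H00 L ⊗[ℂ] H10 L) :=
  LinearMap.mul' ℂ ℂ ∘ₗ
    TensorProduct.map (evalZero L ∘ₗ (H00 L).subtype) (evalZero L ∘ₗ (H10 L).subtype)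

lemma hodgeDual_apply (L : PeriodPair) : hodgeDual L (unit00 L ⊗ₜ dz10 L) = 1 := by
  have h4 : evalZero L (unit00 L).1 = 1 := rfl
  have h5 : evalZero L (dz10 L).1 = 1 := rfl
  simp [hodgeDual, h4, h5]

/-- The generator of the determinant line on which `(dz)²` takes the value `1`. -/
def detGen (L : PeriodPair) : DetD L :=
  ((vol L : ℂ) ^ 2)⁻¹ • (hodgeDual L ⊗ₜ (dzBar01 L ⊗ₜ area11 L))

-- Each of the two Serre pairings of constants contributes one factor `vol L`.
@[simp] lemma dzSq_detGen (L : PeriodPair) : dzSq L (detGen L) = 1 := by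
  have hv : (vol L : ℂ) ≠ 0 := by exact_mod_cast (vol_pos L).ne'
  have h2 : pairing L (dz10 L).1 (dzBar01 L).1 = vol L := pairing_oneFun_oneFun L
  have h3 : pairing L (unit00 L).1 (area11 L).1 = vol L := pairing_oneFun_oneFun L
  rw [detGen, map_smul, dzSq, serreForm, detForm]
  simp only [LinearMap.comp_apply, TensorProduct.map_tmul, LinearMap.mul'_apply,
    Submodule.subtype_apply, Module.Dual.eval_apply, smul_eq_mul, h2, h3, hodgeDual_apply]
  field_simp

lemma exists_eq_smul_detLine {V₁ V₂ W₁ W₂ : Type*} [AddCommMonoid V₁] [Module ℂ V₁]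
    [AddCommMonoid V₂] [Module ℂ V₂] [AddCommMonoid W₁] [Module ℂ W₁] [AddCommMonoid W₂] [Module ℂ W₂]
    {v₁ : V₁} {v₂ : V₂} {w₁ : W₁} {w₂ : W₂} (h₁ : ∀ x, ∃ c : ℂ, x = c • v₁)
    (h₂ : ∀ x, ∃ c : ℂ, x = c • v₂) (k₁ : ∀ x, ∃ c : ℂ, x = c • w₁)
    (k₂ : ∀ x, ∃ c : ℂ, x = c • w₂) {φ : Module.Dual ℂ (V₁ ⊗[ℂ] V₂)} (hφ : φ (v₁ ⊗ₜ v₂) ≠ 0)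
    (ξ : Module.Dual ℂ (V₁ ⊗[ℂ] V₂) ⊗[ℂ] (W₁ ⊗[ℂ] W₂)) :
    ∃ c : ℂ, ξ = c • (φ ⊗ₜ[ℂ] (w₁ ⊗ₜ[ℂ] w₂)) :=
  exists_eq_smul_tmul (exists_eq_smul_dual (exists_eq_smul_tmul h₁ h₂) hφ)
    (exists_eq_smul_tmul k₁ k₂) ξ

lemma exists_eq_smul_detGen {L : PeriodPair} (ξ : DetD L) : ∃ c : ℂ, ξ = c • detGen L := by
  have hv : (vol L : ℂ) ^ 2 ≠ 0 := pow_ne_zero 2 (by exact_mod_cast (vol_pos L).ne')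
  obtain ⟨c, rfl⟩ := exists_eq_smul_detLine exists_eq_smul_unit00 exists_eq_smul_dz10
    exists_eq_smul_dzBar01 exists_eq_smul_area11
    (by rw [hodgeDual_apply L]; exact one_ne_zero) ξ
  refine ⟨c * (vol L : ℂ) ^ 2, ?_⟩
  rw [detGen, smul_smul, mul_assoc, mul_inv_cancel₀ hv, mul_one]

lemma eq_smul_detGen {L : PeriodPair} (ξ : DetD L) : ξ = dzSq L ξ • detGen L := by
  obtain ⟨c, rfl⟩ := exists_eq_smul_detGen ξ
  rw [map_smul, dzSq_detGen, smul_eq_mul, mul_one]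

lemma dzSq_eq_zero_iff {L : PeriodPair} {ξ : DetD L} : dzSq L ξ = 0 ↔ ξ = 0 :=
  ⟨fun h => by rw [eq_smul_detGen ξ, h, zero_smul], fun h => by rw [h, map_zero]⟩

/-- The `L²`-norm of the determinant line. -/
lemma detL2Norm_eq {L : PeriodPair} (ξ : DetD L) : detL2Norm ξ = ‖dzSq L ξ‖ / vol L ^ 2 := by
  have hv := vol_pos L
  have hs := Real.sqrt_pos.mpr hv
  have key (a b c d : ℂ) : ‖detForm (a • unit00 L) (b • dz10 L)
      (pairing L (conjFun (c • dzBar01 L).1) ∘ₗ (H01 L).subtype)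
      (pairing L (conjFun (d • area11 L).1) ∘ₗ (H11 L).subtype) ξ‖ =
      ‖a‖ * ‖b‖ * ‖c‖ * ‖d‖ * ‖dzSq L ξ‖ := by
    have h1 : pairing L (conjFun (c • dzBar01 L).1) ∘ₗ (H01 L).subtype =
        conj c • (pairing L (dz10 L).1 ∘ₗ (H01 L).subtype) := by
      rw [← LinearMap.smul_comp, ← pairing_smul]
      exact congrArg (fun g => pairing L g ∘ₗ (H01 L).subtype) (conjFun_smul_oneFun c)
    have h2 : pairing L (conjFun (d • area11 L).1) ∘ₗ (H11 L).subtype =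
        conj d • (pairing L (unit00 L).1 ∘ₗ (H11 L).subtype) := by
      rw [← LinearMap.smul_comp, ← pairing_smul]
      exact congrArg (fun g => pairing L g ∘ₗ (H11 L).subtype) (conjFun_smul_oneFun d)
    rw [h1, h2, detForm_smul, dzSq, serreForm]
    simp only [LinearMap.smul_apply, smul_eq_mul, norm_mul, RCLike.norm_conj]
    ring
  have hn (c : ℂ) (h : l2Norm (c • oneFun L) = 1) : ‖c‖ = (√ (vol L))⁻¹ := by
    rw [l2Norm_smul_oneFun] at h
    exact eq_inv_of_mul_eq_one_left h
  -- Unit vectors in a line differ by phases only, so the set under the supremum is a single point.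
  -- Each of the four unit vectors has a coefficient of modulus `vol^{-1/2}`.
  have hset : {r : ℝ | ∃ (f : H00 L) (α : H10 L) (β : H01 L) (h : H11 L),
      l2Norm f.1 = 1 ∧ l2Norm α.1 = 1 ∧ l2Norm β.1 = 1 ∧ l2Norm h.1 = 1 ∧
      r = ‖detForm f α (pairing L (conjFun β.1) ∘ₗ (H01 L).subtype)
        (pairing L (conjFun h.1) ∘ₗ (H11 L).subtype) ξ‖} = {‖dzSq L ξ‖ / vol L ^ 2} := by
    have hval : (√ (vol L))⁻¹ * (√ (vol L))⁻¹ * (√ (vol L))⁻¹ * (√ (vol L))⁻¹ * ‖dzSq L ξ‖ =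
        ‖dzSq L ξ‖ / vol L ^ 2 := by
      nth_rewrite 5 [← Real.sq_sqrt hv.le]
      field_simp
    ext r
    constructor
    · rintro ⟨f, α, β, h, hf, hα, hβ, hh, rfl⟩
      obtain ⟨a, rfl⟩ := exists_eq_smul_unit00 f
      obtain ⟨b, rfl⟩ := exists_eq_smul_dz10 α
      obtain ⟨c, rfl⟩ := exists_eq_smul_dzBar01 β
      obtain ⟨d, rfl⟩ := exists_eq_smul_area11 h
      rw [Set.mem_singleton_iff, key, hn a hf, hn b hα, hn c hβ, hn d hh, hval]
    · rintro rfl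
      set c : ℂ := (((√ (vol L))⁻¹ : ℝ) : ℂ) with hc
      have hcn : ‖c‖ = (√ (vol L))⁻¹ := by
        rw [hc, Complex.norm_real, Real.norm_of_nonneg (inv_nonneg.mpr hs.le)]
      have h1 : l2Norm (c • oneFun L) = 1 := by
        rw [l2Norm_smul_oneFun, hcn, inv_mul_cancel₀ hs.ne']
      refine ⟨c • unit00 L, c • dz10 L, c • dzBar01 L, c • area11 L, h1, h1, h1, h1, ?_⟩
      rw [key, hcn, hval]
  rw [detL2Norm, hset, csSup_singleton]

/-! ### The sixth power of the dual determinant line -/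

lemma sixth_smul {L : PeriodPair} (c : ℂ) (ℓ : Module.Dual ℂ (DetD L)) :
    sixth (c • ℓ) = c ^ 6 • sixth ℓ := by
  simp [sixth, MultilinearMap.map_smul_univ]

lemma evalSixth_sixth {L : PeriodPair} (ξ : DetD L) (ℓ : Module.Dual ℂ (DetD L)) :
    evalSixth ξ (sixth ℓ) = ℓ ξ ^ 6 := by
  simp [evalSixth, sixth]

lemma sixth_dzSq_ne_zero (L : PeriodPair) : sixth (dzSq L) ≠ 0 := fun h => by
  have := evalSixth_sixth (detGen L) (dzSq L)
  simp [h] at this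

lemma exists_eq_smul_dzSq {L : PeriodPair} (ℓ : Module.Dual ℂ (DetD L)) :
    ∃ c : ℂ, ℓ = c • dzSq L := by
  refine ⟨ℓ (detGen L), LinearMap.ext fun ξ => ?_⟩
  rw [LinearMap.smul_apply, smul_eq_mul, mul_comm, ← smul_eq_mul, ← map_smul, ← eq_smul_detGen]

lemma exists_eq_smul_sixth {L : PeriodPair} (x : DetDualPow L) :
    ∃ c : ℂ, x = c • sixth (dzSq L) := by
  induction x using PiTensorProduct.induction_on with
  | smul_tprod r f =>
    choose c hc using fun i => exists_eq_smul_dzSq (f i)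
    have : f = fun i => c i • dzSq L := funext hc
    refine ⟨r * ∏ i, c i, ?_⟩
    rw [this, MultilinearMap.map_smul_univ, smul_smul]
    rfl
  | add x y hx hy =>
    obtain ⟨a, rfl⟩ := hx
    obtain ⟨b, rfl⟩ := hy
    exact ⟨a + b, (add_smul _ _ _).symm⟩

end SeibergWitten

end

noncomputable section

namespace SeibergWitten

open MeasureTheory Filter Set

/-! ### A Bessel integral -/

/-- The error function, without normalisation. -/
def erfAux (x : ℝ) : ℝ := ∫ t in (0 : ℝ)..x, Real.exp (-t ^ 2)

lemma hasDerivAt_erfAux (x : ℝ) : HasDerivAt erfAux (Real.exp (-x ^ 2)) x := by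
  have hc : Continuous fun t : ℝ => Real.exp (-t ^ 2) := by fun_prop
  exact intervalIntegral.integral_hasDerivAt_right (hc.intervalIntegrable _ _)
    hc.aestronglyMeasurable.stronglyMeasurableAtFilter hc.continuousAt

lemma tendsto_erfAux_atTop : Tendsto erfAux atTop (𝓝 (√Real.pi / 2)) := by
  have h := integral_gaussian_Ioi 1
  have h1 : IntegrableOn (fun t : ℝ => Real.exp (-t ^ 2)) (Ioi 0) := by
    have := (integrable_exp_neg_mul_sq (b := 1) one_pos).integrableOn (s := Ioi 0)
    simpa using this
  have h2 := intervalIntegral_tendsto_integral_Ioi 0 h1 tendsto_id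
  simp only [neg_mul, one_mul, div_one] at h
  rw [h] at h2
  exact h2

lemma erfAux_neg (x : ℝ) : erfAux (-x) = -erfAux x := by
  have h := intervalIntegral.integral_comp_neg (a := 0) (b := x) fun t : ℝ => Real.exp (-t ^ 2)
  simp only [neg_sq, neg_zero] at h
  rw [erfAux, intervalIntegral.integral_symm, ← h, erfAux]

lemma tendsto_erfAux_atBot : Tendsto erfAux atBot (𝓝 (-(√Real.pi / 2))) := by
  have h := (tendsto_erfAux_atTop.comp tendsto_neg_atBot_atTop).neg
  refine h.congr fun x => ?_
  simp [erfAux_neg]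

/-- An antiderivative of `t^{-3/2} exp (-(a² t + b² / t))`. -/
def besselPrimitive (a b t : ℝ) : ℝ :=
  -(Real.exp (2 * (a * b)) * erfAux (b / √t + a * √t) +
    Real.exp (-(2 * (a * b))) * erfAux (b / √t - a * √t)) / b

lemma hasDerivAt_besselPrimitive {a b t : ℝ} (hb : 0 < b) (ht : 0 < t) :
    HasDerivAt (besselPrimitive a b)
      (t ^ (-3 / 2 : ℝ) * Real.exp (-(a ^ 2 * t + b ^ 2 / t))) t := by
  have hs := Real.sqrt_pos.mpr ht
  have hss : √t ^ 2 = t := Real.sq_sqrt ht.le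
  have h0 := Real.hasDerivAt_sqrt ht.ne'
  have h1 : HasDerivAt (fun t => b / √t) (-b / (2 * t * √t)) t := by
    refine ((hasDerivAt_const t b).div h0 hs.ne').congr_deriv ?_
    rw [hss]; field_simp; ring
  have h2 : HasDerivAt (fun t => a * √t) (a / (2 * √t)) t :=
    (h0.const_mul a).congr_deriv (by field_simp)
  have h3 := ((hasDerivAt_erfAux _).comp t (h1.add h2)).const_mul (Real.exp (2 * (a * b)))
  have h4 := ((hasDerivAt_erfAux _).comp t (h1.sub h2)).const_mul (Real.exp (-(2 * (a * b))))
  refine ((h3.add h4).neg.div_const b).congr_deriv ?_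
  -- Since `(b/√t ± a√t)² = a²t + b²/t ± 2ab`, the prefactors `e^{±2ab}` make both exponentials
  -- equal. The `a`-parts of the inner derivatives then cancel.
  have e1 : Real.exp (2 * (a * b)) * Real.exp (-(b / √t + a * √t) ^ 2) =
      Real.exp (-(a ^ 2 * t + b ^ 2 / t)) := by
    rw [← Real.exp_add]; congr 1
    rw [add_sq, div_pow, mul_pow, hss]; field_simp; ring
  have e2 : Real.exp (-(2 * (a * b))) * Real.exp (-(b / √t - a * √t) ^ 2) =
      Real.exp (-(a ^ 2 * t + b ^ 2 / t)) := by
    rw [← Real.exp_add]; congr 1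
    rw [sub_sq, div_pow, mul_pow, hss]; field_simp; ring
  have e3 : t ^ (-3 / 2 : ℝ) = (t * √t)⁻¹ := by
    rw [Real.sqrt_eq_rpow, ← Real.rpow_one_add' ht.le (by norm_num), ← Real.rpow_neg ht.le]
    norm_num
  simp only [Pi.add_apply, Pi.sub_apply]
  rw [← mul_assoc (Real.exp (2 * (a * b))) (Real.exp _),
    ← mul_assoc (Real.exp (-(2 * (a * b)))) (Real.exp _), e1, e2, e3]
  field_simp
  ring

lemma tendsto_besselPrimitive_zero {a b : ℝ} (hb : 0 < b) :
    Tendsto (besselPrimitive a b) (𝓝[>] 0)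
      (𝓝 (-(Real.exp (2 * (a * b)) * (√Real.pi / 2) +
        Real.exp (-(2 * (a * b))) * (√Real.pi / 2)) / b)) := by
  have hs0 : Tendsto (fun t : ℝ => √t) (𝓝[>] 0) (𝓝 0) := by
    have := Real.continuous_sqrt.tendsto 0
    rw [Real.sqrt_zero] at this
    exact this.mono_left nhdsWithin_le_nhds
  have hs : Tendsto (fun t : ℝ => √t) (𝓝[>] 0) (𝓝[>] 0) :=
    tendsto_nhdsWithin_iff.mpr ⟨hs0, eventually_nhdsWithin_of_forall fun t ht => Real.sqrt_pos.mpr ht⟩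
  have h1 : Tendsto (fun t : ℝ => b / √t) (𝓝[>] 0) atTop := by
    simp only [div_eq_mul_inv]
    exact (tendsto_inv_nhdsGT_zero.comp hs).const_mul_atTop hb
  have h2 : Tendsto (fun t : ℝ => a * √t) (𝓝[>] 0) (𝓝 0) := by
    simpa using hs0.const_mul a
  have h3 := (tendsto_erfAux_atTop.comp (h1.atTop_add h2)).const_mul (Real.exp (2 * (a * b)))
  have h4 := (tendsto_erfAux_atTop.comp (h1.atTop_add h2.neg)).const_mul
    (Real.exp (-(2 * (a * b))))
  simp only [← sub_eq_add_neg] at h4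
  exact (h3.add h4).neg.div_const b

lemma tendsto_besselPrimitive_atTop {a b : ℝ} (ha : 0 < a) :
    Tendsto (besselPrimitive a b) atTop
      (𝓝 (-(Real.exp (2 * (a * b)) * (√Real.pi / 2) +
        Real.exp (-(2 * (a * b))) * -(√Real.pi / 2)) / b)) := by
  have hs : Tendsto (fun t : ℝ => √t) atTop atTop := Real.tendsto_sqrt_atTop
  have h1 : Tendsto (fun t : ℝ => b / √t) atTop (𝓝 0) := hs.const_div_atTop b
  have h2 : Tendsto (fun t : ℝ => a * √t) atTop atTop := hs.const_mul_atTop ha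
  have h2' : Tendsto (fun t : ℝ => -(a * √t)) atTop atBot := tendsto_neg_atTop_atBot.comp h2
  have h3 := (tendsto_erfAux_atTop.comp (h1.add_atTop h2)).const_mul (Real.exp (2 * (a * b)))
  have h4 := (tendsto_erfAux_atBot.comp (h1.add_atBot h2')).const_mul
    (Real.exp (-(2 * (a * b))))
  simp only [← sub_eq_add_neg] at h4
  exact (h3.add h4).neg.div_const b

/-- This is the elementary Bessel function `K_{1/2}`. Between the two limits of the primitive the
`e^{2ab}` terms cancel and the `e^{-2ab}` terms add up. -/
lemma integral_bessel {a b : ℝ} (ha : 0 < a) (hb : 0 < b) :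
    IntegrableOn (fun t : ℝ => t ^ (-3 / 2 : ℝ) * Real.exp (-(a ^ 2 * t + b ^ 2 / t))) (Ioi 0) ∧
    ∫ t in Ioi (0 : ℝ), t ^ (-3 / 2 : ℝ) * Real.exp (-(a ^ 2 * t + b ^ 2 / t)) =
      √Real.pi / b * Real.exp (-(2 * (a * b))) := by
  set l := -(Real.exp (2 * (a * b)) * (√Real.pi / 2) +
    Real.exp (-(2 * (a * b))) * (√Real.pi / 2)) / b with hl
  -- The primitive is given its limit as value at 0, to make it continuous there from the right.
  set g : ℝ → ℝ := Function.update (besselPrimitive a b) 0 l with hg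
  have hcont : ContinuousWithinAt g (Ici 0) 0 := by
    rw [hg, continuousWithinAt_update_same]
    have : Ici (0 : ℝ) \ {0} = Ioi 0 := Ici_sdiff_left
    rw [this]
    exact tendsto_besselPrimitive_zero hb
  have hderiv : ∀ t ∈ Ioi (0 : ℝ), HasDerivAt g
      (t ^ (-3 / 2 : ℝ) * Real.exp (-(a ^ 2 * t + b ^ 2 / t))) t := fun t ht => by
    refine (hasDerivAt_besselPrimitive hb ht).congr_of_eventuallyEq ?_
    filter_upwards [isOpen_Ioi.mem_nhds ht] with s hs
    exact Function.update_of_ne (ne_of_gt hs) _ _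
  have hpos : ∀ t ∈ Ioi (0 : ℝ),
      0 ≤ t ^ (-3 / 2 : ℝ) * Real.exp (-(a ^ 2 * t + b ^ 2 / t)) := fun t ht =>
    mul_nonneg (Real.rpow_nonneg (le_of_lt ht) _) (Real.exp_pos _).le
  have hlim := (tendsto_besselPrimitive_atTop (b := b) ha).congr' (f₂ := g) (by
    filter_upwards [Ioi_mem_atTop (0 : ℝ)] with s hs
    exact (Function.update_of_ne (ne_of_gt hs) _ _).symm)
  refine ⟨integrableOn_Ioi_deriv_of_nonneg hcont hderiv hpos hlim, ?_⟩
  rw [integral_Ioi_of_hasDerivAt_of_nonneg hcont hderiv hpos hlim, hg, Function.update_self, hl]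
  field_simp
  ring

end SeibergWitten

end

noncomputable section

namespace SeibergWitten

open MeasureTheory Filter Set

/-! ### The Bessel kernel -/

/-- The terms of the part of the theta function that survives after removing the constant terms
in both variables. -/
def besselTerm (x y : ℝ) (n : ℤ × ℤ) (t : ℝ) : ℂ :=
  if n.1 = 0 ∨ n.2 = 0 then 0 else
    Complex.exp (-(2 * Real.pi * Complex.I * n.1 * n.2 * x)) *
      (Real.exp (-(Real.pi * y * (n.1 ^ 2 * t + n.2 ^ 2 / t))) : ℝ)

/-- The sum of the Bessel terms. -/
def besselKernel (x y : ℝ) (t : ℝ) : ℂ := ∑' n, besselTerm x y n t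

/-- A summable bound for the Bessel terms. -/
def besselBound (y : ℝ) (n : ℤ × ℤ) : ℝ :=
  Real.exp (-(Real.pi * y / 2 * |(n.1 : ℝ)|)) * Real.exp (-(Real.pi * y / 2 * |(n.2 : ℝ)|))

lemma summable_exp_neg_mul_abs {c : ℝ} (hc : 0 < c) :
    Summable fun n : ℤ => Real.exp (-(c * |(n : ℝ)|)) := by
  have h : Summable fun n : ℕ => Real.exp (-(c * (n : ℝ))) := by
    have := Real.summable_exp_nat_mul_iff.mpr (neg_lt_zero.mpr hc)
    exact this.congr fun n => by ring_nf
  refine Summable.of_nat_of_neg ?_ ?_ <;> simpa using h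

lemma summable_besselBound {y : ℝ} (hy : 0 < y) : Summable (besselBound y) := by
  have hc : 0 < Real.pi * y / 2 := by positivity
  have h := summable_exp_neg_mul_abs hc
  exact h.mul_of_nonneg h (fun _ => (Real.exp_pos _).le) fun _ => (Real.exp_pos _).le

lemma norm_besselTerm (x y : ℝ) (n : ℤ × ℤ) (t : ℝ) : ‖besselTerm x y n t‖ =
    if n.1 = 0 ∨ n.2 = 0 then 0 else
      Real.exp (-(Real.pi * y * (n.1 ^ 2 * t + n.2 ^ 2 / t))) := by
  rw [besselTerm]
  split_ifs
  · simp
  · rw [norm_mul, Complex.norm_real, Real.norm_of_nonneg (Real.exp_pos _).le, Complex.norm_exp]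
    simp

/-- The average of two bounds: `t + 1/t`, termwise, which gives decay in `t` at both ends, and `|m|
+ |k| ≤ 2|m||k| ≤ m²t + k²/t`, which gives summability in `(m, k)`. -/
lemma add_div_ge {m k t : ℝ} (hm : 1 ≤ |m|) (hk : 1 ≤ |k|) (ht : 0 < t) :
    (t + 1 / t) / 2 + (|m| + |k|) / 2 ≤ m ^ 2 * t + k ^ 2 / t := by
  rw [← sq_abs m, ← sq_abs k]
  set a := |m|
  set b := |k|
  have h1 : t ≤ a ^ 2 * t := le_mul_of_one_le_left ht.le (one_le_pow₀ hm)
  have h2 : 1 / t ≤ b ^ 2 / t := by gcongr; exact one_le_pow₀ hk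
  have h3 : 2 * (a * b) ≤ a ^ 2 * t + b ^ 2 / t := by
    have : a ^ 2 * t + b ^ 2 / t - 2 * (a * b) = (a * t - b) ^ 2 / t := by field_simp; ring
    have h0 : 0 ≤ (a * t - b) ^ 2 / t := by positivity
    linarith
  have h4 : a + b ≤ 2 * (a * b) := by nlinarith
  linarith

lemma norm_besselTerm_le {x y : ℝ} (hy : 0 < y) (n : ℤ × ℤ) {t : ℝ} (ht : 0 < t) :
    ‖besselTerm x y n t‖ ≤ besselBound y n * Real.exp (-(Real.pi * y / 2 * (t + 1 / t))) := by
  rw [norm_besselTerm]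
  split_ifs with h
  · rw [besselBound]; positivity
  · push Not at h
    have h1 : (1 : ℝ) ≤ |(n.1 : ℝ)| := by exact_mod_cast Int.one_le_abs h.1
    have h2 : (1 : ℝ) ≤ |(n.2 : ℝ)| := by exact_mod_cast Int.one_le_abs h.2
    rw [besselBound, ← Real.exp_add, ← Real.exp_add, Real.exp_le_exp]
    have h3 := mul_le_mul_of_nonneg_left (add_div_ge h1 h2 ht) (by positivity : 0 ≤ Real.pi * y)
    linarith

lemma exp_neg_add_inv_le_one {y t : ℝ} (hy : 0 < y) (ht : 0 < t) :
    Real.exp (-(Real.pi * y / 2 * (t + 1 / t))) ≤ 1 := by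
  rw [Real.exp_le_one_iff, neg_nonpos]; positivity

lemma norm_besselTerm_le' {x y : ℝ} (hy : 0 < y) (n : ℤ × ℤ) {t : ℝ} (ht : 0 < t) :
    ‖besselTerm x y n t‖ ≤ besselBound y n :=
  (norm_besselTerm_le hy n ht).trans (mul_le_of_le_one_right
    (by rw [besselBound]; positivity) (exp_neg_add_inv_le_one hy ht))

lemma summable_besselTerm (x : ℝ) {y : ℝ} (hy : 0 < y) {t : ℝ} (ht : 0 < t) :
    Summable fun n => besselTerm x y n t :=
  (summable_besselBound hy).of_norm_bounded fun n => norm_besselTerm_le' hy n ht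

lemma continuousOn_besselTerm (x y : ℝ) (n : ℤ × ℤ) :
    ContinuousOn (besselTerm x y n) (Ioi 0) := by
  unfold besselTerm
  split_ifs
  · exact continuousOn_const
  · refine continuousOn_const.mul (Complex.continuous_ofReal.comp_continuousOn ?_)
    refine Real.continuous_exp.comp_continuousOn (ContinuousOn.neg (continuousOn_const.mul ?_))
    exact (by fun_prop : ContinuousOn (fun t : ℝ => (n.1 : ℝ) ^ 2 * t) (Ioi 0)).add
      (continuousOn_const.div continuousOn_id fun t ht => ne_of_gt ht)

lemma continuousOn_besselKernel (x : ℝ) {y : ℝ} (hy : 0 < y) :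
    ContinuousOn (besselKernel x y) (Ioi 0) :=
  continuousOn_tsum (continuousOn_besselTerm x y) (summable_besselBound hy)
    fun n _ ht => norm_besselTerm_le' hy n ht

lemma norm_besselKernel_le {x y : ℝ} (hy : 0 < y) {t : ℝ} (ht : 0 < t) :
    ‖besselKernel x y t‖ ≤
      (∑' n, besselBound y n) * Real.exp (-(Real.pi * y / 2 * (t + 1 / t))) :=
  tsum_of_norm_bounded ((summable_besselBound hy).hasSum.mul_right _)
    fun n => norm_besselTerm_le hy n ht

lemma isBigO_besselKernel_atTop (x : ℝ) {y : ℝ} (hy : 0 < y) (a : ℝ) :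
    besselKernel x y =O[atTop] fun t : ℝ => t ^ (-a) := by
  have hc : 0 < Real.pi * y / 2 := by positivity
  refine Asymptotics.IsBigO.trans ?_ (isLittleO_exp_neg_mul_rpow_atTop hc (-a)).isBigO
  refine Asymptotics.IsBigO.of_bound (∑' n, besselBound y n) ?_
  filter_upwards [eventually_gt_atTop 0] with t ht
  refine (norm_besselKernel_le hy ht).trans ?_
  rw [Real.norm_of_nonneg (Real.exp_pos _).le]
  refine mul_le_mul_of_nonneg_left ?_ (tsum_nonneg fun n => by rw [besselBound]; positivity)
  rw [Real.exp_le_exp, neg_mul, neg_le_neg_iff]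
  refine mul_le_mul_of_nonneg_left ?_ hc.le
  have : 0 < 1 / t := by positivity
  linarith

lemma isBigO_besselKernel_zero (x : ℝ) {y : ℝ} (hy : 0 < y) (a : ℝ) :
    besselKernel x y =O[𝓝[>] 0] fun t : ℝ => t ^ (-a) := by
  have hc : 0 < Real.pi * y / 2 := by positivity
  have h1 := ((isLittleO_exp_neg_mul_rpow_atTop hc a).isBigO).comp_tendsto
    (tendsto_inv_nhdsGT_zero (𝕜 := ℝ))
  have h2 : (fun t : ℝ => (t⁻¹) ^ a) =ᶠ[𝓝[>] 0] fun t => t ^ (-a) := by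
    filter_upwards [self_mem_nhdsWithin] with t ht
    rw [Real.inv_rpow (le_of_lt ht), Real.rpow_neg (le_of_lt ht)]
  refine Asymptotics.IsBigO.trans ?_ (h1.trans_eventuallyEq h2)
  refine Asymptotics.IsBigO.of_bound (∑' n, besselBound y n) ?_
  filter_upwards [self_mem_nhdsWithin] with t ht
  have ht' : 0 < t := ht
  refine (norm_besselKernel_le hy ht).trans ?_
  rw [Function.comp_apply, Real.norm_of_nonneg (Real.exp_pos _).le]
  refine mul_le_mul_of_nonneg_left ?_ (tsum_nonneg fun n => by rw [besselBound]; positivity)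
  rw [Real.exp_le_exp, neg_mul, neg_le_neg_iff]
  refine mul_le_mul_of_nonneg_left ?_ hc.le
  rw [← one_div]
  linarith

lemma locallyIntegrableOn_besselKernel (x : ℝ) {y : ℝ} (hy : 0 < y) :
    LocallyIntegrableOn (besselKernel x y) (Ioi 0) :=
  (continuousOn_besselKernel x hy).locallyIntegrableOn measurableSet_Ioi

lemma mellinConvergent_besselKernel (x : ℝ) {y : ℝ} (hy : 0 < y) (s : ℂ) :
    MellinConvergent (besselKernel x y) s :=
  mellinConvergent_of_isBigO_rpow (locallyIntegrableOn_besselKernel x hy)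
    (isBigO_besselKernel_atTop x hy (s.re + 1)) (by linarith)
    (isBigO_besselKernel_zero x hy (s.re - 1)) (by linarith)

/-- The kernel decays faster than any power at both ends, so the exponents `Re s ± 1` enclose an
arbitrary `s`. -/
lemma differentiable_mellin_besselKernel (x : ℝ) {y : ℝ} (hy : 0 < y) :
    Differentiable ℂ (mellin (besselKernel x y)) := fun s =>
  mellin_differentiableAt_of_isBigO_rpow (locallyIntegrableOn_besselKernel x hy)
    (isBigO_besselKernel_atTop x hy (s.re + 1)) (by linarith)
    (isBigO_besselKernel_zero x hy (s.re - 1)) (by linarith)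

/-! ### The special value of the Bessel part -/

/-- The value of the Mellin transform of a Bessel term at `-1/2`, up to normalisation. -/
def besselValue (x y : ℝ) (n : ℤ × ℤ) : ℂ :=
  if n.1 = 0 ∨ n.2 = 0 then 0 else
    Complex.exp (-(2 * Real.pi * Complex.I * n.1 * n.2 * x)) *
      (Real.exp (-(2 * Real.pi * y * (|(n.1 : ℝ)| * |(n.2 : ℝ)|))) / |(n.2 : ℝ)| : ℝ)

/-- At `-1/2` the Mellin weight is `t^{-3/2}`, so `integral_bessel` applies with `a = √(πy)|m|` and
`b = √(πy)|k|`. The integral of the norm is needed to interchange sum and integral. -/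
lemma mellin_besselTerm {x y : ℝ} (hy : 0 < y) (n : ℤ × ℤ) :
    IntegrableOn (fun t : ℝ => (t : ℂ) ^ ((-1 / 2 : ℂ) - 1) • besselTerm x y n t) (Ioi 0) ∧
    ∫ t in Ioi (0 : ℝ), (t : ℂ) ^ ((-1 / 2 : ℂ) - 1) • besselTerm x y n t =
      besselValue x y n / √y ∧
    ∫ t in Ioi (0 : ℝ), ‖(t : ℂ) ^ ((-1 / 2 : ℂ) - 1) • besselTerm x y n t‖ =
      ‖besselValue x y n‖ / √y := by
  by_cases h : n.1 = 0 ∨ n.2 = 0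
  · simp [besselTerm, besselValue, h]
  · have h' := h
    push Not at h'
    have h1 : 0 < |(n.1 : ℝ)| := abs_pos.mpr (by exact_mod_cast h'.1)
    have h2 : 0 < |(n.2 : ℝ)| := abs_pos.mpr (by exact_mod_cast h'.2)
    have hr : 0 < √(Real.pi * y) := Real.sqrt_pos.mpr (by positivity)
    have hrs : √(Real.pi * y) ^ 2 = Real.pi * y := Real.sq_sqrt (by positivity)
    set c := Complex.exp (-(2 * Real.pi * Complex.I * n.1 * n.2 * x)) with hc
    have hcn : ‖c‖ = 1 := by rw [hc, Complex.norm_exp]; simp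
    obtain ⟨hi, hv⟩ := integral_bessel (mul_pos hr h1) (mul_pos hr h2)
    set g : ℝ → ℝ := fun t => t ^ (-3 / 2 : ℝ) * Real.exp (-((√(Real.pi * y) * |(n.1 : ℝ)|) ^ 2 * t +
      (√(Real.pi * y) * |(n.2 : ℝ)|) ^ 2 / t)) with hg
    have hterm : ∀ t ∈ Ioi (0 : ℝ), (t : ℂ) ^ ((-1 / 2 : ℂ) - 1) • besselTerm x y n t =
        c * (g t : ℝ) := by
      intro t ht
      have e1 : (t : ℂ) ^ ((-1 / 2 : ℂ) - 1) = ((t ^ (-3 / 2 : ℝ) : ℝ) : ℂ) := by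
        rw [Complex.ofReal_cpow (le_of_lt ht)]
        congr 1
        push_cast
        norm_num
      rw [e1, besselTerm, if_neg h, hg, mul_pow, mul_pow, hrs, sq_abs, sq_abs, smul_eq_mul]
      rw [show Real.pi * y * ((n.1 : ℝ) ^ 2 * t + (n.2 : ℝ) ^ 2 / t) =
        Real.pi * y * (n.1 : ℝ) ^ 2 * t + Real.pi * y * (n.2 : ℝ) ^ 2 / t by ring]
      push_cast
      ring
    have hval : √Real.pi / (√(Real.pi * y) * |(n.2 : ℝ)|) *
        Real.exp (-(2 * (√(Real.pi * y) * |(n.1 : ℝ)| * (√(Real.pi * y) * |(n.2 : ℝ)|)))) =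
        Real.exp (-(2 * Real.pi * y * (|(n.1 : ℝ)| * |(n.2 : ℝ)|))) / |(n.2 : ℝ)| / √y := by
      rw [show 2 * (√(Real.pi * y) * |(n.1 : ℝ)| * (√(Real.pi * y) * |(n.2 : ℝ)|)) =
        2 * √(Real.pi * y) ^ 2 * (|(n.1 : ℝ)| * |(n.2 : ℝ)|) by ring, hrs,
        Real.sqrt_mul Real.pi_pos.le]
      have := Real.sqrt_pos.mpr Real.pi_pos
      have := Real.sqrt_pos.mpr hy
      field_simp
    refine ⟨?_, ?_, ?_⟩
    · rw [integrableOn_congr_fun hterm measurableSet_Ioi]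
      exact (hi.ofReal (𝕜 := ℂ)).const_mul c
    · rw [setIntegral_congr_fun measurableSet_Ioi hterm, integral_const_mul, integral_complex_ofReal, hv,
        hval, besselValue, if_neg h]
      push_cast
      ring
    · have hn : ∀ t ∈ Ioi (0 : ℝ), ‖(t : ℂ) ^ ((-1 / 2 : ℂ) - 1) • besselTerm x y n t‖ = g t := by
        intro t ht
        rw [hterm t ht, norm_mul, hcn, one_mul, Complex.norm_real, Real.norm_of_nonneg]
        exact mul_nonneg (Real.rpow_nonneg (le_of_lt ht) _) (Real.exp_pos _).le
      rw [setIntegral_congr_fun measurableSet_Ioi hn, hv, hval, besselValue, if_neg h, norm_mul,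
        ← hc, hcn, one_mul, Complex.norm_real, Real.norm_of_nonneg (by positivity)]

lemma summable_norm_besselValue (x : ℝ) {y : ℝ} (hy : 0 < y) :
    Summable fun n => ‖besselValue x y n‖ := by
  refine (summable_besselBound hy).of_nonneg_of_le (fun _ => norm_nonneg _) fun n => ?_
  rw [besselValue]
  split_ifs with h
  · rw [norm_zero, besselBound]; positivity
  · push Not at h
    have h1 : (1 : ℝ) ≤ |(n.1 : ℝ)| := by exact_mod_cast Int.one_le_abs h.1
    have h2 : (1 : ℝ) ≤ |(n.2 : ℝ)| := by exact_mod_cast Int.one_le_abs h.2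
    rw [norm_mul, Complex.norm_real, Real.norm_of_nonneg (by positivity), Complex.norm_exp]
    have h3 : Real.exp (-(2 * Real.pi * y * (|(n.1 : ℝ)| * |(n.2 : ℝ)|))) ≤ besselBound y n := by
      rw [besselBound, ← Real.exp_add, Real.exp_le_exp]
      have h4 : |(n.1 : ℝ)| + |(n.2 : ℝ)| ≤ 4 * (|(n.1 : ℝ)| * |(n.2 : ℝ)|) := by nlinarith
      have := mul_le_mul_of_nonneg_left h4 (by positivity : 0 ≤ Real.pi * y / 2)
      linarith
    simp only [Complex.neg_re, Complex.mul_re, Complex.re_ofNat, Complex.ofReal_re, Complex.im_ofNat,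
      Complex.ofReal_im, mul_zero, sub_zero, Complex.I_re, Complex.mul_im, zero_mul, add_zero,
      Complex.I_im, mul_one, Complex.intCast_re, Complex.intCast_im, neg_zero, Real.exp_zero,
      one_mul, sub_self]
    exact (div_le_self (Real.exp_pos _).le h2).trans h3

lemma hasSum_besselValue (x : ℝ) {y : ℝ} (hy : 0 < y) :
    HasSum (besselValue x y) (√y * mellin (besselKernel x y) (-1 / 2)) := by
  have hs : (√y : ℂ) ≠ 0 := by exact_mod_cast (Real.sqrt_pos.mpr hy).ne'
  have h := hasSum_integral_of_summable_integral_norm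
    (F := fun (n : ℤ × ℤ) (t : ℝ) => (t : ℂ) ^ ((-1 / 2 : ℂ) - 1) • besselTerm x y n t)
    (μ := volume.restrict (Ioi 0)) (fun n => (mellin_besselTerm hy n).1)
    (by simp only [fun n => (mellin_besselTerm (x := x) hy n).2.2]
        exact (summable_norm_besselValue x hy).div_const _)
  simp only [fun n => (mellin_besselTerm (x := x) hy n).2.1] at h
  have h2 : ∫ t in Ioi (0 : ℝ), ∑' n, (t : ℂ) ^ ((-1 / 2 : ℂ) - 1) • besselTerm x y n t =
      mellin (besselKernel x y) (-1 / 2) := by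
    rw [mellin]
    congr 1
    ext t
    rw [besselKernel, tsum_const_smul'']
  rw [h2] at h
  refine (h.mul_left (√y : ℂ)).congr_fun fun n => ?_
  field_simp

end SeibergWitten

end

noncomputable section

namespace SeibergWitten

open MeasureTheory Filter Set

/-! ### The Bessel part and the Dedekind eta function -/

/-- Real parts suffice because only `|∏ (1 - qⁿ)|` is wanted. The cosine is even, so the signs of
`m` and `k` disappear and a power of `q` is left. -/
lemma re_besselValue (x y : ℝ) (n : ℤ × ℤ) : (besselValue x y n).re =
    if n.1 = 0 ∨ n.2 = 0 then 0 else
      ((Complex.exp (2 * Real.pi * Complex.I * (x + y * Complex.I)) ^ n.1.natAbs) ^ n.2.natAbs /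
        (n.2.natAbs : ℂ)).re := by
  rw [besselValue]
  split_ifs with h
  · rfl
  have h1 : (n.1.natAbs : ℝ) = |(n.1 : ℝ)| := by rw [Nat.cast_natAbs]; simp
  have h2 : (n.2.natAbs : ℝ) = |(n.2 : ℝ)| := by rw [Nat.cast_natAbs]; simp
  rw [← pow_mul, ← Complex.exp_nat_mul, ← Complex.ofReal_natCast n.2.natAbs, Complex.div_ofReal_re,
    Complex.re_mul_ofReal, Complex.exp_re, Complex.exp_re]
  have e1 : (-(2 * Real.pi * Complex.I * n.1 * n.2 * x) : ℂ).re = 0 := by simp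
  have e2 : (-(2 * Real.pi * Complex.I * n.1 * n.2 * x) : ℂ).im =
      -(2 * Real.pi * x * (n.1 * n.2)) := by
    simp; ring
  have e3 : (((n.1.natAbs * n.2.natAbs : ℕ) : ℂ) *
      (2 * Real.pi * Complex.I * (x + y * Complex.I))).re =
      -(2 * Real.pi * y * (|(n.1 : ℝ)| * |(n.2 : ℝ)|)) := by
    rw [← h1, ← h2, ← Complex.ofReal_natCast, Complex.re_ofReal_mul]; simp; ring
  have e4 : (((n.1.natAbs * n.2.natAbs : ℕ) : ℂ) *
      (2 * Real.pi * Complex.I * (x + y * Complex.I))).im =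
      2 * Real.pi * x * |(n.1 : ℝ) * n.2| := by
    rw [abs_mul, ← h1, ← h2, ← Complex.ofReal_natCast, Complex.im_ofReal_mul]; simp; ring
  rw [e1, e2, e3, e4, Real.exp_zero, one_mul, Real.cos_neg, h2]
  have e5 : Real.cos (2 * Real.pi * x * |(n.1 : ℝ) * n.2|) =
      Real.cos (2 * Real.pi * x * (n.1 * n.2)) := by
    rcases abs_choice ((n.1 : ℝ) * n.2) with h | h <;> rw [h]
    rw [mul_neg, Real.cos_neg]
  rw [e5]
  ring

/-- The row is the Taylor series of `-log (1 - q^{|m|})`, taken once for `k > 0` and once for `k <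
0`. -/
lemma tsum_re_besselValue_right (x : ℝ) {y : ℝ} (hy : 0 < y) (m : ℤ) :
    ∑' k, (besselValue x y (m, k)).re = if m = 0 then 0 else
      -2 * Real.log ‖1 - Complex.exp (2 * Real.pi * Complex.I * (x + y * Complex.I)) ^ m.natAbs‖ := by
  set q := Complex.exp (2 * Real.pi * Complex.I * (x + y * Complex.I)) with hq
  have hq1 : ‖q‖ < 1 := by
    rw [hq, Complex.norm_exp]
    simp
    positivity
  have hs : Summable fun k => (besselValue x y (m, k)).re :=
    (Complex.hasSum_re (summable_norm_besselValue x hy).of_norm.hasSum).summable.prod_factor m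
  split_ifs with hm
  · simp [besselValue, hm]
  · have hz : ‖q ^ m.natAbs‖ < 1 := by
      rw [norm_pow]; exact pow_lt_one₀ (norm_nonneg _) hq1 (Int.natAbs_ne_zero.mpr hm)
    have heven : (fun k => (besselValue x y (m, k)).re).Even := fun k => by
      simp only [re_besselValue, neg_eq_zero, Int.natAbs_neg]
    rw [tsum_int_eq_zero_add_two_mul_tsum_pnat heven hs]
    have h0 : (besselValue x y (m, 0)).re = 0 := by simp [besselValue]
    have h1 : ∀ k : ℕ+, (besselValue x y (m, ((k : ℕ) : ℤ))).re =
        ((q ^ m.natAbs) ^ (k : ℕ) / ((k : ℕ) : ℂ)).re := fun k => by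
      rw [re_besselValue]
      simp [hm, hq]
    rw [h0, tsum_congr h1, tsum_pnat_eq_tsum_succ
      (f := fun k : ℕ => ((q ^ m.natAbs) ^ k / (k : ℂ)).re)]
    have h2 := Complex.hasSum_re (Complex.hasSum_taylorSeries_neg_log hz)
    have h3 := (hasSum_nat_add_iff' 1).mpr h2
    simp only [Finset.range_one, Finset.sum_singleton, pow_zero, Nat.cast_zero, div_zero,
      Complex.zero_re, sub_zero] at h3
    rw [h3.tsum_eq, Complex.neg_re, Complex.log_re]
    ring

/-- The special value of the Bessel part is `-4 log |∏ (1 - qⁿ)|`. -/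
lemma re_mellin_besselKernel (τ : UpperHalfPlane) :
    ‖∏' n : ℕ, (1 - ModularForm.eta_q n τ)‖ ^ 4 =
      Real.exp (-(√τ.im * mellin (besselKernel τ.re τ.im) (-1 / 2)).re) := by
  have hy := τ.im_pos
  set q := Complex.exp (2 * Real.pi * Complex.I * τ) with hq
  have hqe : q = Complex.exp (2 * Real.pi * Complex.I * (τ.re + τ.im * Complex.I)) := by
    rw [hq]; congr 2; exact (Complex.re_add_im (τ : ℂ)).symm
  have hsum := Complex.hasSum_re (hasSum_besselValue τ.re hy)
  have hprod := hsum.summable.tsum_prod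
  rw [hsum.tsum_eq] at hprod
  simp only [tsum_re_besselValue_right τ.re hy, ← hqe] at hprod
  set h : ℤ → ℝ := fun m => if m = 0 then 0 else -2 * Real.log ‖1 - q ^ m.natAbs‖ with hh
  have hsh : Summable h := by
    have := hsum.summable.prod
    simpa only [tsum_re_besselValue_right τ.re hy, ← hqe] using this
  have heven : h.Even := fun k => by simp [hh]
  have hh0 : h 0 = 0 := by simp [hh]
  have hN : Summable fun n : ℕ => h (n + 1 : ℕ) :=
    (summable_nat_add_iff 1 (f := fun n : ℕ => h n)).mpr
      (hsh.comp_injective Nat.cast_injective)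
  have hterm (n : ℕ) : h (n + 1 : ℕ) = -2 * Real.log ‖1 - ModularForm.eta_q n τ‖ := by
    rw [ModularForm.eta_q_eq_pow, hh]
    have : ((n + 1 : ℕ) : ℤ) ≠ 0 := by omega
    simp only [this, if_false, Int.natAbs_natCast]
    rfl
  change _ = ∑' m, h m at hprod
  rw [tsum_int_eq_zero_add_two_mul_tsum_pnat heven hsh, hh0, zero_add,
    tsum_pnat_eq_tsum_succ (f := fun n : ℕ => h n)] at hprod
  -- The rows `±m` agree and each contributes `-2 log |1 - q^{|m|}|`, which explains the factor
  -- `-1/4`.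
  have hlog : HasSum (fun n : ℕ => Real.log ‖1 - ModularForm.eta_q n τ‖)
      (-(1 / 4) * (√τ.im * mellin (besselKernel τ.re τ.im) (-1 / 2)).re) := by
    rw [hprod]
    have h1 := (hN.hasSum).mul_left (-1 / 2 : ℝ)
    rw [nsmul_eq_mul, ← mul_assoc, show -(1 / 4 : ℝ) * (2 : ℕ) = -1 / 2 by norm_num]
    refine h1.congr_fun fun n => ?_
    rw [hterm]; ring
  have hne (n : ℕ) : 0 < ‖1 - ModularForm.eta_q n τ‖ :=
    norm_pos_iff.mpr (ModularForm.one_sub_eta_q_ne_zero n τ.2)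
  have h2 := Real.hasProd_of_hasSum_log hne hlog
  have h3 := (ModularForm.multipliableLocallyUniformlyOn_eta.multipliable τ.2).hasProd.norm
  rw [h3.unique h2, ← Real.exp_nat_mul]
  congr 1
  push_cast
  ring

end SeibergWitten

end

noncomputable section

namespace SeibergWitten

open MeasureTheory Filter Set

/-! ### The Epstein zeta function for `Re s > 1` -/

/-- The normalised quadratic form of the lattice `ℤ τ + ℤ`. -/
def quadForm (τ : UpperHalfPlane) (n : ℤ × ℤ) : ℝ :=
  Real.pi / τ.im * ‖(n.1 : ℂ) * τ + n.2‖ ^ 2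

lemma quadForm_eq (τ : UpperHalfPlane) (n : ℤ × ℤ) :
    quadForm τ n = Real.pi / τ.im * ((n.2 + n.1 * τ.re) ^ 2 + (n.1 * τ.im) ^ 2) := by
  rw [quadForm, ← Complex.normSq_eq_norm_sq, Complex.normSq_apply]
  congr 1
  simp
  ring

lemma quadForm_nonneg (τ : UpperHalfPlane) (n : ℤ × ℤ) : 0 ≤ quadForm τ n := by
  have := τ.im_pos
  rw [quadForm]; positivity

lemma quadForm_pos (τ : UpperHalfPlane) {n : ℤ × ℤ} (h : n.1 ≠ 0) : 0 < quadForm τ n := by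
  have := τ.im_pos
  have h' : (n.1 : ℝ) ≠ 0 := by exact_mod_cast h
  rw [quadForm_eq]
  positivity

lemma summable_quadForm_rpow (τ : UpperHalfPlane) {σ : ℝ} (hσ : 1 < σ) :
    Summable fun n : ℤ × ℤ => 1 / quadForm τ n ^ σ := by
  have hy := τ.im_pos
  have h1 := (EisensteinSeries.summable_one_div_norm_rpow (k := 2 * σ) (by linarith)).mul_left
    ((Real.pi / τ.im) ^ (-σ) * EisensteinSeries.r τ ^ (-(2 * σ)))
  rw [← (finTwoArrowEquiv ℤ).symm.summable_iff] at h1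
  refine h1.of_nonneg_of_le (fun n => ?_) fun n => ?_
  · have := quadForm_nonneg τ n
    positivity
  · have h2 := EisensteinSeries.summand_bound τ (k := 2 * σ) (by linarith)
      ((finTwoArrowEquiv ℤ).symm n)
    simp only [finTwoArrowEquiv_symm_apply, Matrix.cons_val_zero, Matrix.cons_val_one,
      Function.comp_apply] at h2 ⊢
    rw [quadForm, one_div, ← Real.rpow_neg (by positivity),
      Real.mul_rpow (by positivity) (by positivity), ← Real.rpow_natCast, ← Real.rpow_mul
      (norm_nonneg _), mul_assoc]
    refine mul_le_mul_of_nonneg_left ?_ (by positivity)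
    rwa [show ((2 : ℕ) : ℝ) * -σ = -(2 * σ) by push_cast; ring]

lemma summable_exp_neg_quadForm (τ : UpperHalfPlane) {t : ℝ} (ht : 0 < t) :
    Summable fun n : ℤ × ℤ => (if n.1 = 0 then 0 else 1) * Real.exp (-quadForm τ n * t) := by
  have h := (summable_quadForm_rpow τ (σ := 2) (by norm_num)).mul_left (2 / t ^ 2)
  refine h.of_nonneg_of_le (fun n => ?_) fun n => ?_
  · split_ifs <;> positivity
  · split_ifs with h0
    · have := quadForm_nonneg τ n
      rw [zero_mul]
      positivity
    · have hp := quadForm_pos τ h0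
      -- The bound `e^{-x} ≤ 2/x²` reduces the claim to the zeta sum at `σ = 2`.
      have h1 := Real.pow_div_factorial_le_exp (quadForm τ n * t) (by positivity) 2
      have h2 : Real.exp (-quadForm τ n * t) = 1 / Real.exp (quadForm τ n * t) := by
        rw [neg_mul, Real.exp_neg, one_div]
      rw [one_mul, h2, show ((2 : ℝ)) = ((2 : ℕ) : ℝ) by norm_num, Real.rpow_natCast]
      refine (one_div_le_one_div_of_le (by positivity) h1).trans (le_of_eq ?_)
      simp only [Nat.factorial]
      field_simp

lemma tsum_exp_neg_shift_sq {y t : ℝ} (hy : 0 < y) (ht : 0 < t) (c : ℝ) :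
    ∑' n : ℤ, Complex.exp (-Real.pi * t / y * (n + c) ^ 2) =
      √(y / t) * ∑' k : ℤ, Complex.exp (-Real.pi * y / t * k ^ 2 - 2 * Real.pi * Complex.I * c * k) := by
  have ha : 0 < ((y / t : ℝ) : ℂ).re := by rw [Complex.ofReal_re]; positivity
  -- Poisson summation; the imaginary linear coefficient `-ic` becomes the real shift `c` on the
  -- dual side.
  have h := Complex.tsum_exp_neg_quadratic ha (-(Complex.I * c))
  have hs : (((y / t : ℝ) : ℂ)) ^ (1 / 2 : ℂ) = (√(y / t) : ℝ) := by
    rw [Real.sqrt_eq_rpow, Complex.ofReal_cpow (by positivity)]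
    norm_num
  have hs0 : ((√(y / t) : ℝ) : ℂ) ≠ 0 := by
    have := Real.sqrt_pos.mpr (div_pos hy ht)
    exact_mod_cast this.ne'
  rw [hs] at h
  have h1 : ∑' k : ℤ, Complex.exp (-Real.pi * y / t * k ^ 2 - 2 * Real.pi * Complex.I * c * k) =
      ∑' n : ℤ, Complex.exp (-Real.pi * ((y / t : ℝ) : ℂ) * n ^ 2 +
        2 * Real.pi * (-(Complex.I * c)) * n) := by
    refine tsum_congr fun n => ?_
    congr 1
    push_cast
    ring
  have h2 : ∑' n : ℤ, Complex.exp (-Real.pi * t / y * (n + c) ^ 2) =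
      ∑' n : ℤ, Complex.exp (-Real.pi / ((y / t : ℝ) : ℂ) * (n + Complex.I * -(Complex.I * c)) ^ 2) := by
    refine tsum_congr fun n => ?_
    congr 1
    have : Complex.I * -(Complex.I * c) = c := by
      rw [mul_neg, ← mul_assoc, Complex.I_mul_I]; ring
    rw [this]
    push_cast
    field_simp
  rw [h1, h, h2]
  field_simp

/-- Poisson summation in `n`, with shift `m Re τ`. The zero frequency gives the term `e^{-πm² t Im
τ}` of a Jacobi theta function, the other frequencies give the Bessel terms. -/
lemma tsum_row (τ : UpperHalfPlane) {t : ℝ} (ht : 0 < t) (m : ℤ) :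
    ∑' n : ℤ, (if m = 0 then 0 else 1 : ℂ) * Real.exp (-quadForm τ (m, n) * t) =
      √(τ.im / t) * ((if m = 0 then 0 else Real.exp (-Real.pi * m ^ 2 * (τ.im * t)) : ℝ) +
        ∑' k : ℤ, besselTerm τ.re τ.im (m, k) t) := by
  have hy := τ.im_pos
  by_cases hm : m = 0
  · simp [hm, besselTerm]
  have hK : Summable fun k : ℤ => besselTerm τ.re τ.im (m, k) t :=
    (summable_besselTerm τ.re hy ht).prod_factor m
  simp only [hm, if_false, one_mul]
  set E : ℂ := ((Real.exp (-Real.pi * m ^ 2 * (τ.im * t)) : ℝ) : ℂ) with hE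
  have hterm (k : ℤ) : E * Complex.exp (-Real.pi * τ.im / t * k ^ 2 -
      2 * Real.pi * Complex.I * (m * τ.re : ℝ) * k) =
      besselTerm τ.re τ.im (m, k) t + if k = 0 then E else 0 := by
    rcases eq_or_ne k 0 with rfl | hk
    · simp [besselTerm]
    · simp only [besselTerm, hm, hk, or_self, if_false, add_zero, hE]
      have ht0 : (t : ℂ) ≠ 0 := by exact_mod_cast ht.ne'
      push_cast
      rw [← Complex.exp_add, ← Complex.exp_add]
      congr 1
      field_simp
      ring
  have hsplit : E * ∑' k : ℤ, Complex.exp (-Real.pi * τ.im / t * k ^ 2 -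
      2 * Real.pi * Complex.I * (m * τ.re : ℝ) * k) =
      E + ∑' k : ℤ, besselTerm τ.re τ.im (m, k) t := by
    rw [← tsum_mul_left, tsum_congr hterm, hK.tsum_add (hasSum_ite_eq 0 E).summable,
      (hasSum_ite_eq 0 E).tsum_eq, add_comm]
  rw [← hsplit, mul_left_comm, ← tsum_exp_neg_shift_sq hy ht, ← tsum_mul_left]
  refine tsum_congr fun n => ?_
  rw [hE, Complex.ofReal_exp, Complex.ofReal_exp, ← Complex.exp_add, quadForm_eq]
  congr 1
  push_cast
  field_simp
  ring

/-- The theta function of the lattice without the terms with `m = 0`, after Poisson summation. -/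
def thetaPart (τ : UpperHalfPlane) (t : ℝ) : ℂ :=
  √(τ.im / t) * (((HurwitzZeta.evenKernel 0 (τ.im * t) : ℝ) - 1) + besselKernel τ.re τ.im t)

lemma hasSum_thetaPart (τ : UpperHalfPlane) {t : ℝ} (ht : 0 < t) :
    HasSum (fun n : ℤ × ℤ => (if n.1 = 0 then 0 else 1 : ℂ) * Real.exp (-quadForm τ n * t))
      (thetaPart τ t) := by
  have hy := τ.im_pos
  have hS : Summable fun n : ℤ × ℤ =>
      (if n.1 = 0 then 0 else 1 : ℂ) * Real.exp (-quadForm τ n * t) := by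
    have := (Complex.hasSum_ofReal.mpr (summable_exp_neg_quadForm τ ht).hasSum).summable
    refine this.congr fun n => ?_
    split_ifs <;> simp
  have hE := HurwitzZeta.hasSum_int_evenKernel₀ 0 (mul_pos hy ht)
  have hE' : HasSum (fun m : ℤ =>
      ((if m = 0 then 0 else Real.exp (-Real.pi * m ^ 2 * (τ.im * t)) : ℝ) : ℂ))
      ((HurwitzZeta.evenKernel 0 (τ.im * t) : ℝ) - 1) := by
    have := Complex.hasSum_ofReal.mpr hE
    simpa using this
  have hB := summable_besselTerm τ.re hy ht
  convert hS.hasSum using 1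
  rw [hS.tsum_prod, tsum_congr (tsum_row τ ht), tsum_mul_left, hE'.summable.tsum_add hB.prod,
    hE'.tsum_eq, ← hB.tsum_prod, thetaPart, besselKernel]

lemma hasMellin_evenKernel {s : ℂ} (hs : 1 / 2 < s.re) :
    HasMellin (fun t => ((HurwitzZeta.evenKernel 0 t : ℝ) : ℂ) - 1) s
      (2 * completedRiemannZeta (2 * s)) := by
  have h := (HurwitzZeta.hurwitzEvenFEPair 0).hasMellin (s := s) hs
  have h2 : 2 * completedRiemannZeta (2 * s) = (HurwitzZeta.hurwitzEvenFEPair 0).Λ s := by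
    rw [completedRiemannZeta, HurwitzZeta.completedHurwitzZetaEven]
    rw [mul_div_cancel_left₀ _ (two_ne_zero)]
    ring
  rw [h2]
  simpa [HurwitzZeta.hurwitzEvenFEPair] using h

/-- The factor `t^{-1/2}` shifts the Mellin variable to `s - 1/2`, which turns `2s` into `2s - 1`;
rescaling `t` by `Im τ` produces the power of `Im τ`. -/
lemma mellin_thetaPart (τ : UpperHalfPlane) {s : ℂ} (hs : 1 < s.re) :
    mellin (thetaPart τ) s = 2 * (τ.im : ℂ) ^ (1 - s) * completedRiemannZeta (2 * s - 1) +
      √τ.im * mellin (besselKernel τ.re τ.im) (s - 1 / 2) := by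
  have hy := τ.im_pos
  have hs' : 1 / 2 < (s + (-1 / 2 : ℂ)).re := by
    have : (s + (-1 / 2 : ℂ)).re = s.re - 1 / 2 := by simp; norm_num; ring
    rw [this]; linarith
  have h1 := hasMellin_evenKernel hs'
  have h2 := (MellinConvergent.comp_mul_left hy).mpr h1.1
  have h3 := mellin_comp_mul_left
    (fun t => ((HurwitzZeta.evenKernel 0 t : ℝ) : ℂ) - 1) (s + (-1 / 2 : ℂ)) hy
  have h4 := hasMellin_add h2 (mellinConvergent_besselKernel τ.re hy (s + (-1 / 2 : ℂ)))
  have h5 : mellin (thetaPart τ) s = mellin (fun t : ℝ => (√τ.im : ℂ) •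
      ((t : ℂ) ^ (-1 / 2 : ℂ) • ((((HurwitzZeta.evenKernel 0 (τ.im * t) : ℝ) : ℂ) - 1) +
        besselKernel τ.re τ.im t))) s := by
    rw [mellin, mellin]
    refine setIntegral_congr_fun measurableSet_Ioi fun t ht => ?_
    have ht' : 0 < t := ht
    have e1 : (t : ℂ) ^ (-1 / 2 : ℂ) = ((√t)⁻¹ : ℝ) := by
      rw [Real.sqrt_eq_rpow, ← Real.rpow_neg ht'.le, Complex.ofReal_cpow ht'.le]
      norm_num
    simp only [thetaPart, Real.sqrt_div hy.le, e1, smul_eq_mul]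
    push_cast
    ring
  rw [h5, mellin_const_smul, mellin_cpow_smul, h4.2, h3, h1.2, smul_eq_mul, smul_eq_mul, mul_add]
  have e2 : (√τ.im : ℂ) = (τ.im : ℂ) ^ (1 / 2 : ℂ) := by
    rw [Real.sqrt_eq_rpow, Complex.ofReal_cpow hy.le]
    norm_num
  have hy0 : (τ.im : ℂ) ≠ 0 := by exact_mod_cast hy.ne'
  have e3 : (τ.im : ℂ) ^ (1 - s) = (τ.im : ℂ) ^ (1 / 2 : ℂ) * (τ.im : ℂ) ^ (-(s + (-1 / 2 : ℂ))) := by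
    rw [← Complex.cpow_add _ _ hy0]; congr 1; ring
  rw [e3, e2, show s + (-1 / 2 : ℂ) = s - 1 / 2 by ring, show 2 * (s - 1 / 2) = 2 * s - 1 by ring]
  ring

lemma hasSum_quadForm_axis (τ : UpperHalfPlane) {s : ℂ} (hs : 1 < s.re) :
    HasSum (fun n : ℤ => Complex.Gamma s / (quadForm τ (0, n) : ℂ) ^ s)
      (2 * (τ.im : ℂ) ^ s * completedRiemannZeta (2 * s)) := by
  have hy := τ.im_pos
  have hy0 : (τ.im : ℂ) ≠ 0 := by exact_mod_cast hy.ne'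
  have h := (HurwitzZeta.hasSum_int_completedCosZeta 0 (s := 2 * s) (by simp; linarith)).mul_left
    (2 * (τ.im : ℂ) ^ s)
  have h0 : HurwitzZeta.completedCosZeta ((0 : ℝ) : UnitAddCircle) (2 * s) =
      completedRiemannZeta (2 * s) := HurwitzZeta.completedCosZeta_zero _
  rw [h0] at h
  refine h.congr_fun fun n => ?_
  have e1 : (quadForm τ (0, n) : ℂ) ^ s =
      (Real.pi : ℂ) ^ s / (τ.im : ℂ) ^ s * ((|n| : ℤ) : ℂ) ^ (2 * s) := by
    have e2 : quadForm τ (0, n) = (Real.pi * (τ.im)⁻¹) * (|(n : ℝ)|) ^ 2 := by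
      rw [quadForm_eq, sq_abs]; simp [div_eq_mul_inv]
    rw [e2, Complex.ofReal_mul, Complex.mul_cpow_ofReal_nonneg (by positivity) (by positivity),
      Complex.ofReal_mul, Complex.mul_cpow_ofReal_nonneg (by positivity) (by positivity),
      Complex.ofReal_inv, Complex.inv_cpow, ← div_eq_mul_inv]
    · congr 1
      -- At `n = 0` both sides vanish because `0 ^ s = 0` for `s ≠ 0`; division by zero then makes
      -- that term of the series 0.
      rcases eq_or_ne n 0 with rfl | hn
      · have hs0 : s ≠ 0 := by rintro rfl; simp at hs; linarith
        simp [hs0]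
      · have hn' : ((|n| : ℤ) : ℂ) ≠ 0 := by exact_mod_cast abs_ne_zero.mpr hn
        have e3 : (((|(n : ℝ)|) ^ 2 : ℝ) : ℂ) = ((|(n : ℝ)| : ℝ) : ℂ) * ((|(n : ℝ)| : ℝ) : ℂ) := by
          push_cast; ring
        rw [e3, Complex.mul_cpow_ofReal_nonneg (abs_nonneg _) (abs_nonneg _), two_mul,
          Complex.cpow_add _ _ hn']
        have e4 : ((|(n : ℝ)| : ℝ) : ℂ) = ((|n| : ℤ) : ℂ) := by
          rw [← Int.cast_abs, Complex.ofReal_intCast]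
        rw [e4]
    · rw [Complex.arg_ofReal_of_nonneg hy.le]; exact Real.pi_pos.ne
  have hpi : (Real.pi : ℂ) ^ s ≠ 0 := by
    rw [Complex.cpow_ne_zero_iff]; left; exact_mod_cast Real.pi_ne_zero
  have hys : (τ.im : ℂ) ^ s ≠ 0 := by rw [Complex.cpow_ne_zero_iff]; left; exact hy0
  rw [e1, Complex.Gammaℝ_def, show -(2 * s) / 2 = -s by ring, show 2 * s / 2 = s by ring,
    Complex.cpow_neg]
  simp only [Complex.ofReal_zero, mul_zero, zero_mul, Complex.exp_zero, mul_one]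
  field_simp

/-- The Chowla-Selberg decomposition: the row `m = 0` is a Riemann zeta function, and the rows `m ≠
0` are the Mellin transform of `thetaPart`. -/
lemma hasSum_quadForm (τ : UpperHalfPlane) {s : ℂ} (hs : 1 < s.re) :
    HasSum (fun n : ℤ × ℤ => Complex.Gamma s / (quadForm τ n : ℂ) ^ s)
      (2 * (τ.im : ℂ) ^ s * completedRiemannZeta (2 * s) +
        (2 * (τ.im : ℂ) ^ (1 - s) * completedRiemannZeta (2 * s - 1) +
        √τ.im * mellin (besselKernel τ.re τ.im) (s - 1 / 2))) := by
  have hB := hasSum_mellin (a := fun n : ℤ × ℤ => if n.1 = 0 then 0 else 1) (p := quadForm τ)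
    (F := thetaPart τ) (s := s) (fun n => by
      by_cases h : n.1 = 0
      · left; simp [h]
      · right; exact quadForm_pos τ h) (by linarith)
    (fun t ht => hasSum_thetaPart τ ht) (by
      refine (summable_quadForm_rpow τ hs).of_nonneg_of_le (fun n => ?_) fun n => ?_
      · have := quadForm_nonneg τ n
        positivity
      · have := quadForm_nonneg τ n
        gcongr
        split_ifs <;> simp)
  rw [mellin_thetaPart τ hs] at hB
  have hinj : Function.Injective fun n : ℤ => ((0 : ℤ), n) := fun a b h => (Prod.mk.inj h).2
  have hA : HasSum (fun n : ℤ × ℤ => if n.1 = 0 then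
      Complex.Gamma s / (quadForm τ n : ℂ) ^ s else 0)
      (2 * (τ.im : ℂ) ^ s * completedRiemannZeta (2 * s)) := by
    rw [← hinj.hasSum_iff]
    · exact (hasSum_quadForm_axis τ hs).congr_fun fun n => by simp
    · rintro ⟨m, n⟩ hmn
      rw [if_neg]
      rintro rfl
      exact hmn ⟨n, rfl⟩
  refine (hA.add hB).congr_fun fun n => ?_
  split_ifs <;> simp

end SeibergWitten

end

noncomputable section

namespace SeibergWitten

open Filter Set

/-! ### Analytic continuation of the Epstein zeta function, and the Kronecker limit formula -/

/-- The entire part of the completed Epstein zeta function. -/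
def epsteinEntire (τ : UpperHalfPlane) (s : ℂ) : ℂ :=
  2 * (τ.im : ℂ) ^ s * completedRiemannZeta₀ (2 * s) +
    2 * (τ.im : ℂ) ^ (1 - s) * completedRiemannZeta₀ (2 * s - 1) +
    √τ.im * mellin (besselKernel τ.re τ.im) (s - 1 / 2) -
    -- The poles of the two completed zeta functions at `s = 1/2` combine into this difference
    -- quotient, whose singularity is removable. The poles at 0 and 1 are treated in `epsteinZeta`.
    dslope (fun s : ℂ => (τ.im : ℂ) ^ (1 - s) - (τ.im : ℂ) ^ s) (1 / 2) s

/-- The continuation of the Epstein zeta function `∑ (π |m τ + n|² / Im τ)^{-s}`. -/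
def epsteinZeta (τ : UpperHalfPlane) (s : ℂ) : ℂ :=
  (Complex.Gamma s)⁻¹ * (epsteinEntire τ s - (τ.im : ℂ) ^ (1 - s) / (1 - s)) -
    (Complex.Gamma (s + 1))⁻¹ * (τ.im : ℂ) ^ s

lemma im_ne_zero' (τ : UpperHalfPlane) : (τ.im : ℂ) ≠ 0 := by exact_mod_cast τ.im_pos.ne'

lemma differentiable_im_cpow (τ : UpperHalfPlane) : Differentiable ℂ fun s : ℂ => (τ.im : ℂ) ^ s :=
  differentiable_id.const_cpow (Or.inl (im_ne_zero' τ))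

lemma differentiable_im_cpow_one_sub (τ : UpperHalfPlane) :
    Differentiable ℂ fun s : ℂ => (τ.im : ℂ) ^ (1 - s) :=
  ((differentiable_const (1 : ℂ)).sub differentiable_id).const_cpow (Or.inl (im_ne_zero' τ))

lemma differentiable_epsteinEntire (τ : UpperHalfPlane) : Differentiable ℂ (epsteinEntire τ) := by
  have h1 := differentiable_im_cpow τ
  have h2 := differentiable_im_cpow_one_sub τ
  have h3 : Differentiable ℂ
      (dslope (fun s : ℂ => (τ.im : ℂ) ^ (1 - s) - (τ.im : ℂ) ^ s) (1 / 2)) := by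
    rw [← differentiableOn_univ, Complex.differentiableOn_dslope univ_mem]
    exact (h2.sub h1).differentiableOn
  have h4 : Differentiable ℂ fun s : ℂ => completedRiemannZeta₀ (2 * s) :=
    differentiable_completedZeta₀.comp (differentiable_id.const_mul 2)
  have h5 : Differentiable ℂ fun s : ℂ => completedRiemannZeta₀ (2 * s - 1) :=
    differentiable_completedZeta₀.comp ((differentiable_id.const_mul 2).sub_const 1)
  have h6 : Differentiable ℂ fun s : ℂ => mellin (besselKernel τ.re τ.im) (s - 1 / 2) :=
    (differentiable_mellin_besselKernel τ.re τ.im_pos).comp (differentiable_id.sub_const _)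
  exact (((((h1.const_mul 2).mul h4).add ((h2.const_mul 2).mul h5)).add (h6.const_mul _))).sub h3

lemma differentiableOn_epsteinZeta (τ : UpperHalfPlane) :
    DifferentiableOn ℂ (epsteinZeta τ) {1}ᶜ := by
  have h1 := differentiable_im_cpow τ
  have h2 := differentiable_im_cpow_one_sub τ
  have h3 := differentiable_epsteinEntire τ
  have h4 := Complex.differentiable_one_div_Gamma
  have h5 : Differentiable ℂ fun s : ℂ => (Complex.Gamma (s + 1))⁻¹ :=
    h4.comp (differentiable_id.add_const 1)
  have h6 : DifferentiableOn ℂ (fun s : ℂ => (τ.im : ℂ) ^ (1 - s) / (1 - s)) {1}ᶜ :=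
    h2.differentiableOn.div ((differentiable_const (1 : ℂ)).sub differentiable_id).differentiableOn
      fun s hs => sub_ne_zero.mpr (Ne.symm hs)
  exact (h4.differentiableOn.mul (h3.differentiableOn.sub h6)).sub (h5.mul h1).differentiableOn

lemma hasSum_epsteinZeta (τ : UpperHalfPlane) {s : ℂ} (hs : 1 < s.re) :
    HasSum (fun n : ℤ × ℤ => (quadForm τ n : ℂ) ^ (-s)) (epsteinZeta τ s) := by
  have hG : Complex.Gamma s ≠ 0 := Complex.Gamma_ne_zero_of_re_pos (by linarith)
  have hs0 : s ≠ 0 := by rintro rfl; simp at hs; linarith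
  have hs1 : 1 - s ≠ 0 := by
    intro h; rw [sub_eq_zero] at h; rw [← h] at hs; simp at hs
  have hs2 : s - 1 / 2 ≠ 0 := by
    intro h; rw [sub_eq_zero] at h; rw [h] at hs; norm_num at hs
  have h := (hasSum_quadForm τ hs).mul_left (Complex.Gamma s)⁻¹
  have hd : dslope (fun s : ℂ => (τ.im : ℂ) ^ (1 - s) - (τ.im : ℂ) ^ s) (1 / 2) s =
      ((τ.im : ℂ) ^ (1 - s) - (τ.im : ℂ) ^ s) / (s - 1 / 2) := by
    rw [dslope_of_ne _ (sub_ne_zero.mp hs2), slope_def_field]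
    norm_num
  have h' : HasSum (fun n : ℤ × ℤ => (quadForm τ n : ℂ) ^ (-s)) _ := h.congr_fun fun n => by
    rw [Complex.cpow_neg]
    field_simp
  convert h' using 1
  rw [epsteinZeta, epsteinEntire, hd, completedRiemannZeta_eq, completedRiemannZeta_eq,
    Complex.Gamma_add_one s hs0]
  have e1 : 1 - (2 * s - 1) = 2 * (1 - s) := by ring
  have e2 : 1 - 2 * s = -2 * (s - 1 / 2) := by ring
  have e3 : 2 * s - 1 = 2 * (s - 1 / 2) := by ring
  rw [e1, e2]
  generalize completedRiemannZeta₀ (2 * s - 1) = A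
  generalize mellin (besselKernel τ.re τ.im) (s - 1 / 2) = M
  rw [e3]
  generalize (τ.im : ℂ) ^ (1 - s) = P
  generalize hx : s - 1 / 2 = x at *
  generalize hy : 1 - s = y at *
  field_simp
  ring

/-- Writing `1/Γ(s) = s/Γ(s + 1)` makes the value and the derivative at `s = 0` visible. -/
lemma epsteinZeta_eq (τ : UpperHalfPlane) (s : ℂ) : epsteinZeta τ s =
    (Complex.Gamma (s + 1))⁻¹ * (s * (epsteinEntire τ s - (τ.im : ℂ) ^ (1 - s) / (1 - s)) -
      (τ.im : ℂ) ^ s) := by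
  have h := Complex.one_div_Gamma_eq_self_mul_one_div_Gamma_add_one s
  rw [epsteinZeta, h]
  ring

lemma epsteinZeta_zero (τ : UpperHalfPlane) : epsteinZeta τ 0 = -1 := by
  simp [epsteinZeta_eq]

/-- The derivative of `1 / Γ` at `1`. -/
def invGammaDeriv : ℂ := deriv (fun s => (Complex.Gamma s)⁻¹) 1

lemma hasDerivAt_epsteinZeta_zero (τ : UpperHalfPlane) :
    HasDerivAt (epsteinZeta τ)
      (-invGammaDeriv + (epsteinEntire τ 0 - τ.im - Complex.log τ.im)) 0 := by
  have hΓ : HasDerivAt (fun s : ℂ => (Complex.Gamma (s + 1))⁻¹) invGammaDeriv 0 := by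
    have h := (Complex.differentiable_one_div_Gamma (0 + 1)).hasDerivAt
    rw [show deriv (fun s => (Complex.Gamma s)⁻¹) (0 + 1) = invGammaDeriv by
      rw [zero_add, invGammaDeriv]] at h
    exact h.comp_add_const 0 1
  have hy : HasDerivAt (fun s : ℂ => (τ.im : ℂ) ^ s) (Complex.log τ.im) 0 := by
    have := (hasDerivAt_id (0 : ℂ)).const_cpow (c := (τ.im : ℂ)) (Or.inl (im_ne_zero' τ))
    simpa using this
  have hB : DifferentiableAt ℂ
      (fun s : ℂ => epsteinEntire τ s - (τ.im : ℂ) ^ (1 - s) / (1 - s)) 0 :=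
    (differentiable_epsteinEntire τ 0).sub (((differentiable_im_cpow_one_sub τ) 0).div
      (((differentiable_const (1 : ℂ)).sub differentiable_id) 0) (by simp))
  have h := hΓ.mul (((hasDerivAt_id (0 : ℂ)).mul hB.hasDerivAt).sub hy)
  have h' : HasDerivAt (epsteinZeta τ) _ 0 := h.congr_of_eventuallyEq
    (Eventually.of_forall fun s => epsteinZeta_eq τ s)
  convert h' using 1
  simp

/-- By the functional equation the completed zeta function at `-1` equals its value `π/6` at 2; its
polar terms at `-1` add up to `1/2`. The result `π/3` becomes the factor `|q|^{1/6}` of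
`|Δ(τ)|^{1/6}`. -/
lemma two_mul_completedRiemannZeta₀_neg_one :
    2 * completedRiemannZeta₀ (-1) + 1 = Real.pi / 3 := by
  have h1 := completedRiemannZeta_eq (-1)
  have h2 := completedRiemannZeta_one_sub (-1)
  have h3 := riemannZeta_def_of_ne_zero (s := 2) two_ne_zero
  have hpi : (Real.pi : ℂ) ≠ 0 := by exact_mod_cast Real.pi_ne_zero
  have h4 : Complex.Gammaℝ 2 = (Real.pi : ℂ)⁻¹ := by
    rw [Complex.Gammaℝ_def]
    simp [Complex.cpow_neg_one]
  rw [riemannZeta_two, h4] at h3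
  norm_num at h1 h2
  rw [h2, h1] at h3
  field_simp at h3
  linear_combination -h3 / 6

lemma epsteinEntire_zero (τ : UpperHalfPlane) : epsteinEntire τ 0 - τ.im =
    2 * completedRiemannZeta₀ 0 - 2 + Real.pi / 3 * τ.im +
      √τ.im * mellin (besselKernel τ.re τ.im) (-1 / 2) := by
  have hd : dslope (fun s : ℂ => (τ.im : ℂ) ^ (1 - s) - (τ.im : ℂ) ^ s) (1 / 2) 0 =
      -2 * (τ.im - 1) := by
    rw [dslope_of_ne _ (by norm_num), slope_def_field]
    norm_num
    ring
  rw [epsteinEntire, hd, ← two_mul_completedRiemannZeta₀_neg_one]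
  simp only [mul_zero, Complex.cpow_zero, sub_zero, Complex.cpow_one, zero_sub]
  rw [show -((1 : ℂ) / 2) = -1 / 2 by ring]
  ring

end SeibergWitten

end

noncomputable section

namespace SeibergWitten

open Filter Set

/-! ### The zeta-regularised determinant -/

lemma rpow_norm_discriminant (τ : UpperHalfPlane) :
    ‖ModularForm.discriminant τ‖ ^ (1 / 6 : ℝ) =
      Real.exp (-(Real.pi / 3 * τ.im)) * ‖∏' n : ℕ, (1 - ModularForm.eta_q n τ)‖ ^ 4 := by
  have h : ‖ModularForm.discriminant τ‖ =
      (Real.exp (-(Real.pi / 3 * τ.im)) * ‖∏' n : ℕ, (1 - ModularForm.eta_q n τ)‖ ^ 4) ^ 6 := by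
    rw [ModularForm.discriminant, ModularForm.eta, norm_pow, norm_mul,
      Function.Periodic.norm_qParam, mul_pow, mul_pow, ← pow_mul, ← Real.exp_nat_mul,
      ← Real.exp_nat_mul]
    congr 2
    push_cast
    rw [UpperHalfPlane.coe_im]
    ring
  rw [h, one_div]
  exact Real.pow_rpow_inv_natCast (n := 6) (by positivity) (by norm_num)

/-- As `vol L = |w|² Im τ`, every eigenvalue is `4π / vol L` times a value of `quadForm`. The zero
vector may be included because `0 ^ (-s) = 0`. -/
lemma IsNormalForm.hasSum_laplaceZeta {L : PeriodPair} {w : ℂ} {τ : UpperHalfPlane}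
    (h : IsNormalForm L w τ) {s : ℂ} (hs : 1 < s.re) :
    ((4 * Real.pi / vol L : ℝ) : ℂ) ^ (-s) * epsteinZeta τ s = laplaceZeta L s := by
  obtain ⟨e, he0, he⟩ := h.exists_equiv
  have hV := vol_pos L
  have hy := τ.im_pos
  have hw := norm_pos_iff.mpr h.ne_zero
  have h1 := ((e.hasSum_iff.mpr (hasSum_epsteinZeta τ hs)).mul_left
    (((4 * Real.pi / vol L : ℝ) : ℂ) ^ (-s)))
  have hs0 : -s ≠ 0 := by
    intro h0; rw [neg_eq_zero] at h0; rw [h0] at hs; simp at hs; linarith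
  have h2 : HasSum (fun n : ℤ × ℤ =>
      (((2 * Real.pi * ‖(n.1 : ℂ) * L.ω₁ + (n.2 : ℂ) * L.ω₂‖ / vol L) ^ 2 : ℝ) : ℂ) ^ (-s))
      (((4 * Real.pi / vol L : ℝ) : ℂ) ^ (-s) * epsteinZeta τ s) := by
    refine h1.congr_fun fun n => ?_
    rw [Function.comp_apply, ← Complex.mul_cpow_ofReal_nonneg (by positivity)
      (quadForm_nonneg τ _), ← Complex.ofReal_mul, he n, norm_mul, quadForm]
    congr 2
    have hv := h.vol_eq
    have : vol L ^ 2 = vol L * (‖w‖ ^ 2 * τ.im) := by rw [sq]; nth_rewrite 2 [hv]; rfl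
    rw [div_pow, this]
    field_simp
    ring
  have h3 : Function.support (fun n : ℤ × ℤ =>
      (((2 * Real.pi * ‖(n.1 : ℂ) * L.ω₁ + (n.2 : ℂ) * L.ω₂‖ / vol L) ^ 2 : ℝ) : ℂ) ^ (-s)) ⊆
      {n | n ≠ 0} := by
    intro n hn h0
    rw [h0] at hn
    simp [hs0] at hn
  exact ((hasSum_subtype_iff_of_support_subset h3).mpr h2).tsum_eq.symm

lemma IsNormalForm.isZetaContinuation {L : PeriodPair} {w : ℂ} {τ : UpperHalfPlane}
    (h : IsNormalForm L w τ) :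
    IsZetaContinuation L fun s => ((4 * Real.pi / vol L : ℝ) : ℂ) ^ (-s) * epsteinZeta τ s := by
  have hV := vol_pos L
  have h0 : ((4 * Real.pi / vol L : ℝ) : ℂ) ≠ 0 := by
    have : (4 * Real.pi / vol L : ℝ) ≠ 0 := by positivity
    exact_mod_cast this
  refine ⟨DifferentiableOn.analyticOnNhd ?_ isOpen_compl_singleton,
    fun s hs => h.hasSum_laplaceZeta hs⟩
  exact (differentiable_neg.const_cpow (Or.inl h0)).differentiableOn.mul
    (differentiableOn_epsteinZeta τ)

/-- The identity theorem on the connected set `ℂ ∖ {1}`; it makes the choice in `regDet` immaterial.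
-/
lemma IsZetaContinuation.eqOn {L : PeriodPair} {Z Z' : ℂ → ℂ} (h : IsZetaContinuation L Z)
    (h' : IsZetaContinuation L Z') : EqOn Z Z' {1}ᶜ := by
  refine h.1.eqOn_of_preconnected_of_eventuallyEq h'.1
    (isConnected_compl_singleton_of_one_lt_rank (by simp) 1).isPreconnected
    (z₀ := 2) (by norm_num) ?_
  have : {s : ℂ | 1 < s.re} ∈ 𝓝 (2 : ℂ) :=
    (isOpen_lt continuous_const Complex.continuous_re).mem_nhds (by simp)
  filter_upwards [this] with s hs
  rw [h.2 s hs, h'.2 s hs]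

lemma regDet_eq {L : PeriodPair} {Z : ℂ → ℂ} (h : IsZetaContinuation L Z) :
    regDet L = Real.exp (-(deriv Z 0).re) := by
  have hex : ∃ Z, IsZetaContinuation L Z := ⟨Z, h⟩
  rw [regDet, dif_pos hex]
  have h1 : hex.choose =ᶠ[𝓝 0] Z :=
    (hex.choose_spec.eqOn h).eventuallyEq_of_mem
      (isOpen_compl_singleton.mem_nhds (by simp))
  rw [h1.deriv_eq]

/-- The universal constant in the Kronecker limit formula. -/
def kroneckerConst : ℝ :=
  Real.exp (invGammaDeriv.re - (2 * completedRiemannZeta₀ 0 - 2).re) / (4 * Real.pi) *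
    (2 * Real.pi)⁻¹ ^ 2

lemma kroneckerConst_pos : 0 < kroneckerConst := by
  rw [kroneckerConst]; positivity

lemma IsNormalForm.regDet_eq {L : PeriodPair} {w : ℂ} {τ : UpperHalfPlane}
    (h : IsNormalForm L w τ) : regDet L =
      Real.exp (invGammaDeriv.re - (2 * completedRiemannZeta₀ 0 - 2).re) / (4 * Real.pi) *
        (vol L * τ.im * ‖ModularForm.discriminant τ‖ ^ (1 / 6 : ℝ)) := by
  have hV := vol_pos L
  have hy := τ.im_pos
  have hc : (0 : ℝ) < 4 * Real.pi / vol L := by positivity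
  have h0 : ((4 * Real.pi / vol L : ℝ) : ℂ) ≠ 0 := by exact_mod_cast hc.ne'
  have h1 : HasDerivAt (fun s : ℂ => ((4 * Real.pi / vol L : ℝ) : ℂ) ^ (-s))
      (-Complex.log ((4 * Real.pi / vol L : ℝ) : ℂ)) 0 := by
    have := (hasDerivAt_neg (0 : ℂ)).const_cpow (c := ((4 * Real.pi / vol L : ℝ) : ℂ)) (Or.inl h0)
    simpa using this
  have h2 := (h1.mul (hasDerivAt_epsteinZeta_zero τ)).deriv
  rw [epsteinZeta_zero, neg_zero, Complex.cpow_zero, epsteinEntire_zero] at h2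
  have h3 : regDet L = _ := SeibergWitten.regDet_eq h.isZetaContinuation
  have h2' := congrArg Complex.re h2
  have e1 : ((4 * Real.pi / vol L : ℝ) : ℂ).log.re = Real.log (4 * Real.pi / vol L) := by
    rw [← Complex.ofReal_log hc.le, Complex.ofReal_re]
  have e2 : ((τ.im : ℝ) : ℂ).log.re = Real.log τ.im := by
    rw [← Complex.ofReal_log hy.le, Complex.ofReal_re]
  have e3 : ((Real.pi : ℂ) / 3 * τ.im).re = Real.pi / 3 * τ.im := by
    rw [show (Real.pi : ℂ) / 3 * τ.im = ((Real.pi / 3 * τ.im : ℝ) : ℂ) by push_cast; rfl,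
      Complex.ofReal_re]
  have e4 : (-Complex.log ((4 * Real.pi / vol L : ℝ) : ℂ) * -1 +
      1 * (-invGammaDeriv + (2 * completedRiemannZeta₀ 0 - 2 + (Real.pi : ℂ) / 3 * τ.im +
        √τ.im * mellin (besselKernel τ.re τ.im) (-1 / 2) - Complex.log τ.im))).re =
      Real.log (4 * Real.pi / vol L) - invGammaDeriv.re + ((2 * completedRiemannZeta₀ 0 - 2).re +
        Real.pi / 3 * τ.im + (√τ.im * mellin (besselKernel τ.re τ.im) (-1 / 2)).re -
        Real.log τ.im) := by
    rw [← e1, ← e2, ← e3, mul_neg_one, neg_neg, one_mul, Complex.add_re, Complex.add_re,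
      Complex.sub_re, Complex.add_re, Complex.add_re, Complex.neg_re]
    ring
  have h4 : deriv (fun s : ℂ => ((4 * Real.pi / vol L : ℝ) : ℂ) ^ (-s) * epsteinZeta τ s) 0 = _ :=
    h2
  rw [h3, h4, e4, rpow_norm_discriminant, re_mellin_besselKernel]
  have e5 : -(Real.log (4 * Real.pi / vol L) - invGammaDeriv.re +
      ((2 * completedRiemannZeta₀ 0 - 2).re +
        Real.pi / 3 * τ.im + (√τ.im * mellin (besselKernel τ.re τ.im) (-1 / 2)).re -
        Real.log τ.im)) = (invGammaDeriv.re - (2 * completedRiemannZeta₀ 0 - 2).re) +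
      (-Real.log (4 * Real.pi / vol L) + (Real.log τ.im + (-(Real.pi / 3 * τ.im) +
        -(√τ.im * mellin (besselKernel τ.re τ.im) (-1 / 2)).re))) := by ring
  rw [e5, Real.exp_add, Real.exp_add, Real.exp_add, Real.exp_add, Real.exp_neg, Real.exp_log hc,
    Real.exp_log hy]
  field_simp

/-- The Kronecker limit formula: the regularised determinant of the flat Laplacian. -/
theorem regDet_eq_discr (L : PeriodPair) : regDet L =
    kroneckerConst * vol L ^ 2 * ‖L.g₂ ^ 3 - 27 * L.g₃ ^ 2‖ ^ (1 / 6 : ℝ) := by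
  obtain ⟨w, τ, h⟩ := exists_isNormalForm L
  have hw := norm_pos_iff.mpr h.ne_zero
  have hpi := Real.pi_pos
  have h1 : ‖L.g₂ ^ 3 - 27 * L.g₃ ^ 2‖ ^ (1 / 6 : ℝ) =
      (2 * Real.pi / ‖w‖) ^ 2 * ‖ModularForm.discriminant τ‖ ^ (1 / 6 : ℝ) := by
    rw [h.discr_eq, norm_mul, Real.mul_rpow (norm_nonneg _) (norm_nonneg _), norm_pow, norm_div]
    congr 1
    have e : ‖(2 * Real.pi : ℂ)‖ = 2 * Real.pi := by
      rw [show (2 * Real.pi : ℂ) = ((2 * Real.pi : ℝ) : ℂ) by push_cast; rfl, Complex.norm_real,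
        Real.norm_of_nonneg (by positivity)]
    rw [e, show (2 * Real.pi / ‖w‖) ^ 12 = ((2 * Real.pi / ‖w‖) ^ 2) ^ 6 by ring, one_div]
    exact Real.pow_rpow_inv_natCast (n := 6) (by positivity) (by norm_num)
  -- Writing one of the two factors `vol L` as `|w|² Im τ` cancels the `|w|⁻²` in the discriminant
  -- of the lattice.
  rw [h1, h.regDet_eq, kroneckerConst, sq (vol L)]
  nth_rewrite 3 [h.vol_eq]
  field_simp

end SeibergWitten

end

noncomputable section

namespace SeibergWitten

open Filter Set

/-! ### The Quillen norm and the holomorphic structure in terms of `(dz)²` -/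

lemma Curve.IsPeriods.discr_eq {S : Curve} {L : ℂ → PeriodPair} (h : S.IsPeriods L) {u : ℂ}
    (hu : u ∈ S.smoothLocus) : (L u).g₂ ^ 3 - 27 * (L u).g₃ ^ 2 = S.Δ.eval u := by
  rw [(h u hu).1, (h u hu).2]
  simp [Curve.Δ, discr]

/-- The `vol²` of the regularised determinant cancels the `vol⁻²` of the L²-norm, leaving the
modulus of a holomorphic expression. -/
lemma quillenNorm_eq {S : Curve} {L : ℂ → PeriodPair} (h : S.IsPeriods L) {u : ℂ}
    (hu : u ∈ S.smoothLocus) (ξ : DetD (L u)) : quillenNorm ξ =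
      (2 * Real.pi) ^ 4 * kroneckerConst * ‖dzSq (L u) ξ‖ * ‖S.Δ.eval u‖ ^ (1 / 6 : ℝ) := by
  have hV := vol_pos (L u)
  have hk := kroneckerConst_pos
  have hR : 0 ≤ regDet (L u) := by
    rw [regDet_eq_discr]; positivity
  rw [quillenNorm, detL2Norm_eq, mul_pow, Real.sq_sqrt hR, regDet_eq_discr, h.discr_eq hu]
  field_simp

lemma Curve.isOpen_smoothLocus (S : Curve) : IsOpen S.smoothLocus :=
  isOpen_ne_fun S.Δ.continuous continuous_const

lemma analyticAt_polynomial_eval (p : Polynomial ℂ) (u : ℂ) :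
    AnalyticAt ℂ (fun u => p.eval u) u := by
  simpa using AnalyticAt.aeval_polynomial (analyticAt_id (𝕜 := ℂ) (z := u)) p

lemma exists_cubic_ne_zero (a b : ℂ) : ∃ x : ℂ, 4 * x ^ 3 - a * x - b ≠ 0 := by
  by_contra! h
  have h0 := h 0
  have h1 := h 1
  have h2 := h (-1)
  have h3 := h 2
  have : (24 : ℂ) = 0 := by linear_combination h3 - 2 * h1 + h0
  norm_num at this

/-- Along the fibres, a fibrewise constant holomorphic function on the elliptic surface is
a holomorphic function of the base point. -/
lemma IsHolFun.analyticAt {S : Curve} {L : ℂ → PeriodPair} (h : S.IsPeriods L) {V : Set ℂ}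
    {c : ℂ → ℂ} (hc : IsHolFun L V fun u => c u • oneFun (L u)) {u₀ : ℂ} (hV : u₀ ∈ V)
    (hu₀ : u₀ ∈ S.smoothLocus) : AnalyticAt ℂ c u₀ := by
  -- Away from the branch points, `u ↦ (u, x₀, y(u))` with `y² = P` is a local holomorphic section
  -- of the surface, along which the function equals `c u`.
  obtain ⟨x₀, hx₀⟩ := exists_cubic_ne_zero (S.g₂.eval u₀) (S.g₃.eval u₀)
  set P : ℂ → ℂ := fun u => 4 * x₀ ^ 3 - S.g₂.eval u * x₀ - S.g₃.eval u with hP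
  have hPa : AnalyticAt ℂ P u₀ :=
    (analyticAt_const.sub ((analyticAt_polynomial_eval _ _).mul analyticAt_const)).sub
      (analyticAt_polynomial_eval _ _)
  set y₀ : ℂ := P u₀ ^ (1 / 2 : ℂ) with hy₀
  have hy₀2 : y₀ ^ 2 = P u₀ := by
    rw [hy₀, one_div]
    exact Complex.cpow_nat_inv_pow _ two_ne_zero
  -- Dividing by `P u₀` places the argument of the square root at 1, away from the branch cut.
  set y : ℂ → ℂ := fun u => y₀ * (P u / P u₀) ^ (1 / 2 : ℂ) with hy
  have hy2 (u : ℂ) : y u ^ 2 = P u := by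
    have := Complex.cpow_nat_inv_pow (P u / P u₀) two_ne_zero
    simp only [hy, mul_pow, hy₀2, one_div]
    push_cast at this
    rw [this, mul_div_cancel₀ _ hx₀]
  have hya : AnalyticAt ℂ y u₀ := by
    refine analyticAt_const.mul ((hPa.div analyticAt_const hx₀).cpow analyticAt_const ?_)
    have h1 : P u₀ / P u₀ = 1 := div_self hx₀
    refine (Set.mem_of_eq_of_mem h1 ?_ : P u₀ / P u₀ ∈ Complex.slitPlane)
    exact Complex.one_mem_slitPlane
  have hsurj {u : ℂ} (hu : u ∈ S.smoothLocus) : ∃ z ∉ (L u).lattice,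
      (L u).weierstrassP z = x₀ ∧ (L u).derivWeierstrassP z = y u := by
    refine exists_weierstrassP_derivWeierstrassP_eq (L u) x₀ (y u) ?_
    rw [hy2, (h u hu).1, (h u hu).2]
  obtain ⟨z₀, hz₀, hz₀x, hz₀y⟩ := hsurj hu₀
  obtain ⟨F, hF, hFev⟩ := hc u₀ hV z₀ hz₀
  rw [hz₀x, hz₀y] at hF hFev
  have hm : AnalyticAt ℂ (fun u : ℂ => (u, x₀, y u)) u₀ :=
    analyticAt_id.prod (analyticAt_const.prod hya)
  have hcomp : AnalyticAt ℂ (fun u => F (u, x₀, y u)) u₀ :=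
    AnalyticAt.fun_comp (f := fun u : ℂ => (u, x₀, y u)) hF hm
  refine hcomp.congr ?_
  filter_upwards [hm.continuousAt.tendsto.eventually hFev,
    S.isOpen_smoothLocus.mem_nhds hu₀] with u hu hu'
  obtain ⟨z, hz, hzx, hzy⟩ := hsurj hu'
  rw [← hu z hz hzx hzy]
  simp [oneFun]

/-- A holomorphic section of `DET D` has a holomorphic pairing with `(dz)²`. -/
lemma IsHolDet.analyticAt {S : Curve} {L : ℂ → PeriodPair} (h : S.IsPeriods L) {V : Set ℂ}
    {ξ : ∀ u, DetD (L u)} (hξ : IsHolDet L V ξ) {u₀ : ℂ} (hV : u₀ ∈ V)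
    (hu₀ : u₀ ∈ S.smoothLocus) : AnalyticAt ℂ (fun u => dzSq (L u) (ξ u)) u₀ := by
  obtain ⟨W, f, α, hW, ⟨-, hne, hf, hα⟩, ha⟩ := hξ u₀ hV
  choose a hfa using fun u => exists_eq_smul_unit00 (f u)
  choose b hαb using fun u => exists_eq_smul_dz10 (α u)
  obtain rfl : f = fun u => a u • unit00 (L u) := funext hfa
  obtain rfl : α = fun u => b u • dz10 (L u) := funext hαb
  have haa : AnalyticAt ℂ a u₀ := IsHolFun.analyticAt h (c := a) hf hW hu₀
  have hba : AnalyticAt ℂ b u₀ := IsHolFun.analyticAt h (c := b) hα hW hu₀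
  have ha0 : a u₀ ≠ 0 := fun h0 => (hne u₀ hW).1 (by simp [h0])
  have hb0 : b u₀ ≠ 0 := fun h0 => (hne u₀ hW).2 (by simp [h0])
  -- The given frame pairs as `a² b² (dz)²`, and this analytic factor is not zero at `u₀`.
  have hd := (haa.pow 2).mul (hba.pow 2)
  refine (ha.div hd (mul_ne_zero (pow_ne_zero 2 ha0) (pow_ne_zero 2 hb0))).congr ?_
  filter_upwards [haa.continuousAt.eventually_ne ha0, hba.continuousAt.eventually_ne hb0]
    with u hau hbu
  simp only [serreForm_smul, LinearMap.smul_apply, smul_eq_mul, Pi.mul_apply, Pi.pow_apply,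
    Pi.div_apply]
  field_simp

/-- The frame of `DET D` dual to `(dz)²` is holomorphic. -/
lemma isHodgeFrame_unit00_dz10 (L : ℂ → PeriodPair) :
    IsHodgeFrame L univ (fun u => unit00 (L u)) (fun u => dz10 (L u)) :=
  ⟨isOpen_univ, fun _ _ => ⟨unit00_ne_zero _, dz10_ne_zero _⟩,
    fun _ _ _ _ => ⟨fun _ => 1, analyticAt_const, Eventually.of_forall fun _ _ _ _ _ => rfl⟩,
    fun _ _ _ _ => ⟨fun _ => 1, analyticAt_const, Eventually.of_forall fun _ _ _ _ _ => rfl⟩⟩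

lemma isHolDet_detGen (L : ℂ → PeriodPair) (V : Set ℂ) :
    IsHolDet L V fun u => detGen (L u) := fun u₀ _ =>
  ⟨univ, _, _, mem_univ _, isHodgeFrame_unit00_dz10 L, by
    have : (fun u => serreForm (unit00 (L u)) (dz10 (L u)) (detGen (L u))) = fun _ => 1 :=
      funext fun u => dzSq_detGen (L u)
    rw [this]
    exact analyticAt_const⟩

lemma detGen_ne_zero (L : PeriodPair) : detGen L ≠ 0 := fun h => by
  simpa [h] using dzSq_detGen L

/-! ### The Bismut-Freed connection form -/

/-- The real differential of `log |g|` for a holomorphic function `g`. -/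
lemma hasFDerivAt_log_norm {g : ℂ → ℂ} {u D : ℂ} (hg : HasDerivAt g D u) (hu : g u ≠ 0) :
    HasFDerivAt (fun w => Real.log ‖g w‖)
      (Complex.reCLM.comp (ContinuousLinearMap.restrictScalars ℝ
        (ContinuousLinearMap.toSpanSingleton ℂ (D / g u)))) u := by
  -- Normalising by `g u` brings the argument to 1, so the principal logarithm is available for
  -- every nonzero `g u`.
  have h1 : HasDerivAt (fun w => Complex.log (g w / g u)) (D / g u) u := by
    have := (hg.div_const (g u)).clog (by rw [div_self hu]; exact Complex.one_mem_slitPlane)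
    simpa [div_self hu] using this
  have h2 := (Complex.reCLM.hasFDerivAt.comp u (h1.hasFDerivAt.restrictScalars ℝ)).add_const
    (Real.log ‖g u‖)
  refine h2.congr_of_eventuallyEq ?_
  filter_upwards [hg.continuousAt.eventually_ne hu] with w hw
  simp only [Function.comp_apply, Complex.reCLM_apply, Complex.log_re, norm_div]
  rw [Real.log_div (norm_ne_zero_iff.mpr hw) (norm_ne_zero_iff.mpr hu)]
  ring

lemma del_eq_of_hasFDerivAt {f : ℂ → ℝ} {u a b : ℂ} {r s c : ℝ} {g k : ℂ → ℂ}
    (hg : HasDerivAt g a u) (hgu : g u ≠ 0) (hk : HasDerivAt k b u) (hku : k u ≠ 0)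
    (hf : f =ᶠ[𝓝 u] fun w => c + r * Real.log ‖g w‖ + s * Real.log ‖k w‖) :
    del (fun w => (f w : ℂ)) u = (r * (a / g u) + s * (b / k u)) / 2 := by
  have h1 := (((hasFDerivAt_log_norm hg hgu).const_mul r).const_add c).add
    ((hasFDerivAt_log_norm hk hku).const_mul s)
  have h2 := Complex.ofRealCLM.hasFDerivAt.comp u (h1.congr_of_eventuallyEq hf)
  have h3 : HasFDerivAt (fun w => (f w : ℂ)) _ u := h2
  rw [del, h3.fderiv]
  apply Complex.ext
  · simp
  · simp
    ring

/-- Here `log ‖e‖² = const + 2 log |(dz)²(e)| + (1/3) log |Δ|`, and `∂ log |g| = g'/(2g)` for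
holomorphic `g`. -/
lemma connForm_eq {S : Curve} {L : ℂ → PeriodPair} (h : S.IsPeriods L) {V : Set ℂ}
    {e : ∀ u, DetD (L u)} (he : IsHolDet L V e) {u : ℂ} (hV : u ∈ V) (hu : u ∈ S.smoothLocus)
    (hne : e u ≠ 0) : connForm L e u =
      deriv (fun u => dzSq (L u) (e u)) u / dzSq (L u) (e u) +
        S.Δ.derivative.eval u / (6 * S.Δ.eval u) := by
  have ha := (he.analyticAt h hV hu)
  have hne' : dzSq (L u) (e u) ≠ 0 := fun h0 => hne (dzSq_eq_zero_iff.mp h0)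
  have hk := kroneckerConst_pos
  have hu' : S.Δ.eval u ≠ 0 := hu
  rw [connForm, del_eq_of_hasFDerivAt (c := 2 * Real.log ((2 * Real.pi) ^ 4 * kroneckerConst))
    (r := 2) (s := 1 / 3) ha.differentiableAt.hasDerivAt hne' (S.Δ.hasDerivAt u) hu']
  · push_cast
    field_simp
    ring
  · filter_upwards [ha.continuousAt.eventually_ne hne', S.isOpen_smoothLocus.mem_nhds hu]
      with w hw hw'
    have hw'' : S.Δ.eval w ≠ 0 := hw'
    have h1 : ‖dzSq (L w) (e w)‖ ≠ 0 := norm_ne_zero_iff.mpr hw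
    have h2 : 0 < ‖S.Δ.eval w‖ := norm_pos_iff.mpr hw''
    rw [quillenNorm_eq h hw', Real.log_pow, Real.log_mul (by positivity) (by positivity),
      Real.log_mul (by positivity) h1, Real.log_rpow h2]
    push_cast
    ring

/-! ### Parallel transport -/

/-- The derivative of `(dz)²(e)` cancels the first term of the connection form, so the resulting
equation no longer involves the local frame. -/
lemma IsParallel.hasDerivAt {S : Curve} {L : ℂ → PeriodPair} (h : S.IsPeriods L) {γ : ℝ → ℂ}
    {ξ : ∀ t, DetD (L (γ t))} (hξ : IsParallel L γ ξ) {t : ℝ} (hγ : DifferentiableAt ℝ γ t)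
    (ht : γ t ∈ S.smoothLocus) :
    HasDerivAt (fun s => dzSq (L (γ s)) (ξ s))
      (-(S.Δ.derivative.eval (γ t) / (6 * S.Δ.eval (γ t)) * deriv γ t) *
        dzSq (L (γ t)) (ξ t)) t := by
  obtain ⟨W, e, c, hW, htW, he, hne, hev, hc⟩ := hξ t
  have ha := he.analyticAt h htW ht
  have hne' : dzSq (L (γ t)) (e (γ t)) ≠ 0 := fun h0 => hne _ htW (dzSq_eq_zero_iff.mp h0)
  rw [connForm_eq h he htW ht (hne _ htW)] at hc
  have h1 := hc.mul (ha.differentiableAt.hasDerivAt.comp t hγ.hasDerivAt)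
  have h2 : HasDerivAt (fun s => dzSq (L (γ s)) (ξ s)) _ t := h1.congr_of_eventuallyEq (by
    filter_upwards [hev] with s hs
    rw [hs, map_smul, smul_eq_mul]
    rfl)
  convert h2 using 1
  rw [hev.self_of_nhds, map_smul, smul_eq_mul, Function.comp_apply]
  field_simp
  ring

lemma isParallel_smul_detGen {S : Curve} {L : ℂ → PeriodPair} (h : S.IsPeriods L) {γ : ℝ → ℂ}
    (hγ : ∀ t, γ t ∈ S.smoothLocus) {X : ℝ → ℂ}
    (hX : ∀ t, HasDerivAt X
      (-(S.Δ.derivative.eval (γ t) / (6 * S.Δ.eval (γ t)) * deriv γ t) * X t) t) :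
    IsParallel L γ fun t => X t • detGen (L (γ t)) := fun t =>
  ⟨univ, fun u => detGen (L u), X, isOpen_univ, mem_univ _, isHolDet_detGen L univ,
    fun _ _ => detGen_ne_zero _, Eventually.of_forall fun _ => rfl, by
      rw [connForm_eq h (isHolDet_detGen L univ) (mem_univ _) (hγ t) (detGen_ne_zero _)]
      simpa using hX t⟩

lemma canonicalSection_eq (S : Curve) (L : ℂ → PeriodPair) (u : ℂ) :
    canonicalSection S L u = S.Δ.eval u • sixth (dzSq (L u)) := by
  rw [canonicalSection, sixth_smul, one_div]
  congr 1
  exact Complex.cpow_nat_inv_pow _ (by norm_num)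

/-- In the coordinate `X` of a parallel section the pairing is `Δ X⁶`, and its derivative vanishes:
six times `-Δ'/(6Δ)` offsets `Δ'/Δ`. -/
lemma isParallelDualPow_canonicalSection {S : Curve} {L : ℂ → PeriodPair} (h : S.IsPeriods L) :
    IsParallelDualPow L S.smoothLocus (canonicalSection S L) := by
  intro γ hγ hγU ξ hξ s
  have hγd : Differentiable ℝ γ := hγ.differentiable (by norm_num)
  set X : ℝ → ℂ := fun s => dzSq (L (γ s)) (ξ s) with hX
  have heq (s : ℝ) : evalSixth (ξ s) (canonicalSection S L (γ s)) =
      S.Δ.eval (γ s) * X s ^ 6 := by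
    rw [canonicalSection_eq, map_smul, evalSixth_sixth, smul_eq_mul]
  have hd (s : ℝ) : HasDerivAt (fun s => S.Δ.eval (γ s) * X s ^ 6) 0 s := by
    have hne : S.Δ.eval (γ s) ≠ 0 := hγU s
    have h1 := ((S.Δ.hasDerivAt (γ s)).comp s (hγd s).hasDerivAt).mul
      ((hξ.hasDerivAt h (hγd s) (hγU s)).pow 6)
    refine HasDerivAt.congr_deriv (f := fun s => S.Δ.eval (γ s) * X s ^ 6) h1 ?_
    simp only [Pi.pow_apply, Function.comp_apply]
    field_simp
    push_cast
    ring
  rw [heq, heq]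
  exact is_const_of_deriv_eq_zero (fun s => (hd s).differentiableAt) (fun s => (hd s).deriv) s 0

/-- The fibres at the two ends of a loop are different types until the endpoints are identified; the
coordinate `(dz)²` compares their vectors. -/
lemma sigma_detD_ext {L : ℂ → PeriodPair} {u v : ℂ} (huv : u = v) {x : DetD (L u)}
    {y : DetD (L v)} (hxy : dzSq (L u) x = dzSq (L v) y) :
    (⟨u, x⟩ : Σ u, DetD (L u)) = ⟨v, y⟩ := by
  subst huv
  rw [eq_smul_detGen x, eq_smul_detGen y, hxy]

/-! ### Continuous logarithms along closed paths -/

/-- `f` has a differentiable logarithm, which grows by `d` on `[0, 1]`. -/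
def HasLogIncrement (f : ℝ → ℂ) (d : ℂ) : Prop :=
  ∃ l : ℝ → ℂ, Differentiable ℝ l ∧ (∀ t, Complex.exp (l t) = f t) ∧ l 1 - l 0 = d

lemma HasLogIncrement.mul {f g : ℝ → ℂ} {a b : ℂ} (hf : HasLogIncrement f a)
    (hg : HasLogIncrement g b) : HasLogIncrement (fun t => f t * g t) (a + b) := by
  obtain ⟨l, hl, hl', hla⟩ := hf
  obtain ⟨k, hk, hk', hkb⟩ := hg
  exact ⟨fun t => l t + k t, hl.add hk, fun t => by rw [Complex.exp_add, hl', hk'],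
    by rw [← hla, ← hkb]; ring⟩

lemma HasLogIncrement.inv {f : ℝ → ℂ} {a : ℂ} (hf : HasLogIncrement f a) :
    HasLogIncrement (fun t => (f t)⁻¹) (-a) := by
  obtain ⟨l, hl, hl', hla⟩ := hf
  exact ⟨fun t => -l t, hl.neg, fun t => by rw [Complex.exp_neg, hl'], by rw [← hla]; ring⟩

lemma HasLogIncrement.pow {f : ℝ → ℂ} {a : ℂ} (hf : HasLogIncrement f a) (n : ℕ) :
    HasLogIncrement (fun t => f t ^ n) (n * a) := by
  obtain ⟨l, hl, hl', hla⟩ := hf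
  exact ⟨fun t => n * l t, hl.const_mul _, fun t => by rw [Complex.exp_nat_mul, hl'],
    by rw [← hla]; ring⟩

lemma hasLogIncrement_const {c : ℂ} (hc : c ≠ 0) : HasLogIncrement (fun _ => c) 0 :=
  ⟨fun _ => Complex.log c, differentiable_const _, fun _ => Complex.exp_log hc, sub_self _⟩

lemma hasLogIncrement_multiset_prod {γ : ℝ → ℂ} {d : ℂ → ℂ} (s : Multiset ℂ)
    (h : ∀ r ∈ s, HasLogIncrement (fun t => γ t - r) (d r)) :
    HasLogIncrement (fun t => (s.map fun r => γ t - r).prod) (s.map d).sum := by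
  induction s using Multiset.induction_on with
  | empty => simpa using hasLogIncrement_const one_ne_zero
  | cons r s ih =>
    simp only [Multiset.map_cons, Multiset.prod_cons, Multiset.sum_cons]
    exact (h r (Multiset.mem_cons_self r s)).mul
      (ih fun r' hr' => h r' (Multiset.mem_cons_of_mem hr'))

lemma Curve.Δ_ne_zero (S : Curve) : S.Δ ≠ 0 := fun h => by
  have := S.natDegree_discr
  rw [← Curve.Δ, h] at this
  simp at this

lemma Curve.Δ_eval_eq (S : Curve) (u : ℂ) :
    S.Δ.eval u = S.Δ.leadingCoeff * (S.Δ.roots.map fun r => u - r).prod := by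
  have h := (IsAlgClosed.splits S.Δ).eq_prod_roots
  nth_rewrite 1 [h]
  simp [Polynomial.eval_multiset_prod]

lemma Curve.hasLogIncrement_Δ (S : Curve) {γ : ℝ → ℂ} {d : ℂ → ℂ}
    (h : ∀ r, S.Δ.IsRoot r → HasLogIncrement (fun t => γ t - r) (d r)) :
    HasLogIncrement (fun t => S.Δ.eval (γ t)) (S.Δ.roots.map d).sum := by
  have h1 := (hasLogIncrement_const (Polynomial.leadingCoeff_ne_zero.mpr S.Δ_ne_zero)).mul
    (hasLogIncrement_multiset_prod S.Δ.roots fun r hr => h r (Polynomial.isRoot_of_mem_roots hr))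
  simpa only [← S.Δ_eval_eq, zero_add] using h1

end SeibergWitten

end

noncomputable section

namespace SeibergWitten

open Filter Set

/-! ### Holonomy and logarithmic monodromy along closed paths -/

lemma HasLogIncrement.ne_zero {f : ℝ → ℂ} {d : ℂ} (h : HasLogIncrement f d) (t : ℝ) : f t ≠ 0 := by
  obtain ⟨l, -, hl, -⟩ := h
  rw [← hl]
  exact Complex.exp_ne_zero _

/-- The holonomy of the Bismut-Freed connection along a closed path is determined by the variation
of `log Δ`. -/
lemma hasHolonomy_of_hasLogIncrement {S : Curve} {L : ℂ → PeriodPair} (h : S.IsPeriods L)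
    {γ : ℝ → ℂ} (hγ : Differentiable ℝ γ) (hγ' : γ 1 = γ 0) {d : ℂ}
    (hd : HasLogIncrement (fun t => S.Δ.eval (γ t)) d) :
    HasHolonomy L γ (Complex.exp (-(d / 6))) := by
  have hU (t : ℝ) : γ t ∈ S.smoothLocus := hd.ne_zero t
  obtain ⟨l, hl, hl', hld⟩ := hd
  have hlD (t : ℝ) : HasDerivAt l
      (S.Δ.derivative.eval (γ t) * deriv γ t / S.Δ.eval (γ t)) t := by
    have h1 := (hl t).hasDerivAt.cexp
    have h2 : HasDerivAt (fun t => Complex.exp (l t))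
        (S.Δ.derivative.eval (γ t) * deriv γ t) t := by
      simp only [hl']
      exact (S.Δ.hasDerivAt (γ t)).comp t (hγ t).hasDerivAt
    refine (hl t).hasDerivAt.congr_deriv ?_
    rw [← h1.unique h2, hl', mul_div_cancel_left₀ _ (hU t)]
  -- `exp (-l/6)` is a branch of `Δ^{-1/6}` along `γ` and solves the transport equation. Any other
  -- solution has constant quotient with it.
  have hE (t : ℝ) : HasDerivAt (fun t => Complex.exp (-(l t / 6)))
      (-(S.Δ.derivative.eval (γ t) / (6 * S.Δ.eval (γ t)) * deriv γ t) *
        Complex.exp (-(l t / 6))) t := by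
    have hne : S.Δ.eval (γ t) ≠ 0 := hU t
    refine ((hlD t).div_const 6).neg.cexp.congr_deriv ?_
    simp only [Pi.neg_apply]
    field_simp
  refine ⟨⟨_, isParallel_smul_detGen h hU hE, ?_⟩, fun ξ hξ => ?_⟩
  · exact smul_ne_zero (Complex.exp_ne_zero _) (detGen_ne_zero _)
  · refine sigma_detD_ext hγ' ?_
    set X : ℝ → ℂ := fun s => dzSq (L (γ s)) (ξ s) with hX
    have hQ (t : ℝ) : HasDerivAt (fun t => X t / Complex.exp (-(l t / 6))) 0 t := by
      refine ((hξ.hasDerivAt h (hγ t) (hU t)).div (hE t) (Complex.exp_ne_zero _)).congr_deriv ?_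
      ring
    have hc := is_const_of_deriv_eq_zero (fun t => (hQ t).differentiableAt)
      (fun t => (hQ t).deriv) 1 0
    have hne := Complex.exp_ne_zero (-(l 0 / 6))
    have hne' := Complex.exp_ne_zero (-(l 1 / 6))
    have he : Complex.exp (-(d / 6)) = Complex.exp (-(l 1 / 6)) / Complex.exp (-(l 0 / 6)) := by
      rw [← Complex.exp_sub, ← hld]; congr 1; ring
    rw [map_smul, smul_eq_mul, he]
    simp only [hX] at hc
    field_simp at hc ⊢
    linear_combination hc

/-- `(f - g)/(2πi)` is continuous and integer valued on an interval, hence constant. This is the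
uniqueness of the logarithmic monodromy. -/
lemma sub_eq_of_exp_eq {f g : ℝ → ℂ} (hf : ContinuousOn f (Icc 0 1))
    (hg : ContinuousOn g (Icc 0 1)) (h : ∀ t ∈ Icc (0 : ℝ) 1, Complex.exp (f t) = Complex.exp (g t)) :
    f 1 - f 0 = g 1 - g 0 := by
  have hpi : (2 * Real.pi * Complex.I : ℂ) ≠ 0 := Complex.two_pi_I_ne_zero
  set k : ℝ → ℝ := fun t => ((f t - g t) / (2 * Real.pi * Complex.I)).re with hk
  have hkey (t : ℝ) (ht : t ∈ Icc (0 : ℝ) 1) : ∃ n : ℤ, f t - g t = n * (2 * Real.pi * Complex.I) := by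
    obtain ⟨n, hn⟩ := Complex.exp_eq_exp_iff_exists_int.mp (h t ht)
    exact ⟨n, by rw [hn]; ring⟩
  have hkc : ContinuousOn k (Icc 0 1) :=
    Complex.continuous_re.comp_continuousOn ((hf.sub hg).div_const _)
  have hdisc : IsDiscrete (range ((↑) : ℤ → ℝ)) := isDiscrete_iff_discreteTopology.mpr
    Int.isClosedEmbedding_coe_real.isEmbedding.toHomeomorph.symm.isEmbedding.discreteTopology
  have hmaps : MapsTo k (Icc 0 1) (range ((↑) : ℤ → ℝ)) := fun t ht => by
    obtain ⟨n, hn⟩ := hkey t ht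
    refine ⟨n, ?_⟩
    simp only [hk]
    rw [hn, mul_div_cancel_right₀ _ hpi, Complex.intCast_re]
  have hconst := isPreconnected_Icc.constant_of_mapsTo hdisc hkc hmaps
    (left_mem_Icc.mpr zero_le_one) (right_mem_Icc.mpr zero_le_one)
  obtain ⟨m, hm⟩ := hkey 0 (left_mem_Icc.mpr zero_le_one)
  obtain ⟨n, hn⟩ := hkey 1 (right_mem_Icc.mpr zero_le_one)
  simp only [hk] at hconst
  rw [hm, hn, mul_div_cancel_right₀ _ hpi, mul_div_cancel_right₀ _ hpi, Complex.intCast_re,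
    Complex.intCast_re] at hconst
  have hmn : (m : ℂ) = n := by exact_mod_cast hconst
  rw [← hmn] at hn
  linear_combination hn - hm

lemma smul_left_injective_sixth {L : PeriodPair} {a b : ℂ} :
    a • sixth (dzSq L) = b • sixth (dzSq L) ↔ a = b :=
  (smul_left_injective ℂ (sixth_dzSq_ne_zero L)).eq_iff

/-- The defining condition says that `6θ` is a logarithm of `(w')⁻⁶ Δ⁻¹` along `γ`, and continuous
logarithms of that function grow by `6e - d`. -/
lemma isLogMonodromy_iff {S : Curve} {L : ℂ → PeriodPair} {w : ℂ → ℂ} {γ : ℝ → ℂ} {d e : ℂ}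
    (hd : HasLogIncrement (fun t => S.Δ.eval (γ t)) d)
    (he : HasLogIncrement (fun t => (deriv w (γ t))⁻¹) e) (η : ℝ) :
    IsLogMonodromy S L w γ η ↔ e - d / 6 = -(Real.pi * Complex.I / 2) * η := by
  have hcond (t : ℝ) (θ : ℂ) : sixth (coordFrame L w (γ t)) =
      Complex.exp θ ^ 6 • canonicalSection S L (γ t) ↔
      Complex.exp (6 * θ) = (deriv w (γ t))⁻¹ ^ 6 * (S.Δ.eval (γ t))⁻¹ := by
    have hne := hd.ne_zero t
    rw [coordFrame, sixth_smul, canonicalSection_eq, smul_smul, smul_left_injective_sixth,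
      ← Complex.exp_nat_mul, ← div_eq_mul_inv, eq_div_iff hne, eq_comm]
    norm_num
  obtain ⟨l, hl, hl', hlinc⟩ := (he.pow 6).mul hd.inv
  constructor
  · rintro ⟨θ, hθ, hθ', hinc⟩
    have := sub_eq_of_exp_eq (f := fun t => 6 * θ t) (g := l) (continuousOn_const.mul hθ)
      hl.continuous.continuousOn fun t ht => by rw [hl', (hcond t _).mp (hθ' t ht)]
    rw [← hinc]
    push_cast at hlinc
    linear_combination -(1 / 6 : ℂ) * (this + hlinc)
  · intro h
    refine ⟨fun t => l t / 6, (hl.continuous.div_const 6).continuousOn, fun t _ => ?_, ?_⟩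
    · rw [hcond, mul_div_cancel₀ _ (by norm_num), hl']
    · rw [← h]
      push_cast at hlinc
      linear_combination (1 / 6 : ℂ) * hlinc

/-! ### The two kinds of loops -/

lemma hasLogIncrement_exp_mul (c : ℂ) :
    HasLogIncrement (fun t => Complex.exp (t * c)) c :=
  ⟨fun t => t * c, (Complex.ofRealCLM.differentiable).mul_const c, fun _ => rfl, by simp⟩

/-- The path `1 + z` stays in the unit disc about 1, where the principal logarithm is smooth. -/
lemma hasLogIncrement_one_add {z : ℝ → ℂ} (hz : Differentiable ℝ z) (hz1 : ∀ t, ‖z t‖ < 1)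
    (hz' : z 1 = z 0) : HasLogIncrement (fun t => 1 + z t) 0 := by
  have hs (t : ℝ) : 1 + z t ∈ Complex.slitPlane := Complex.mem_slitPlane_of_norm_lt_one (hz1 t)
  refine ⟨fun t => Complex.log (1 + z t), ?_, fun t => Complex.exp_log ?_, by simp only [hz', sub_self]⟩
  · exact fun t => (((hz t).hasDerivAt.const_add 1).clog_real (hs t)).differentiableAt
  · exact Complex.slitPlane_ne_zero (hs t)

lemma norm_exp_ofReal_mul_two_pi_I (t : ℝ) : ‖Complex.exp (t * (2 * Real.pi * Complex.I))‖ = 1 := by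
  rw [show (t : ℂ) * (2 * Real.pi * Complex.I) = ((t * (2 * Real.pi) : ℝ) : ℂ) * Complex.I by
    push_cast; ring]
  exact Complex.norm_exp_ofReal_mul_I _

lemma norm_exp_ofReal_mul_neg_two_pi_I (t : ℝ) :
    ‖Complex.exp (t * -(2 * Real.pi * Complex.I))‖ = 1 := by
  rw [mul_neg, Complex.exp_neg, norm_inv, norm_exp_ofReal_mul_two_pi_I, inv_one]

lemma clockwiseLoop_eq (r : ℂ) (ε t : ℝ) : clockwiseLoop r ε t =
    r + ε * Complex.exp (t * -(2 * Real.pi * Complex.I)) := by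
  rw [clockwiseLoop]; congr 3; ring

lemma loopAtInfinity_eq (R t : ℝ) : loopAtInfinity R t =
    R * Complex.exp (t * (2 * Real.pi * Complex.I)) := by
  rw [loopAtInfinity]; congr 2; ring

lemma differentiable_exp_ofReal_mul (c : ℂ) :
    Differentiable ℝ fun t : ℝ => Complex.exp (t * c) := fun _ =>
  ((Complex.ofRealCLM.differentiableAt).mul_const c).cexp

lemma differentiable_clockwiseLoop (r : ℂ) (ε : ℝ) : Differentiable ℝ (clockwiseLoop r ε) := by
  rw [funext (clockwiseLoop_eq r ε)]
  exact ((differentiable_exp_ofReal_mul _).const_mul _).const_add _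

lemma differentiable_loopAtInfinity (R : ℝ) : Differentiable ℝ (loopAtInfinity R) := by
  rw [funext (loopAtInfinity_eq R)]
  exact (differentiable_exp_ofReal_mul _).const_mul _

lemma clockwiseLoop_one (r : ℂ) (ε : ℝ) : clockwiseLoop r ε 1 = clockwiseLoop r ε 0 := by
  simp [clockwiseLoop, Complex.exp_neg]

lemma loopAtInfinity_one (R : ℝ) : loopAtInfinity R 1 = loopAtInfinity R 0 := by
  simp [loopAtInfinity]

lemma hasLogIncrement_clockwiseLoop_sub (r : ℂ) {ε : ℝ} (hε : 0 < ε) :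
    HasLogIncrement (fun t => clockwiseLoop r ε t - r) (-(2 * Real.pi * Complex.I)) := by
  have hε0 : (ε : ℂ) ≠ 0 := by exact_mod_cast hε.ne'
  have := (hasLogIncrement_const hε0).mul (hasLogIncrement_exp_mul (-(2 * Real.pi * Complex.I)))
  simpa only [clockwiseLoop_eq, add_sub_cancel_left, zero_add] using this

lemma hasLogIncrement_clockwiseLoop_sub_of_lt {r r' : ℂ} {ε : ℝ} (hε : 0 < ε)
    (h : ε < dist r' r) : HasLogIncrement (fun t => clockwiseLoop r ε t - r') 0 := by
  have hne : r - r' ≠ 0 := by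
    rw [sub_ne_zero]; rintro rfl; rw [dist_self] at h; linarith
  have hn : ε < ‖r - r'‖ := by rwa [← dist_eq_norm, dist_comm]
  -- `u - r' = (r - r') (1 + (u - r)/(r - r'))`, and the last quotient has modulus less than 1 on
  -- the circle.
  have h1 := (hasLogIncrement_const hne).mul (hasLogIncrement_one_add
    (z := fun t => ε / (r - r') * Complex.exp (t * -(2 * Real.pi * Complex.I)))
    ((differentiable_exp_ofReal_mul _).const_mul _) (fun t => by
      rw [norm_mul, norm_exp_ofReal_mul_neg_two_pi_I, mul_one, norm_div, Complex.norm_real,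
        Real.norm_of_nonneg hε.le, div_lt_one (hε.trans hn)]
      exact hn) (by simp [Complex.exp_neg]))
  rw [zero_add] at h1
  convert h1 using 2 with t
  rw [clockwiseLoop_eq]
  field_simp
  ring

lemma hasLogIncrement_loopAtInfinity {R : ℝ} (hR : 0 < R) :
    HasLogIncrement (loopAtInfinity R) (2 * Real.pi * Complex.I) := by
  have hR0 : (R : ℂ) ≠ 0 := by exact_mod_cast hR.ne'
  have := (hasLogIncrement_const hR0).mul (hasLogIncrement_exp_mul (2 * Real.pi * Complex.I))
  rw [funext (loopAtInfinity_eq R)]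
  simpa only [zero_add] using this

lemma hasLogIncrement_loopAtInfinity_sub {R : ℝ} {r : ℂ} (h : ‖r‖ < R) :
    HasLogIncrement (fun t => loopAtInfinity R t - r) (2 * Real.pi * Complex.I) := by
  have hR : 0 < R := (norm_nonneg r).trans_lt h
  have hR0 : (R : ℂ) ≠ 0 := by exact_mod_cast hR.ne'
  -- `u - r = u (1 - r/u)` with `|r/u| < 1`, so `r` contributes the same increment as the origin.
  have h1 := (hasLogIncrement_loopAtInfinity hR).mul (hasLogIncrement_one_add
    (z := fun t => -(r / R) * Complex.exp (t * -(2 * Real.pi * Complex.I)))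
    ((differentiable_exp_ofReal_mul _).const_mul _) (fun t => by
      rw [norm_mul, norm_exp_ofReal_mul_neg_two_pi_I, mul_one, norm_neg, norm_div,
        Complex.norm_real, Real.norm_of_nonneg hR.le, div_lt_one hR]
      exact h) (by simp [Complex.exp_neg]))
  rw [add_zero] at h1
  convert h1 using 2 with t
  have he := Complex.exp_ne_zero ((t : ℂ) * (2 * Real.pi * Complex.I))
  rw [loopAtInfinity_eq, mul_neg, Complex.exp_neg]
  field_simp
  ring

lemma Curve.card_roots (S : Curve) : Multiset.card S.Δ.roots = S.Nf + 2 := by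
  rw [← S.natDegree_discr, ← Curve.Δ]
  exact (IsAlgClosed.splits S.Δ).natDegree_eq_card_roots.symm

lemma Curve.hasLogIncrement_node (S : Curve) {r : ℂ} (hr : S.Δ.IsRoot r) {ε : ℝ} (hε : 0 < ε)
    (h : ∀ r' : ℂ, S.Δ.IsRoot r' → r' ≠ r → ε < dist r' r) :
    HasLogIncrement (fun t => S.Δ.eval (clockwiseLoop r ε t)) (-(2 * Real.pi * Complex.I)) := by
  classical
  have h1 := S.hasLogIncrement_Δ (γ := clockwiseLoop r ε)
    (d := fun r' => if r' = r then -(2 * Real.pi * Complex.I) else 0) fun r' hr' => by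
      split_ifs with h0
      · rw [h0]; exact hasLogIncrement_clockwiseLoop_sub r hε
      · exact hasLogIncrement_clockwiseLoop_sub_of_lt hε (h r' hr' h0)
  have hmem : r ∈ S.Δ.roots := (Polynomial.mem_roots S.Δ_ne_zero).mpr hr
  have h2 : (S.Δ.roots.map fun r' => if r' = r then -(2 * Real.pi * Complex.I : ℂ) else 0).sum =
      -(2 * Real.pi * Complex.I) := by
    -- Simplicity of the zeros enters here: `r` is counted once.
    rw [Multiset.sum_map_eq_nsmul_single r fun r' hr' _ => if_neg hr',
      Multiset.count_eq_one_of_mem (show S.Δ.roots.Nodup from S.nodup_roots) hmem, one_smul,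
      if_pos rfl]
  rwa [h2] at h1

lemma Curve.hasLogIncrement_infinity (S : Curve) {R : ℝ} (h : ∀ r : ℂ, S.Δ.IsRoot r → ‖r‖ < R) :
    HasLogIncrement (fun t => S.Δ.eval (loopAtInfinity R t))
      ((S.Nf + 2) * (2 * Real.pi * Complex.I)) := by
  have h1 := S.hasLogIncrement_Δ (γ := loopAtInfinity R)
    (d := fun _ => 2 * Real.pi * Complex.I) fun r hr => hasLogIncrement_loopAtInfinity_sub (h r hr)
  rw [Multiset.map_const', Multiset.sum_replicate, S.card_roots, nsmul_eq_mul] at h1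
  push_cast at h1
  exact h1

lemma Curve.radius_pos (S : Curve) {R : ℝ} (h : ∀ r : ℂ, S.Δ.IsRoot r → ‖r‖ < R) : 0 < R := by
  have hc : 0 < Multiset.card S.Δ.roots := by rw [S.card_roots]; omega
  obtain ⟨r, hr⟩ := Multiset.card_pos_iff_exists_mem.mp hc
  exact (norm_nonneg r).trans_lt (h r (Polynomial.isRoot_of_mem_roots hr))

lemma inv_deriv_neg_one_div (u : ℂ) : (deriv (fun u : ℂ => -1 / u) u)⁻¹ = u ^ 2 := by
  have : (fun u : ℂ => -1 / u) = fun u => -(u⁻¹) := by ext u; rw [neg_div, one_div]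
  rw [this, deriv.fun_neg, deriv_inv, neg_neg, inv_inv]

end SeibergWitten

end

/-! ### The main theorem -/

theorem mainTheorem10 (S : SeibergWitten.Curve) :
    -- every smooth fibre is a complex torus `ℂ / Λ_u`
    (∃ L : ℂ → PeriodPair, S.IsPeriods L) ∧
    ∀ L : ℂ → PeriodPair, S.IsPeriods L →
      -- the section trivializes `(DET D)^{* ⊗ 6}` holomorphically over the smooth locus
      (SeibergWitten.IsHolDetDualPow L S.smoothLocus (SeibergWitten.canonicalSection S L) ∧
        (∀ u ∈ S.smoothLocus, SeibergWitten.canonicalSection S L u ≠ 0) ∧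
        (∀ u ∈ S.smoothLocus, ∀ x : SeibergWitten.DetDualPow (L u),
          ∃! c : ℂ, x = c • SeibergWitten.canonicalSection S L u)) ∧
      -- it does not depend on the choice of the sixth root, and it is flat
      (∀ u ∈ S.smoothLocus, ∀ c : ℂ, c ^ 6 = S.Δ.eval u →
        SeibergWitten.sixth (c • SeibergWitten.dzSq (L u)) =
          SeibergWitten.canonicalSection S L u) ∧
      SeibergWitten.IsParallelDualPow L S.smoothLocus (SeibergWitten.canonicalSection S L) ∧
      -- logarithmic monodromy around a node
      (∀ r : ℂ, S.Δ.IsRoot r → ∀ ε : ℝ, 0 < ε →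
        (∀ r' : ℂ, S.Δ.IsRoot r' → r' ≠ r → ε < dist r' r) →
        (∀ η : ℝ, SeibergWitten.IsLogMonodromy S L (fun u => u)
          (SeibergWitten.clockwiseLoop r ε) η ↔ η = -2 / 3) ∧
        SeibergWitten.HasHolonomy L (SeibergWitten.clockwiseLoop r ε)
          (Complex.exp (-(Real.pi * Complex.I / 2) * (-2 / 3)))) ∧
      -- logarithmic monodromy around the fibre at infinity
      (∀ R : ℝ, (∀ r : ℂ, S.Δ.IsRoot r → ‖r‖ < R) →
        (∀ η : ℝ, SeibergWitten.IsLogMonodromy S L (fun u => -1 / u)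
          (SeibergWitten.loopAtInfinity R) η ↔ η = -(2 * (10 - (S.Nf : ℝ)) / 3)) ∧
        SeibergWitten.HasHolonomy L (SeibergWitten.loopAtInfinity R)
          (Complex.exp (-(Real.pi * Complex.I / 2) * (-(2 * (10 - (S.Nf : ℂ)) / 3))))) := by
  have hpiI : (Real.pi * Complex.I / 2 : ℂ) ≠ 0 := by simp [Real.pi_ne_zero]
  refine ⟨SeibergWitten.Curve.exists_isPeriods S, fun L h => ⟨⟨?_, ?_, ?_⟩, ?_, ?_, ?_, ?_⟩⟩
  · exact fun u₀ _ => ⟨Set.univ, _, _, fun u => S.Δ.eval u, Set.mem_univ _,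
      SeibergWitten.isHodgeFrame_unit00_dz10 L, SeibergWitten.analyticAt_polynomial_eval _ _,
      fun u _ => SeibergWitten.canonicalSection_eq S L u⟩
  · intro u hu
    rw [SeibergWitten.canonicalSection_eq]
    intro h0
    exact hu (SeibergWitten.smul_left_injective_sixth.mp (h0.trans (zero_smul ℂ _).symm))
  · intro u hu x
    have hu' : S.Δ.eval u ≠ 0 := hu
    obtain ⟨c, rfl⟩ := SeibergWitten.exists_eq_smul_sixth x
    simp only [SeibergWitten.canonicalSection_eq, smul_smul,
      SeibergWitten.smul_left_injective_sixth]
    exact ⟨c / S.Δ.eval u, (div_mul_cancel₀ _ hu').symm, fun b hb => by rw [hb]; field_simp⟩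
  · intro u _ c hc
    rw [SeibergWitten.sixth_smul, hc, SeibergWitten.canonicalSection_eq]
  · exact SeibergWitten.isParallelDualPow_canonicalSection h
  · intro r hr ε hε hsep
    have hd := S.hasLogIncrement_node hr hε hsep
    constructor
    · intro η
      have he : SeibergWitten.HasLogIncrement
          (fun t => (deriv (fun u : ℂ => u) (SeibergWitten.clockwiseLoop r ε t))⁻¹) 0 := by
        simpa using SeibergWitten.hasLogIncrement_const one_ne_zero
      rw [SeibergWitten.isLogMonodromy_iff hd he]
      -- The framing does not turn, so the increment of `θ` is `πi/3`.
      have e1 : (0 : ℂ) - -(2 * Real.pi * Complex.I) / 6 =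
          -(Real.pi * Complex.I / 2) * ((-2 / 3 : ℝ) : ℂ) := by push_cast; ring
      rw [e1, mul_right_inj' (neg_ne_zero.mpr hpiI), Complex.ofReal_inj, eq_comm]
    · convert SeibergWitten.hasHolonomy_of_hasLogIncrement h
        (SeibergWitten.differentiable_clockwiseLoop r ε)
        (SeibergWitten.clockwiseLoop_one r ε) hd using 2
      ring
  · intro R hR
    have hd := S.hasLogIncrement_infinity hR
    constructor
    · intro η
      have he : SeibergWitten.HasLogIncrement
          (fun t => (deriv (fun u : ℂ => -1 / u) (SeibergWitten.loopAtInfinity R t))⁻¹)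
          ((2 : ℕ) * (2 * Real.pi * Complex.I)) := by
        simp only [SeibergWitten.inv_deriv_neg_one_div]
        exact (SeibergWitten.hasLogIncrement_loopAtInfinity (S.radius_pos hR)).pow 2
      rw [SeibergWitten.isLogMonodromy_iff hd he]
      -- The framing `u²` turns twice: `4πi - (Nf + 2) πi/3 = πi (10 - Nf)/3`.
      have e1 : ((2 : ℕ) : ℂ) * (2 * Real.pi * Complex.I) -
          (S.Nf + 2) * (2 * Real.pi * Complex.I) / 6 =
          -(Real.pi * Complex.I / 2) * ((-(2 * (10 - (S.Nf : ℝ)) / 3) : ℝ) : ℂ) := by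
        push_cast; ring
      rw [e1, mul_right_inj' (neg_ne_zero.mpr hpiI), Complex.ofReal_inj, eq_comm]
    · convert SeibergWitten.hasHolonomy_of_hasLogIncrement h
        (SeibergWitten.differentiable_loopAtInfinity R)
        (SeibergWitten.loopAtInfinity_one R) hd using 1
      -- The contribution `4πi` of the framing disappears under the exponential.
      have e2 : -(Real.pi * Complex.I / 2) * (-(2 * (10 - (S.Nf : ℂ)) / 3)) =
          -((S.Nf + 2) * (2 * Real.pi * Complex.I) / 6) + (2 : ℕ) * (2 * Real.pi * Complex.I) := by
        push_cast; ring
      rw [e2, Complex.exp_add, Complex.exp_nat_mul_two_pi_mul_I, mul_one]
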